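/- **Setting.** The *size* of a circle is its area; $\mathrm{tot}(C)$ is the total area of a finite set $C$ of circles. A packing of circles into a region $R$ places every circle (as a closed disc) inside $R$ so that the interiors are pairwise disjoint. The *critical density* of $R$ is the largest $a$ such that every finite set of circles with $\mathrm{tot}\le a$ can be packed into $R$. For $s\ge 1$, an $s$-right-angled triangle has legs $s\ell,\ell$; its *long* (*short*) corner is the end of the longer (shorter) leg away from the right angle. Its *capacity* is the area of its incircle; the capacity of a square is the total area of the incircles of its two halves along a diagonal. (A degenerate triangle, a point of capacity $0$, may occur as a node.) A corner has a *$b$-curve* if it is trimmed to an arc of a circle of area $b$ fitting snugly into the corner. A *$b$-semihat* has a $b$-curve at the long corner, a *$b$-hat* at both the long and the short corner, and a *$b$-$b'$-semihat* has a $\max\{b,b'\}$-curve at the long and a $b'$-curve at the short corner; $b=0$ means no trimming. The capacity of such a shape is that of the underlying triangle. **Splitting a triangle.** The altitude onto the hypotenuse divides a triangle $T$ of capacity $a$ into two triangles similar to $T$, of capacities $a_{lg}^*$ (at the long corner) and $a_{sh}^*$ (at the short corner). The *long (short) child* of capacity $x$ is the image of the first (second) of these under the homothety centred at the long (short) corner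 of $T$ that gives it capacity $x$. A $b$-semihat is split with capacities $(a_L,a_R)$ into a left (long) and a right (short) child: if $a_L\ge a_{lg}^*$, the left child is a $b$-$b_{lg}$-semihat and the right child a full triangle; otherwise the left child is a $b$-semihat and the right child a $b_{sh}$-semihat. Here $b_{lg}$ (resp. $b_{sh}$) is the smallest value such that the long (short) child with that curve at its short (long) corner fits within $T$. **Splitting a square** of capacity $a$ with capacities $(a_L,a_R)$, where $a_L\ge a/2$: the two half-squares are scaled about two opposite corners of the square to have capacities $a_L,a_R$. The left child is the first with a $b$-curve at both acute corners, with the smallest $b$ for which it fits in the square; the right child is the second, a full triangle. **Split Packing** of circles $C$ into a triangle $T$: a single circle is put at the incentre. Otherwise, go through $C$ from largest to smallest, adding each circle to $C_1$ if $\mathrm{tot}(C_1)/a_{lg}^*\le \mathrm{tot}(C_2)/a_{sh}^*$ and else to $C_2$; then pack $C_1$ and $C_2$ recursively into the long and short children of capacities $\mathrm{tot}(C_1)$ and $\mathrm{tot}(C_2)$. For hats and semihats the underlying triangle is used. **Repack$(C,S)$** ($S$ a square or semihat of capacity $a$) chooses $C=C_L\sqcup C_R$ and $a_L,a_R$, splits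 $S$, packs $C_L$ into the left child by Split Packing, and calls Repack on $C_R$ and the right child (indefinitely). Unless stated otherwise, $a_L=\mathrm{tot}(C_L)$ and $a_R=a-a_L$. *Triangles*, the first case that applies: (1) if some circle is larger than $a_{lg}^*$, $C_L$ consists of the largest circle; (2) if $\mathrm{tot}(C)\le a_{lg}^*$, $C_L=C$, $a_L=a_{lg}^*$, $a_R=a_{sh}^*$; (3) go through $C$ from largest to smallest, adding a circle to $C_L$ whenever $\mathrm{tot}(C_L)$ stays $\le a_{lg}^*$; keep this $C_L$ if $\delta:=(a_{lg}^*-\mathrm{tot}(C_L))/a<\bigl(1-\tfrac1{2\sqrt{1+s^2}-1}\bigr)^2$; (4) otherwise, $C_L$ consists of the two largest circles. *Squares*: if $\mathrm{tot}(C)>a/2$, start with $C_L=C$ and go through $C$ from largest to smallest, moving a circle to $C_R$ whenever $\mathrm{tot}(C_L)$ stays $\ge a/2$; otherwise $C_L=C$ and $a_L=a_R=a/2$. **Online Split Packing (insertions only).** The tree consists of an infinite right spine, whose nodes are called *rightmost nodes*, together with their left children. The circles contained in a node are those it was assigned, including those of its descendants. Initially the tree is Repack$(\emptyset,\text{root})$.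 A rightmost node is *tight* if the total size of the circles in its left child equals the capacity of the left child. To insert $c$ at a rightmost node $S$ with right child $R$ (starting at the root): if $S$ is tight or $\mathrm{tot}(R)+\mathrm{size}(c)<\mathrm{capacity}(R)$, insert $c$ at $R$; otherwise call Repack on $S$ and the circles contained in $S$ together with $c$. Ties between circles of equal size are broken arbitrarily. **Packing Invariant**: every rightmost node $S$, with the circles $C$ it contains, is a square or a $b$-semihat with $b\ge0$; $\mathrm{tot}(C)\le\mathrm{capacity}(S)$; and if $S$ is a $b$-semihat with $b>0$, some circle in $C$ has size at least $b$. **Theorem.** Let the root be a nondegenerate square or (full) right-angled triangle. Its capacity is its critical density. For every finite sequence of circles of positive size inserted one after another, with total size at most the capacity of the root, every insertion terminates, and initially and after every insertion the tree contains exactly the circles inserted so far and 1. every node of the tree (rightmost node or left child) is validly packed: each circle contained in the node has been assigned exactly one position, all these circles lie within the bounds of the node, and no two of them overlap; 2. the Packing Invariant holds. In particular all inserted circles are always validly packed in the root, i.e. the algorithm packs to critical density. -/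

import Mathlib

/-! ### Discs and packings -/

/-- The Euclidean plane. -/
abbrev Plane := EuclideanSpace ℝ (Fin 2)

/-- The size of a circle is its area; this is the radius of a circle of size `a`. -/
noncomputable def discRadius (a : ℝ) : ℝ := Real.sqrt (a / Real.pi)

/-- The circles in the list `C` (circle `i` has area `size i`) are validly packed in the region `R`
by the placement `P`, where `P i p` says that circle `i` is placed with centre `p`:
`P` gives exactly one centre to each circle of `C` and no centre to anything else, all the circles
lie within `R`, and no two of them overlap. -/
def ValidlyPacked (size : ℕ → ℝ) (R : Set Plane) (C : List ℕ) (P : ℕ → Plane → Prop) : Prop :=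
  ∃ center : ℕ → Plane,
    (∀ i p, P i p ↔ i ∈ C ∧ p = center i) ∧
    (∀ i ∈ C, Metric.closedBall (center i) (discRadius (size i)) ⊆ R) ∧
    (∀ i ∈ C, ∀ j ∈ C, i ≠ j →
      Disjoint (Metric.ball (center i) (discRadius (size i)))
        (Metric.ball (center j) (discRadius (size j))))

/-- Finitely many circles with the given areas can be packed into `R` without overlap. -/
def CanPack (R : Set Plane) {n : ℕ} (area : Fin n → ℝ) : Prop :=
  ∃ center : Fin n → Plane,
    (∀ i, Metric.closedBall (center i) (discRadius (area i)) ⊆ R) ∧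
    (∀ i j, i ≠ j →
      Disjoint (Metric.ball (center i) (discRadius (area i)))
        (Metric.ball (center j) (discRadius (area j))))

/-- `a` is the critical density of `R`: the largest value such that every finite family of circles
of total area at most `a` can be packed into `R`. -/
def IsCriticalDensity (R : Set Plane) (a : ℝ) : Prop :=
  IsGreatest {A : ℝ | ∀ (n : ℕ) (area : Fin n → ℝ),
    (∀ i, 0 < area i) → ∑ i, area i ≤ A → CanPack R area} a

/-- Total size of a collection of circles. -/
noncomputable def totalSize (size : ℕ → ℝ) (C : List ℕ) : ℝ := (C.map size).sum

/-! ### Right-angled triangles and hats -/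

/-- A triangle with ordered vertices. For a right-angled triangle, `right` is the vertex at the right
angle, `long` is the other end of the longer leg (the corner of the long side) and `short` is the
other end of the shorter leg (the corner of the short side). -/
structure Triangle where
  right : Plane
  long : Plane
  short : Plane

namespace Triangle

/-- `T` is an `s`-right-angled triangle for some `s ≥ 1`: the legs are orthogonal and of lengths
`s * ℓ` and `ℓ`. (The degenerate triangle `ℓ = 0`, a point, of capacity `0`, is allowed.) -/
def IsRightAngled (T : Triangle) : Prop :=
  inner ℝ (T.long - T.right) (T.short - T.right) = 0 ∧
    ∃ s : ℝ, 1 ≤ s ∧ dist T.right T.long = s * dist T.right T.short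

/-- The ratio of the two legs. -/
noncomputable def ratio (T : Triangle) : ℝ := dist T.right T.long / dist T.right T.short

/-- The inradius of a right-angled triangle. -/
noncomputable def inradius (T : Triangle) : ℝ :=
  (dist T.right T.long + dist T.right T.short - dist T.long T.short) / 2

/-- The capacity of a right-angled triangle: the area of its incircle. -/
noncomputable def capacity (T : Triangle) : ℝ := Real.pi * T.inradius ^ 2

/-- The incentre: the average of the vertices weighted by the lengths of the opposite sides. -/
noncomputable def incenter (T : Triangle) : Plane :=
  (dist T.long T.short + dist T.right T.short + dist T.right T.long)⁻¹ •
    (dist T.long T.short • T.right + dist T.right T.short • T.long + dist T.right T.long • T.short)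

/-- The foot of the altitude from the right angle to the hypotenuse. -/
noncomputable def foot (T : Triangle) : Plane :=
  T.long + (dist T.right T.long ^ 2 / dist T.long T.short ^ 2) • (T.short - T.long)

/-- The long side of the ideal split: the part of `T` between the altitude and the long corner. -/
noncomputable def idealLong (T : Triangle) : Triangle := ⟨T.foot, T.long, T.right⟩

/-- The short side of the ideal split: the part of `T` between the altitude and the short corner. -/
noncomputable def idealShort (T : Triangle) : Triangle := ⟨T.foot, T.right, T.short⟩

/-- The image of `T` under the homothety with centre `z` and factor `t`. -/
noncomputable def scale (T : Triangle) (z : Plane) (t : ℝ) : Triangle :=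
  ⟨z + t • (T.right - z), z + t • (T.long - z), z + t • (T.short - z)⟩

/-- The (untrimmed) long child of capacity `a`: the triangle similar to `T`, cut off by a
perpendicular to the hypotenuse, whose incircle has area `a` and is squeezed into the long corner. -/
noncomputable def longChild (T : Triangle) (a : ℝ) : Triangle :=
  T.idealLong.scale T.long (Real.sqrt (a / T.idealLong.capacity))

/-- The (untrimmed) short child of capacity `a`, whose incircle is squeezed into the short corner. -/
noncomputable def shortChild (T : Triangle) (a : ℝ) : Triangle :=
  T.idealShort.scale T.short (Real.sqrt (a / T.idealShort.capacity))

/-- The bounds of the full triangle. -/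
def region (T : Triangle) : Set Plane := convexHull ℝ {T.right, T.long, T.short}

end Triangle

/-- The angle with apex `v` and sides through `p` and `q`. -/
def angleAt (v p q : Plane) : Set Plane :=
  {x | ∃ s t : ℝ, 0 ≤ s ∧ 0 ≤ t ∧ x = v + s • (p - v) + t • (q - v)}

/-- The angle with apex `v` and sides through `p` and `q`, with the corner trimmed to an arc of a
circle of area `b` fitting snugly into the corner. What remains is the part of the angle that can be
covered by a disc of area `b` lying in the angle. -/
noncomputable def roundedAngle (v p q : Plane) (b : ℝ) : Set Plane :=
  {x | ∃ z, x ∈ Metric.closedBall z (discRadius b) ∧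
    Metric.closedBall z (discRadius b) ⊆ angleAt v p q}

/-- A triangle with a `bLong`-curve on the long side and a `bShort`-curve on the short side.
Full triangle: `bLong = bShort = 0`; `b`-semihat: `bLong = b`, `bShort = 0`; `b`-hat:
`bLong = bShort = b`; `b`-`b'`-semihat: `bLong = max b b'`, `bShort = b'`. -/
structure Hat where
  tri : Triangle
  bLong : ℝ
  bShort : ℝ

namespace Hat

/-- The bounds of a hat. -/
noncomputable def region (H : Hat) : Set Plane :=
  H.tri.region ∩ roundedAngle H.tri.long H.tri.right H.tri.short H.bLong ∩
    roundedAngle H.tri.short H.tri.right H.tri.long H.bShort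

/-- A `b`-semihat, for some `b ≥ 0` (namely `H.bLong`), from a right-angled triangle. -/
def IsSemihat (H : Hat) : Prop := H.tri.IsRightAngled ∧ 0 ≤ H.bLong ∧ H.bShort = 0

end Hat

namespace Triangle

/-- The full triangle as a hat. -/
def full (T : Triangle) : Hat := ⟨T, 0, 0⟩

/-- The smallest `b` such that the long child of capacity `a` with a `b`-curve on its short side
fits within the bounds of `T`. -/
noncomputable def longCurve (T : Triangle) (a : ℝ) : ℝ :=
  sInf {b | 0 ≤ b ∧ (⟨T.longChild a, 0, b⟩ : Hat).region ⊆ T.region}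

/-- The smallest `b` such that the short child of capacity `a` with a `b`-curve on its long side
fits within the bounds of `T`. -/
noncomputable def shortCurve (T : Triangle) (a : ℝ) : ℝ :=
  sInf {b | 0 ≤ b ∧ (⟨T.shortChild a, b, 0⟩ : Hat).region ⊆ T.region}

end Triangle

open Classical in
/-- Splitting a semihat into a left (long) child of capacity `aL` and a right (short) child of
capacity `aR`. -/
noncomputable def Hat.split (H : Hat) (aL aR : ℝ) : Hat × Hat :=
  if H.tri.idealLong.capacity ≤ aL then
    (⟨H.tri.longChild aL, max H.bLong (H.tri.longCurve aL), H.tri.longCurve aL⟩,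
      ⟨H.tri.shortChild aR, 0, 0⟩)
  else
    (⟨H.tri.longChild aL, H.bLong, 0⟩, ⟨H.tri.shortChild aR, H.tri.shortCurve aR, 0⟩)

/-! ### Squares -/

/-- A square, given by a corner and the two adjacent corners. -/
structure Square where
  corner : Plane
  adj₁ : Plane
  adj₂ : Plane

namespace Square

/-- The three points do span a nondegenerate square. -/
def IsSquare (Q : Square) : Prop :=
  inner ℝ (Q.adj₁ - Q.corner) (Q.adj₂ - Q.corner) = 0 ∧
    dist Q.corner Q.adj₁ = dist Q.corner Q.adj₂ ∧ 0 < dist Q.corner Q.adj₁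

/-- The corner opposite to `corner`. -/
noncomputable def opposite (Q : Square) : Plane := Q.adj₁ + Q.adj₂ - Q.corner

def region (Q : Square) : Set Plane :=
  {x | ∃ s t : ℝ, s ∈ Set.Icc 0 1 ∧ t ∈ Set.Icc 0 1 ∧
    x = Q.corner + s • (Q.adj₁ - Q.corner) + t • (Q.adj₂ - Q.corner)}

/-- The half of the square on the side of `corner` of the diagonal. -/
def half₁ (Q : Square) : Triangle := ⟨Q.corner, Q.adj₁, Q.adj₂⟩

/-- The half of the square on the other side of the diagonal. -/
noncomputable def half₂ (Q : Square) : Triangle := ⟨Q.opposite, Q.adj₂, Q.adj₁⟩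

/-- The capacity of a square: the total area of the incircles of its two halves. -/
noncomputable def capacity (Q : Square) : ℝ := Q.half₁.capacity + Q.half₂.capacity

/-- The (untrimmed) left child of capacity `a`: an isosceles right-angled triangle whose incircle has
area `a` and which is squeezed into a corner of the square. -/
noncomputable def leftChild (Q : Square) (a : ℝ) : Triangle :=
  Q.half₁.scale Q.corner (Real.sqrt (a / Q.half₁.capacity))

/-- The (untrimmed) right child of capacity `a`, squeezed into the opposite corner. -/
noncomputable def rightChild (Q : Square) (a : ℝ) : Triangle :=
  Q.half₂.scale Q.opposite (Real.sqrt (a / Q.half₂.capacity))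

/-- The smallest `b` such that the left child of capacity `a` with a `b`-curve on both sides fits
within the bounds of the square. -/
noncomputable def curve (Q : Square) (a : ℝ) : ℝ :=
  sInf {b | 0 ≤ b ∧ (⟨Q.leftChild a, b, b⟩ : Hat).region ⊆ Q.region}

/-- Splitting a square into a hat of capacity `aL` (the left child, at least half of the square's
capacity) and a full triangle of capacity `aR` (the right child). -/
noncomputable def split (Q : Square) (aL aR : ℝ) : Hat × Hat :=
  (⟨Q.leftChild aL, Q.curve aL, Q.curve aL⟩, (Q.rightChild aR).full)

end Square

/-! ### The offline Split Packing Algorithm in a right-angled triangle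

Collections of circles are lists in decreasing order of size. -/

open Classical in
/-- `SPLIT` with split key `(f₁, f₂)`, when circles of total sizes `t₁` and `t₂` have already been
put into the two parts: each circle goes to the relatively less filled part (the first one if there
is a tie, so that the largest circle goes to the first part). -/
noncomputable def splitCircles (size : ℕ → ℝ) (f₁ f₂ : ℝ) : ℝ → ℝ → List ℕ → List ℕ × List ℕ
  | _, _, [] => ([], [])
  | t₁, t₂, i :: C =>
    if t₁ / f₁ ≤ t₂ / f₂ then
      let r := splitCircles size f₁ f₂ (t₁ + size i) t₂ C
      (i :: r.1, r.2)
    else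
      let r := splitCircles size f₁ f₂ t₁ (t₂ + size i) C
      (r.1, i :: r.2)

/-- The recursion of the Split Packing Algorithm. A single circle is placed in the centre of the
triangle; several circles are partitioned and packed recursively into the long and short children,
whose capacities are the total sizes of the two parts. The result lists the circles with their
centres. The first argument bounds the recursion depth. -/
noncomputable def splitPackAux (size : ℕ → ℝ) : ℕ → Triangle → List ℕ → List (ℕ × Plane)
  | 0, _, _ => []
  | _ + 1, _, [] => []
  | _ + 1, T, [i] => [(i, T.incenter)]
  | d + 1, T, i :: j :: C =>
    let r := splitCircles size T.idealLong.capacity T.idealShort.capacity 0 0 (i :: j :: C)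
    splitPackAux size d (T.longChild (totalSize size r.1)) r.1 ++
      splitPackAux size d (T.shortChild (totalSize size r.2)) r.2

/-- The Split Packing Algorithm. As every partition of at least two circles of positive sizes has two
nonempty parts, the recursion depth is at most the number of circles. -/
noncomputable def splitPack (size : ℕ → ℝ) (T : Triangle) (C : List ℕ) : List (ℕ × Plane) :=
  splitPackAux size C.length T C

/-! ### The Repack operation -/

/-- A node on the right spine of the tree: a square or a (semi)hat. -/
inductive Shape where
  | square (Q : Square)
  | hat (H : Hat)

namespace Shape

/-- The bounds of a node. -/
noncomputable def region : Shape → Set Plane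
  | square Q => Q.region
  | hat H => H.region

/-- The capacity of a node; that of a hat is that of its underlying triangle. -/
noncomputable def capacity : Shape → ℝ
  | square Q => Q.capacity
  | hat H => H.tri.capacity

/-- The regions that the algorithm packs: a square or a right-angled triangle (nondegenerate, with no
rounded corners). -/
def IsRoot : Shape → Prop
  | square Q => Q.IsSquare
  | hat H => H.tri.IsRightAngled ∧ 0 < dist H.tri.right H.tri.short ∧ H = H.tri.full

end Shape

/-- The decision of `Repack`: the circles and the capacities of the left and right children. -/
structure Division where
  leftCircles : List ℕ
  rightCircles : List ℕ
  leftCapacity : ℝ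
  rightCapacity : ℝ

/-- Pack the left child of a shape of capacity `a` tightly with `CL`, and leave the remaining space
to the right child, which receives `CR`. -/
noncomputable def Division.tight (size : ℕ → ℝ) (a : ℝ) (CL CR : List ℕ) : Division :=
  ⟨CL, CR, totalSize size CL, a - totalSize size CL⟩

open Classical in
/-- From the largest to the smallest, put a circle on the left if the total size there (`t` so far)
stays at most `cap`, and otherwise on the right. -/
noncomputable def greedyFill (size : ℕ → ℝ) (cap : ℝ) : ℝ → List ℕ → List ℕ × List ℕ
  | _, [] => ([], [])
  | t, i :: C =>
    if t + size i ≤ cap then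
      let r := greedyFill size cap (t + size i) C
      (i :: r.1, r.2)
    else
      let r := greedyFill size cap t C
      (r.1, i :: r.2)

open Classical in
/-- All circles start on the left, with total size `t`. From the largest to the smallest, move a
circle to the right if the total size on the left stays at least `h`. -/
noncomputable def greedyRemove (size : ℕ → ℝ) (h : ℝ) : ℝ → List ℕ → List ℕ × List ℕ
  | _, [] => ([], [])
  | t, i :: C =>
    if h ≤ t - size i then
      let r := greedyRemove size h (t - size i) C
      (r.1, i :: r.2)
    else
      let r := greedyRemove size h t C
      (i :: r.1, r.2)

/-- The threshold `δ_sh` of an `s`-right-angled triangle. -/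
noncomputable def deltaShort (s : ℝ) : ℝ := (1 - 1 / (2 * Real.sqrt (1 + s ^ 2) - 1)) ^ 2

open Classical in
/-- The four cases of `Repack` on a triangle. -/
noncomputable def Triangle.divide (size : ℕ → ℝ) (T : Triangle) (C : List ℕ) : Division :=
  let a := T.capacity
  let aLong := T.idealLong.capacity
  let aShort := T.idealShort.capacity
  if ∃ i ∈ C, aLong < size i then
    Division.tight size a (C.take 1) (C.drop 1)
  else if totalSize size C ≤ aLong then
    ⟨C, [], aLong, aShort⟩
  else
    let r := greedyFill size aLong 0 C
    let δ := (aLong - totalSize size r.1) / a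
    if δ < deltaShort T.ratio then
      Division.tight size a r.1 r.2
    else
      Division.tight size a (C.take 2) (C.drop 2)

open Classical in
/-- The two cases of `Repack` on a square. -/
noncomputable def Square.divide (size : ℕ → ℝ) (Q : Square) (C : List ℕ) : Division :=
  let a := Q.capacity
  if a / 2 < totalSize size C then
    let r := greedyRemove size (a / 2) (totalSize size C) C
    Division.tight size a r.1 r.2
  else
    ⟨C, [], a / 2, a / 2⟩

namespace Shape

noncomputable def divide (size : ℕ → ℝ) : Shape → List ℕ → Division
  | square Q => Q.divide size
  | hat H => H.tri.divide size

noncomputable def split : Shape → ℝ → ℝ → Hat × Hat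
  | square Q => Q.split
  | hat H => H.split

end Shape

/-- One level of the tree: its rightmost node with the circles contained in it, and the left child of
that node with the circles contained in it and their centres. The right child of the node is the
rightmost node of the next level. -/
structure Level where
  node : Shape
  circles : List ℕ
  left : Hat
  leftCircles : List ℕ
  placed : List (ℕ × Plane)

/-- The tree: its infinite right spine, with the left children. -/
abbrev PackTree := ℕ → Level

/-- The level whose rightmost node is `S`, when `Repack` is called on the circles `C` and `S`. -/
noncomputable def repackLevel (size : ℕ → ℝ) (S : Shape) (C : List ℕ) : Level :=
  let d := S.divide size C
  let L := (S.split d.leftCapacity d.rightCapacity).1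
  ⟨S, C, L, d.leftCircles, splitPack size L.tri d.leftCircles⟩

/-- The right child, and the circles recursively packed into it. -/
noncomputable def repackRight (size : ℕ → ℝ) (S : Shape) (C : List ℕ) : Shape × List ℕ :=
  let d := S.divide size C
  (Shape.hat (S.split d.leftCapacity d.rightCapacity).2, d.rightCircles)

/-- `Repack(C, S)`: the subtree rooted at `S`, rebuilt from the circles `C` (sorted in decreasing
order of size). -/
noncomputable def repack (size : ℕ → ℝ) (S : Shape) (C : List ℕ) : PackTree
  | 0 => repackLevel size S C
  | n + 1 => repack size (repackRight size S C).1 (repackRight size S C).2 n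

/-! ### Insertions -/

/-- Add a new first level to a tree. -/
def PackTree.cons (l : Level) (T : PackTree) : PackTree
  | 0 => l
  | n + 1 => T n

/-- The subtree rooted at the right child of the root. -/
def PackTree.tail (T : PackTree) : PackTree := fun n => T (n + 1)

/-- The rightmost node of this level is a tight shape. -/
def Level.IsTight (size : ℕ → ℝ) (l : Level) : Prop :=
  totalSize size l.leftCircles = l.left.tri.capacity

/-- The condition for the insertion of circle `i` to recurse on the right child of the root. -/
def PackTree.Recurses (size : ℕ → ℝ) (i : ℕ) (T : PackTree) : Prop :=
  (T 0).IsTight size ∨ totalSize size (T 1).circles + size i < (T 1).node.capacity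

/-- `InsertCircle size i T T'`: inserting circle `i` into the root of the tree `T` terminates and
results in the tree `T'`. (The order of circles of equal sizes is arbitrary.) -/
inductive InsertCircle (size : ℕ → ℝ) (i : ℕ) : PackTree → PackTree → Prop
  | recurse (T R : PackTree) (h : T.Recurses size i) (hR : InsertCircle size i T.tail R) :
      InsertCircle size i T (PackTree.cons { T 0 with circles := i :: (T 0).circles } R)
  | repack (T : PackTree) (C : List ℕ) (h : ¬ T.Recurses size i)
      (hC : C.Perm (i :: (T 0).circles)) (hsort : C.Pairwise fun j k => size k ≤ size j) :
      InsertCircle size i T (repack size (T 0).node C)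

/-- `Run size root k T`: starting from the initial configuration on `root`, the tree is `T` after the
insertion of the circles `0, …, k - 1` in this order. -/
inductive Run (size : ℕ → ℝ) (root : Shape) : ℕ → PackTree → Prop
  | init : Run size root 0 (repack size root [])
  | insert (k : ℕ) (T T' : PackTree) (h : Run size root k T) (hi : InsertCircle size k T T') :
      Run size root (k + 1) T'

/-! ### Correctness -/

/-- Circle `i` is placed with centre `p` in the rightmost node of level `n` or its descendants. -/
def PackTree.PlacedIn (T : PackTree) (n i : ℕ) (p : Plane) : Prop := ∃ m, n ≤ m ∧ (i, p) ∈ (T m).placed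

/-- Every node of the tree, rightmost node or left child, is validly packed. -/
def PackTree.AllValidlyPacked (size : ℕ → ℝ) (T : PackTree) : Prop :=
  ∀ n, ValidlyPacked size (T n).node.region (T n).circles (T.PlacedIn n) ∧
    ValidlyPacked size (T n).left.region (T n).leftCircles fun i p => (i, p) ∈ (T n).placed

/-- The Packing Invariant holds on `S` with the circles `C`. -/
def PackingInvariant (size : ℕ → ℝ) (S : Shape) (C : List ℕ) : Prop :=
  (match S with
    | .square Q => Q.IsSquare
    | .hat H => H.IsSemihat ∧ (0 < H.bLong → ∃ i ∈ C, H.bLong ≤ size i)) ∧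
  totalSize size C ≤ S.capacity

/-- The Packing Invariant holds on the packing. -/
def PackTree.PackingInvariantHolds (size : ℕ → ℝ) (T : PackTree) : Prop :=
  ∀ n, PackingInvariant size (T n).node (T n).circles

/-- The Online Split Packing Algorithm, for insertions only, has packing density `A` on `root`:
for every sequence of circles of total area at most `A`, every insertion terminates, and initially and
after each insertion all the circles inserted so far are validly packed in `root`. -/
def HasPackingDensity (root : Shape) (A : ℝ) : Prop :=
  ∀ (size : ℕ → ℝ) (N : ℕ), (∀ k < N, 0 < size k) → ∑ k ∈ Finset.range N, size k ≤ A →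
    ∀ k ≤ N, (∃ T, Run size root k T) ∧
      ∀ T, Run size root k T →
        (k < N → ∃ T', InsertCircle size k T T') ∧
        ValidlyPacked size root.region (List.range k) (T.PlacedIn 0)

/-! The geometric part rests on one linear inequality. Let a triangle have legs `p`, `m`, hypotenuse
`h` and inradius `r`, and let the long child have inradius `κ r`. If the child is larger than the
ideal one, its short corner sticks out beyond the short leg. A disc of radius `ρ` in the child
nevertheless stays inside the triangle when `h (κ r) - p r ≤ (h - p) ρ` (`Frame.le_u_of_long`). Call
this the curve condition; for the short child `p` and `m` are interchanged. It also determines the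
rounding of the child (`Frame.longCurve_le`, `Frame.le_longCurve`). The children never meet: as
their capacities add up to at most that of the triangle, Cauchy–Schwarz (`Legs.scaled_le`) puts them
on different sides of a perpendicular to the hypotenuse. So each split only requires a proof of the
curve condition.

In offline Split Packing it follows from the balance of the partition (`Legs.curve_le_of_balanced`).
The induction `Frame.packed_splitPackAux` also shows that all discs avoid the rounding of the long
corner by any circle of the packing. This is what makes semihats, whose rounding is bounded by some
circle present, as good as full triangles.

For `Repack` on a semihat the condition is checked case by case (`Frame.goodDivision_divide`). The
threshold `deltaShort` is small enough that a circle rejected by the greedy filling suits the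
rounded right child (`Legs.curve_le_of_delta`), and large enough that otherwise the two largest
circles suit the left child (`Legs.curve_le_of_two`). Squares are handled by the analogous
`Legs.curve_le_of_square`. Hence every `Repack` gives a valid level and hands the Packing Invariant
on to the right child (`goodDivision`).

On the tree, each level remembers the circles from which its left child was built (`Level.Linked`);
insertions further right do not disturb this, so `PackTree.Valid` is preserved
(`PackTree.Valid.insert`). An insertion that recursed forever would have to fit its circle into
nodes whose capacities tend to zero (`PackTree.Valid.exists_insert`). Finally, no more than the
capacity can be guaranteed, because of one circle in a triangle or two equal circles in a square
(`Shape.IsRoot.le_capacity`). -/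

section CirclePacking

open Metric

/-! ### Cartesian frames -/

/-- An orthonormal frame of the plane. -/
structure Frame where
  origin : Plane
  e₁ : Plane
  e₂ : Plane
  norm₁ : ‖e₁‖ = 1
  norm₂ : ‖e₂‖ = 1
  orth : inner ℝ e₁ e₂ = 0

namespace Frame

/-- The first coordinate. -/
noncomputable def u (F : Frame) (x : Plane) : ℝ := inner ℝ F.e₁ (x - F.origin)

/-- The second coordinate. -/
noncomputable def v (F : Frame) (x : Plane) : ℝ := inner ℝ F.e₂ (x - F.origin)

/-- The point with given coordinates. -/
noncomputable def pt (F : Frame) (a b : ℝ) : Plane := F.origin + a • F.e₁ + b • F.e₂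

variable (F : Frame)

theorem inner_e₁_e₁ : inner ℝ F.e₁ F.e₁ = (1 : ℝ) := by
  rw [real_inner_self_eq_norm_sq, F.norm₁]; norm_num

theorem inner_e₂_e₂ : inner ℝ F.e₂ F.e₂ = (1 : ℝ) := by
  rw [real_inner_self_eq_norm_sq, F.norm₂]; norm_num

theorem orth' : inner ℝ F.e₂ F.e₁ = (0 : ℝ) := by rw [real_inner_comm]; exact F.orth

@[simp] theorem u_pt (a b : ℝ) : F.u (F.pt a b) = a := by
  have : F.pt a b - F.origin = a • F.e₁ + b • F.e₂ := by simp only [pt]; module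
  rw [u, this, inner_add_right, inner_smul_right, inner_smul_right, inner_e₁_e₁, F.orth]; ring

@[simp] theorem v_pt (a b : ℝ) : F.v (F.pt a b) = b := by
  have : F.pt a b - F.origin = a • F.e₁ + b • F.e₂ := by simp only [pt]; module
  rw [v, this, inner_add_right, inner_smul_right, inner_smul_right, inner_e₂_e₂, F.orth']; ring

theorem u_comb (x y z : Plane) (t : ℝ) : F.u (x + t • (y - z)) = F.u x + t * (F.u y - F.u z) := by
  have : x + t • (y - z) - F.origin
      = (x - F.origin) + t • ((y - F.origin) - (z - F.origin)) := by module
  simp only [u]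
  rw [this, inner_add_right, inner_smul_right, inner_sub_right F.e₁ (y - _)]

theorem v_comb (x y z : Plane) (t : ℝ) : F.v (x + t • (y - z)) = F.v x + t * (F.v y - F.v z) := by
  have : x + t • (y - z) - F.origin
      = (x - F.origin) + t • ((y - F.origin) - (z - F.origin)) := by module
  simp only [v]
  rw [this, inner_add_right, inner_smul_right, inner_sub_right F.e₂ (y - _)]

theorem pt_u_v (x : Plane) : F.pt (F.u x) (F.v x) = x := by
  obtain ⟨O, e, f, h1, h2, h3⟩ := F
  have h1' : e 0 ^ 2 + e 1 ^ 2 = 1 := by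
    have : ‖e‖ ^ 2 = 1 := by rw [h1]; norm_num
    simpa [EuclideanSpace.real_norm_sq_eq, Fin.sum_univ_two] using this
  have h2' : f 0 ^ 2 + f 1 ^ 2 = 1 := by
    have : ‖f‖ ^ 2 = 1 := by rw [h2]; norm_num
    simpa [EuclideanSpace.real_norm_sq_eq, Fin.sum_univ_two] using this
  have h3' : e 0 * f 0 + e 1 * f 1 = 0 := by
    simp [PiLp.inner_apply, Fin.sum_univ_two] at h3; nlinarith
  have hf0 : f 0 = - e 1 * (e 0 * f 1 - e 1 * f 0) := by
    linear_combination (-f 0) * h1' + e 0 * h3'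
  have hf1 : f 1 = e 0 * (e 0 * f 1 - e 1 * f 0) := by
    linear_combination (-f 1) * h1' + e 1 * h3'
  -- The determinant of the frame. Only `D ^ 2 = 1` is available, since frames of either orientation
  -- are allowed; passing to a child reverses the orientation.
  set D := e 0 * f 1 - e 1 * f 0 with hD
  have hD2 : D ^ 2 = 1 := by
    rw [hf0, hf1] at h2'; linear_combination h2' - D ^ 2 * h1'
  ext i
  fin_cases i
  · simp [pt, u, v, PiLp.inner_apply, Fin.sum_univ_two]
    rw [hf0, hf1]
    linear_combination (x 0 - O 0) * h1' + (e 1 ^ 2 * (x 0 - O 0) - e 0 * e 1 * (x 1 - O 1)) * hD2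
  · simp [pt, u, v, PiLp.inner_apply, Fin.sum_univ_two]
    rw [hf0, hf1]
    linear_combination (x 1 - O 1) * h1' + (e 0 ^ 2 * (x 1 - O 1) - e 0 * e 1 * (x 0 - O 0)) * hD2

theorem ext_uv {x y : Plane} (h₁ : F.u x = F.u y) (h₂ : F.v x = F.v y) : x = y := by
  rw [← F.pt_u_v x, ← F.pt_u_v y, h₁, h₂]

theorem dist_sq (x y : Plane) : dist x y ^ 2 = (F.u x - F.u y) ^ 2 + (F.v x - F.v y) ^ 2 := by
  have h : x - y = (F.u x - F.u y) • F.e₁ + (F.v x - F.v y) • F.e₂ := by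
    conv_lhs => rw [← F.pt_u_v x, ← F.pt_u_v y]
    simp only [pt]; module
  rw [dist_eq_norm, h, ← real_inner_self_eq_norm_sq]
  simp only [inner_add_left, inner_add_right, inner_smul_left, inner_smul_right, inner_e₁_e₁,
    inner_e₂_e₂, F.orth, F.orth', RCLike.conj_to_real]
  ring

theorem dist_eq {x y : Plane} {d : ℝ} (hd : 0 ≤ d)
    (h : (F.u x - F.u y) ^ 2 + (F.v x - F.v y) ^ 2 = d ^ 2) : dist x y = d := by
  rw [← F.dist_sq] at h
  exact (pow_left_inj₀ dist_nonneg hd two_ne_zero).1 h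

theorem dist_le {x y : Plane} {d : ℝ} (hd : 0 ≤ d)
    (h : (F.u x - F.u y) ^ 2 + (F.v x - F.v y) ^ 2 ≤ d ^ 2) : dist x y ≤ d := by
  rw [← F.dist_sq] at h
  exact (pow_le_pow_iff_left₀ dist_nonneg hd two_ne_zero).1 h

/-- A disc lies in a half-plane iff its centre has at least the distance `ρ` from the boundary. -/
theorem closedBall_halfPlane {z : Plane} {ρ α β γ : ℝ} (hρ : 0 ≤ ρ) (h : α ^ 2 + β ^ 2 = 1) :
    (∀ x ∈ Metric.closedBall z ρ, 0 ≤ α * F.u x + β * F.v x + γ) ↔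
      ρ ≤ α * F.u z + β * F.v z + γ := by
  constructor
  · intro H
    have := H (F.pt (F.u z - ρ * α) (F.v z - ρ * β)) (by
      rw [Metric.mem_closedBall]
      apply F.dist_le hρ
      simp only [u_pt, v_pt]
      apply le_of_eq; linear_combination ρ ^ 2 * h)
    simp only [u_pt, v_pt] at this
    linear_combination this - ρ * h
  · intro H x hx
    rw [Metric.mem_closedBall] at hx
    have h1 : (F.u x - F.u z) ^ 2 + (F.v x - F.v z) ^ 2 ≤ ρ ^ 2 := by
      rw [← F.dist_sq]; exact pow_le_pow_left₀ dist_nonneg hx 2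
    have h2 : -ρ ≤ α * (F.u x - F.u z) + β * (F.v x - F.v z) := by
      apply neg_le_of_abs_le
      apply abs_le_of_sq_le_sq _ hρ
      nlinarith [sq_nonneg (α * (F.v x - F.v z) - β * (F.u x - F.u z))]
    linarith

/-- Discs on different sides of a line do not overlap. -/
theorem disjoint_of_halfPlanes {z z' : Plane} {ρ ρ' α β γ : ℝ} (h : α ^ 2 + β ^ 2 = 1)
    (h₁ : α * F.u z + β * F.v z + γ ≤ -ρ) (h₂ : ρ' ≤ α * F.u z' + β * F.v z' + γ) :
    ρ + ρ' ≤ dist z z' := by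
  have h1 := F.dist_sq z z'
  have h2 : ρ + ρ' ≤ α * (F.u z' - F.u z) + β * (F.v z' - F.v z) := by linarith
  refine h2.trans (le_of_abs_le (abs_le_of_sq_le_sq ?_ dist_nonneg))
  nlinarith [sq_nonneg (α * (F.v z' - F.v z) - β * (F.u z' - F.u z))]

/-- The frame with the axes interchanged. -/
def swap : Frame := ⟨F.origin, F.e₂, F.e₁, F.norm₂, F.norm₁, F.orth'⟩

@[simp] theorem swap_u (x : Plane) : F.swap.u x = F.v x := rfl
@[simp] theorem swap_v (x : Plane) : F.swap.v x = F.u x := rfl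
@[simp] theorem swap_swap : F.swap.swap = F := rfl
theorem swap_pt (a b : ℝ) : F.swap.pt a b = F.pt b a := by simp only [pt, swap]; module

/-- The triangle with the right angle at the origin and legs `p`, `m` along the axes. -/
noncomputable def tri (p m : ℝ) : Triangle := ⟨F.pt 0 0, F.pt p 0, F.pt 0 m⟩

end Frame

/-! ### Side lengths of right-angled triangles, radii and areas. -/

/-- The same triangle, with the acute corners interchanged. -/
def Triangle.swap (T : Triangle) : Triangle := ⟨T.right, T.short, T.long⟩

/-- Every fact about the long corner yields one about the short corner by interchanging the axes.
For this reason `Legs` imposes no order on `p` and `m`. -/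
theorem Frame.swap_tri (F : Frame) (p m : ℝ) : F.swap.tri m p = (F.tri p m).swap := by
  simp only [Frame.tri, Triangle.swap, Frame.swap_pt]

/-- A nondegenerate right-angled triangle with legs `p`, `m`, hypotenuse `h` and inradius `r`. -/
structure Legs (p m h r : ℝ) : Prop where
  p_pos : 0 < p
  m_pos : 0 < m
  h_pos : 0 < h
  sq : h ^ 2 = p ^ 2 + m ^ 2
  two_r : 2 * r = p + m - h

namespace Legs

variable {p m h r : ℝ}

theorem swap (L : Legs p m h r) : Legs m p h r :=
  ⟨L.m_pos, L.p_pos, L.h_pos, by rw [L.sq]; ring, by rw [L.two_r]; ring⟩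

theorem p_lt_h (L : Legs p m h r) : p < h := by nlinarith [L.p_pos, L.m_pos, L.h_pos, L.sq]

theorem m_lt_h (L : Legs p m h r) : m < h := L.swap.p_lt_h

theorem h_lt (L : Legs p m h r) : h < p + m := by
  nlinarith [mul_pos L.p_pos L.m_pos, L.p_pos, L.m_pos, L.h_pos, L.sq]

theorem r_pos (L : Legs p m h r) : 0 < r := by linarith [L.h_lt, L.two_r]

theorem r_mul (L : Legs p m h r) : r * (p + m + h) = p * m := by
  linear_combination (p + m + h) / 2 * L.two_r - L.sq / 2

/-- The factor `h + m - p` is twice the tangent length `m - r` at the short corner. The identity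
removes `r` from the curve condition. -/
theorem r_mul_long (L : Legs p m h r) : r * (h + m - p) = p * (h - p) := by
  linear_combination (h + m - p) / 2 * L.two_r - L.sq / 2

theorem scale (L : Legs p m h r) {κ : ℝ} (hκ : 0 < κ) : Legs (κ * p) (κ * m) (κ * h) (κ * r) :=
  ⟨mul_pos hκ L.p_pos, mul_pos hκ L.m_pos, mul_pos hκ L.h_pos,
    by linear_combination κ ^ 2 * L.sq, by linear_combination κ * L.two_r⟩

end Legs

theorem discRadius_nonneg (a : ℝ) : 0 ≤ discRadius a := Real.sqrt_nonneg _

theorem discRadius_zero : discRadius 0 = 0 := by simp [discRadius]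

theorem discRadius_sq {a : ℝ} (ha : 0 ≤ a) : discRadius a ^ 2 = a / Real.pi :=
  Real.sq_sqrt (div_nonneg ha Real.pi_pos.le)

theorem pi_mul_discRadius_sq {a : ℝ} (ha : 0 ≤ a) : Real.pi * discRadius a ^ 2 = a := by
  rw [discRadius_sq ha]; field_simp [Real.pi_ne_zero]

theorem discRadius_pi_mul_sq {r : ℝ} (hr : 0 ≤ r) : discRadius (Real.pi * r ^ 2) = r := by
  rw [discRadius, mul_div_cancel_left₀ _ Real.pi_ne_zero, Real.sqrt_sq hr]

theorem discRadius_mono {a b : ℝ} (h : a ≤ b) : discRadius a ≤ discRadius b :=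
  Real.sqrt_le_sqrt (div_le_div_of_nonneg_right h Real.pi_pos.le)

theorem discRadius_pos {a : ℝ} (h : 0 < a) : 0 < discRadius a :=
  Real.sqrt_pos.2 (div_pos h Real.pi_pos)

/-- The similar copies of a triangle are determined by the ratio of the inradii. -/
theorem sqrt_div_pi_mul_sq (a : ℝ) {ρ : ℝ} (hρ : 0 ≤ ρ) :
    Real.sqrt (a / (Real.pi * ρ ^ 2)) = discRadius a / ρ := by
  rw [← div_div, Real.sqrt_div' _ (sq_nonneg ρ), Real.sqrt_sq hρ, discRadius]

namespace Frame

variable (F : Frame) {p m h r : ℝ}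

/-- The signed distance from the hypotenuse. -/
noncomputable def w (p m h : ℝ) (x : Plane) : ℝ := (p * m - m * F.u x - p * F.v x) / h

/-- The coordinate along the hypotenuse, with origin at the long corner. -/
noncomputable def along (p m h : ℝ) (x : Plane) : ℝ := (p * (p - F.u x) + m * F.v x) / h

/-- The disc of radius `ρ` with centre `x` lies in the triangle. -/
def Within (p m h ρ : ℝ) (x : Plane) : Prop := ρ ≤ F.u x ∧ ρ ≤ F.v x ∧ ρ ≤ F.w p m h x

theorem h_mul_w (L : Legs p m h r) (x : Plane) :
    h * F.w p m h x = p * m - m * F.u x - p * F.v x := by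
  rw [w]; field_simp [L.h_pos.ne']

theorem h_mul_along (L : Legs p m h r) (x : Plane) :
    h * F.along p m h x = p * (p - F.u x) + m * F.v x := by
  rw [along]; field_simp [L.h_pos.ne']

theorem h_mul_v (L : Legs p m h r) (x : Plane) :
    h * F.v x = m * F.along p m h x - p * F.w p m h x := by
  have h1 := F.h_mul_w L x
  have h2 := F.h_mul_along L x
  apply mul_left_cancel₀ L.h_pos.ne'
  linear_combination F.v x * L.sq - m * h2 + p * h1

theorem swap_w (x : Plane) : F.swap.w m p h x = F.w p m h x := by
  simp only [w, swap_u, swap_v]; ring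

theorem swap_within {ρ : ℝ} {x : Plane} : F.swap.Within m p h ρ x ↔ F.Within p m h ρ x := by
  simp only [Within, swap_u, swap_v, swap_w]; tauto

theorem swap_along (L : Legs p m h r) (x : Plane) :
    F.swap.along m p h x = h - F.along p m h x := by
  apply mul_left_cancel₀ L.h_pos.ne'
  have h1 := F.swap.h_mul_along L.swap x
  have h2 := F.h_mul_along L x
  rw [swap_u, swap_v] at h1
  linear_combination h1 + h2 - L.sq

theorem w_unit (L : Legs p m h r) : (-m / h) ^ 2 + (-p / h) ^ 2 = 1 := by
  have := L.h_pos.ne'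
  field_simp; linear_combination -L.sq

theorem along_unit (L : Legs p m h r) : (-p / h) ^ 2 + (m / h) ^ 2 = 1 := by
  have := L.h_pos.ne'
  field_simp; linear_combination -L.sq

theorem closedBall_u {z : Plane} {ρ : ℝ} (hρ : 0 ≤ ρ) :
    (∀ x ∈ closedBall z ρ, 0 ≤ F.u x) ↔ ρ ≤ F.u z := by
  simpa using F.closedBall_halfPlane (z := z) (α := 1) (β := 0) (γ := 0) hρ (by norm_num)

theorem closedBall_v {z : Plane} {ρ : ℝ} (hρ : 0 ≤ ρ) :
    (∀ x ∈ closedBall z ρ, 0 ≤ F.v x) ↔ ρ ≤ F.v z := F.swap.closedBall_u hρ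

theorem closedBall_w (L : Legs p m h r) {z : Plane} {ρ : ℝ} (hρ : 0 ≤ ρ) :
    (∀ x ∈ closedBall z ρ, 0 ≤ F.w p m h x) ↔ ρ ≤ F.w p m h z := by
  have e : ∀ x, F.w p m h x = -m / h * F.u x + -p / h * F.v x + p * m / h := by
    intro x; simp only [w]; ring
  simp only [e]
  exact F.closedBall_halfPlane hρ (w_unit L)

/-! ### Triangles in a frame -/

theorem dist_right_long (hp : 0 ≤ p) : dist (F.tri p m).right (F.tri p m).long = p :=
  F.dist_eq hp (by simp [tri])

theorem dist_right_short (hm : 0 ≤ m) : dist (F.tri p m).right (F.tri p m).short = m :=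
  F.dist_eq hm (by simp [tri])

theorem dist_long_short (L : Legs p m h r) : dist (F.tri p m).long (F.tri p m).short = h :=
  F.dist_eq L.h_pos.le (by simp [tri, L.sq])

theorem inradius_tri (L : Legs p m h r) : (F.tri p m).inradius = r := by
  rw [Triangle.inradius, F.dist_right_long L.p_pos.le, F.dist_right_short L.m_pos.le,
    F.dist_long_short L]
  linarith [L.two_r]

theorem capacity_tri (L : Legs p m h r) : (F.tri p m).capacity = Real.pi * r ^ 2 := by
  rw [Triangle.capacity, F.inradius_tri L]

theorem ratio_tri (L : Legs p m h r) : (F.tri p m).ratio = p / m := by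
  rw [Triangle.ratio, F.dist_right_long L.p_pos.le, F.dist_right_short L.m_pos.le]

theorem incenter_tri (L : Legs p m h r) : (F.tri p m).incenter = F.pt r r := by
  rw [Triangle.incenter, F.dist_right_long L.p_pos.le, F.dist_right_short L.m_pos.le,
    F.dist_long_short L]
  have hs : h + m + p ≠ 0 := by linarith [L.p_pos, L.m_pos, L.h_pos]
  have hr : r = (h + m + p)⁻¹ * (p * m) := by
    field_simp; linear_combination L.r_mul
  have : h • (F.tri p m).right + m • (F.tri p m).long + p • (F.tri p m).short
      = (h + m + p) • F.origin + (p * m) • F.e₁ + (p * m) • F.e₂ := by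
    simp only [tri, pt]; module
  rw [this, smul_add, smul_add, smul_smul, smul_smul, inv_mul_cancel₀ hs, ← hr, one_smul,
    smul_smul, ← hr, pt]

theorem within_incenter (L : Legs p m h r) {ρ : ℝ} (hρ : ρ ≤ r) :
    F.Within p m h ρ (F.tri p m).incenter := by
  rw [F.incenter_tri L]
  refine ⟨by simpa, by simpa, hρ.trans ?_⟩
  rw [w, le_div_iff₀ L.h_pos, u_pt, v_pt]
  linarith [L.r_mul]

theorem u_affine (x y : Plane) {a b : ℝ} (hab : a + b = 1) :
    F.u (a • x + b • y) = a * F.u x + b * F.u y := by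
  obtain rfl : a = 1 - b := by linarith
  have : (1 - b) • x + b • y = x + b • (y - x) := by module
  rw [this, u_comb]; ring

theorem v_affine (x y : Plane) {a b : ℝ} (hab : a + b = 1) :
    F.v (a • x + b • y) = a * F.v x + b * F.v y := F.swap.u_affine x y hab

theorem mem_region_tri (L : Legs p m h r) {x : Plane} :
    x ∈ (F.tri p m).region ↔ 0 ≤ F.u x ∧ 0 ≤ F.v x ∧ 0 ≤ F.w p m h x := by
  have hp := L.p_pos
  have hm := L.m_pos
  have hw := F.h_mul_w L x
  constructor
  · intro hx
    have hsub : (F.tri p m).region ⊆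
        {x | 0 ≤ F.u x ∧ 0 ≤ F.v x ∧ 0 ≤ p * m - m * F.u x - p * F.v x} := by
      apply convexHull_min
      · intro y hy
        rcases hy with rfl | rfl | rfl <;> simp [tri, hp.le, hm.le, mul_comm]
        positivity
      · rintro y ⟨h1, h2, h3⟩ z ⟨h1', h2', h3'⟩ a b ha hb hab
        refine ⟨?_, ?_, ?_⟩ <;> simp only [u_affine F _ _ hab, v_affine F _ _ hab]
        · positivity
        · positivity
        · have := add_nonneg (mul_nonneg ha h3) (mul_nonneg hb h3')
          linear_combination this + p * m * hab
    obtain ⟨h1, h2, h3⟩ := hsub hx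
    exact ⟨h1, h2, div_nonneg h3 L.h_pos.le⟩
  · rintro ⟨h1, h2, h3⟩
    -- The barycentric coordinates: each distance from a side, divided by the altitude to that side.
    have hs : x = ∑ i : Fin 3, ![h * F.w p m h x / (p * m), F.u x / p, F.v x / m] i •
        ![(F.tri p m).right, (F.tri p m).long, (F.tri p m).short] i := by
      have key : h * F.w p m h x / (p * m) + F.u x / p + F.v x / m = 1 := by
        rw [hw]; field_simp; ring
      conv_lhs => rw [← F.pt_u_v x]
      simp only [Fin.sum_univ_three, Matrix.cons_val, tri, pt]
      have e1 : F.u x = F.u x / p * p := by field_simp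
      have e2 : F.v x = F.v x / m * m := by field_simp
      rw [← sub_eq_zero]
      have : F.origin = (h * F.w p m h x / (p * m) + F.u x / p + F.v x / m) • F.origin := by
        rw [key, one_smul]
      conv_lhs => enter [1, 1, 1]; rw [this]
      conv_lhs => enter [1, 1, 2]; rw [e1]
      conv_lhs => enter [1, 2]; rw [e2]
      module
    rw [hs]
    apply (convex_convexHull ℝ _).sum_mem
    · intro i _
      have := L.h_pos
      fin_cases i <;> simp <;> positivity
    · simp only [Fin.sum_univ_three, Matrix.cons_val]
      rw [hw]; field_simp; ring
    · intro i _
      apply subset_convexHull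
      fin_cases i <;> simp

theorem mem_angleAt_long (L : Legs p m h r) {x : Plane} :
    x ∈ angleAt (F.tri p m).long (F.tri p m).right (F.tri p m).short ↔
      0 ≤ F.v x ∧ 0 ≤ F.w p m h x := by
  have hp := L.p_pos
  have hm := L.m_pos
  have hh := L.h_pos
  have hw := F.h_mul_w L x
  constructor
  · rintro ⟨s, t, hs, ht, rfl⟩
    simp only [w, u_comb, v_comb, tri, u_pt, v_pt]
    refine ⟨by simp; positivity, div_nonneg ?_ hh.le⟩
    have : 0 ≤ s * p * m := by positivity
    linear_combination this
  · rintro ⟨h1, h2⟩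
    refine ⟨h * F.w p m h x / (p * m), F.v x / m, by positivity, by positivity, ?_⟩
    apply F.ext_uv
    · rw [hw]; simp only [u_comb, tri, u_pt]; field_simp; ring
    · simp only [v_comb, tri, v_pt]; field_simp; ring

theorem closedBall_subset_region (L : Legs p m h r) {z : Plane} {ρ : ℝ} (hρ : 0 ≤ ρ) :
    closedBall z ρ ⊆ (F.tri p m).region ↔ F.Within p m h ρ z := by
  rw [Within, ← F.closedBall_u hρ, ← F.closedBall_v hρ, ← F.closedBall_w L hρ]
  simp only [Set.subset_def, F.mem_region_tri L]
  exact ⟨fun H => ⟨fun x hx => (H x hx).1, fun x hx => (H x hx).2.1, fun x hx => (H x hx).2.2⟩,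
    fun H x hx => ⟨H.1 x hx, H.2.1 x hx, H.2.2 x hx⟩⟩

theorem mem_roundedAngle_long (L : Legs p m h r) {x : Plane} {b : ℝ} :
    x ∈ roundedAngle (F.tri p m).long (F.tri p m).right (F.tri p m).short b ↔
      ∃ z, dist x z ≤ discRadius b ∧ discRadius b ≤ F.v z ∧ discRadius b ≤ F.w p m h z := by
  have hρ := discRadius_nonneg b
  simp only [roundedAngle, Set.mem_ofPred_eq, mem_closedBall, Set.subset_def, F.mem_angleAt_long L]
  refine exists_congr fun z => and_congr_right fun _ => ?_
  rw [← F.closedBall_v hρ, ← F.closedBall_w L hρ]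
  simp only [mem_closedBall]
  exact ⟨fun H => ⟨fun x hx => (H x hx).1, fun x hx => (H x hx).2⟩,
    fun H x hx => ⟨H.1 x hx, H.2 x hx⟩⟩

theorem mem_roundedAngle_short (L : Legs p m h r) {x : Plane} {b : ℝ} :
    x ∈ roundedAngle (F.tri p m).short (F.tri p m).right (F.tri p m).long b ↔
      ∃ z, dist x z ≤ discRadius b ∧ discRadius b ≤ F.u z ∧ discRadius b ≤ F.w p m h z := by
  have := F.swap.mem_roundedAngle_long L.swap (x := x) (b := b)
  simp only [swap_tri, swap_v, swap_w] at this
  exact this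

/-- The distances from the sides of a triangle are `1`-Lipschitz. -/
theorem sub_le_of_unit {x z : Plane} {α β : ℝ} (h : α ^ 2 + β ^ 2 = 1) :
    α * F.u z + β * F.v z - dist x z ≤ α * F.u x + β * F.v x := by
  have h2 : |α * (F.u z - F.u x) + β * (F.v z - F.v x)| ≤ dist x z := by
    apply abs_le_of_sq_le_sq _ dist_nonneg
    rw [F.dist_sq x z]
    nlinarith [sq_nonneg (α * (F.v x - F.v z) - β * (F.u x - F.u z))]
  linarith [le_abs_self (α * (F.u z - F.u x) + β * (F.v z - F.v x))]

theorem u_ge_sub_dist (x z : Plane) : F.u z - dist x z ≤ F.u x := by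
  simpa using F.sub_le_of_unit (x := x) (z := z) (α := 1) (β := 0) (by norm_num)

theorem v_ge_sub_dist (x z : Plane) : F.v z - dist x z ≤ F.v x := F.swap.u_ge_sub_dist x z

theorem w_ge_sub_dist (L : Legs p m h r) (x z : Plane) :
    F.w p m h z - dist x z ≤ F.w p m h x := by
  have e : ∀ x, F.w p m h x = -m / h * F.u x + -p / h * F.v x + p * m / h := by
    intro x; simp only [w]; ring
  have := F.sub_le_of_unit (x := x) (z := z) (w_unit L)
  rw [e, e]; linarith

/-- Shrinking the covering disc by a homothety centred at `x` keeps it inside the original disc and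
hence inside the angle. -/
theorem roundedAngle_long_anti (L : Legs p m h r) {b b' : ℝ} (hb : b ≤ b') :
    roundedAngle (F.tri p m).long (F.tri p m).right (F.tri p m).short b' ⊆
      roundedAngle (F.tri p m).long (F.tri p m).right (F.tri p m).short b := by
  intro x hx
  rw [F.mem_roundedAngle_long L] at hx ⊢
  obtain ⟨z, h1, h2, h3⟩ := hx
  have hbb := discRadius_mono hb
  have hb0 := discRadius_nonneg b
  -- move `z` towards `x`
  obtain ⟨t, ht0, ht1, ht⟩ : ∃ t : ℝ, 0 ≤ t ∧ t ≤ 1 ∧ t * discRadius b' = discRadius b := by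
    rcases (discRadius_nonneg b').eq_or_lt with h0 | h0
    · exact ⟨0, le_rfl, zero_le_one, by linarith⟩
    · exact ⟨discRadius b / discRadius b', by positivity, (div_le_one h0).2 hbb, by field_simp⟩
  have e1 : dist x (x + t • (z - x)) = t * dist x z := by
    rw [dist_comm, dist_eq_norm, add_sub_cancel_left, norm_smul, Real.norm_of_nonneg ht0,
      ← dist_eq_norm, dist_comm]
  have e2 : dist (x + t • (z - x)) z = (1 - t) * dist x z := by
    have : x + t • (z - x) - z = (1 - t) • (x - z) := by module
    rw [dist_eq_norm, this, norm_smul, Real.norm_of_nonneg (by linarith), ← dist_eq_norm]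
  have e3 : (1 - t) * dist x z ≤ discRadius b' - discRadius b := by
    have := mul_le_mul_of_nonneg_left h1 (by linarith : 0 ≤ 1 - t)
    linarith
  refine ⟨x + t • (z - x), ?_, ?_, ?_⟩
  · rw [e1, ← ht]; exact mul_le_mul_of_nonneg_left h1 ht0
  · have := F.v_ge_sub_dist (x + t • (z - x)) z
    rw [e2] at this; linarith
  · have := F.w_ge_sub_dist L (x + t • (z - x)) z
    rw [e2] at this; linarith

end Frame

/-! ### Frames of the long and the short child. -/

namespace Frame

variable (F : Frame) {p m h r : ℝ}

theorem inner_e₁_sub (x y : Plane) : inner ℝ F.e₁ (x - y) = F.u x - F.u y := by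
  have : x - y = (x - F.origin) - (y - F.origin) := by module
  rw [this, inner_sub_right]; rfl

theorem inner_e₂_sub (x y : Plane) : inner ℝ F.e₂ (x - y) = F.v x - F.v y :=
  F.swap.inner_e₁_sub x y

theorem norm_eq_one {a b : ℝ} (hab : a ^ 2 + b ^ 2 = 1) : ‖a • F.e₁ + b • F.e₂‖ = 1 := by
  have : ‖a • F.e₁ + b • F.e₂‖ ^ 2 = 1 := by
    rw [← real_inner_self_eq_norm_sq]
    simp only [inner_add_left, inner_add_right, inner_smul_left, inner_smul_right, inner_e₁_e₁,
      inner_e₂_e₂, F.orth, F.orth', RCLike.conj_to_real]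
    linear_combination hab
  exact (pow_eq_one_iff_of_nonneg (norm_nonneg _) two_ne_zero).1 this

/-- The frame of the long child whose legs are `κ` times those of the triangle. -/
noncomputable def longFrame (L : Legs p m h r) (κ : ℝ) : Frame where
  origin := F.pt (p - κ * p * p / h) (κ * p * m / h)
  e₁ := (p / h) • F.e₁ + (-m / h) • F.e₂
  e₂ := (-m / h) • F.e₁ + (-p / h) • F.e₂
  norm₁ := F.norm_eq_one (by
    have := along_unit L; rw [← this]; ring)
  norm₂ := F.norm_eq_one (w_unit L)
  orth := by
    simp only [inner_add_left, inner_add_right, inner_smul_left, inner_smul_right, inner_e₁_e₁,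
      inner_e₂_e₂, F.orth, F.orth', RCLike.conj_to_real]
    ring

/-- The child's longer leg lies on the hypotenuse and the child's hypotenuse on the line of the long
leg. So parent and child share the angle at the long corner, with its two sides interchanged, and
only the altitude is a new side. -/
theorem longFrame_u (L : Legs p m h r) (κ : ℝ) (x : Plane) :
    (F.longFrame L κ).u x = κ * p - F.along p m h x := by
  have hh := L.h_pos.ne'
  rw [u]
  simp only [longFrame, inner_add_left, inner_smul_left, inner_e₁_sub, inner_e₂_sub, u_pt, v_pt,
    RCLike.conj_to_real, along]
  field_simp
  linear_combination -(p * κ) * L.sq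

theorem longFrame_v (L : Legs p m h r) (κ : ℝ) (x : Plane) :
    (F.longFrame L κ).v x = F.w p m h x := by
  have hh := L.h_pos.ne'
  rw [v]
  simp only [longFrame, inner_add_left, inner_smul_left, inner_e₁_sub, inner_e₂_sub, u_pt, v_pt,
    RCLike.conj_to_real, w]
  field_simp
  ring

theorem longFrame_w (L : Legs p m h r) {κ : ℝ} (hκ : 0 < κ) (x : Plane) :
    (F.longFrame L κ).w (κ * p) (κ * m) (κ * h) x = F.v x := by
  have hh := L.h_pos.ne'
  rw [w, longFrame_u, longFrame_v, div_eq_iff (by positivity)]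
  linear_combination -κ * F.h_mul_v L x

theorem foot_tri (L : Legs p m h r) :
    (F.tri p m).foot = F.pt (p - p * p * p / h ^ 2) (p * p * m / h ^ 2) := by
  rw [Triangle.foot, F.dist_right_long L.p_pos.le, F.dist_long_short L]
  have hh := L.h_pos.ne'
  apply F.ext_uv
  · simp only [u_comb, tri, u_pt]; field_simp; ring
  · simp only [v_comb, tri, v_pt]; field_simp; ring

theorem longFrame_tri (L : Legs p m h r) (κ : ℝ) :
    (F.longFrame L κ).tri (κ * p) (κ * m) =
      ⟨F.pt (p - κ * p * p / h) (κ * p * m / h), F.pt p 0, F.pt (p - κ * h) 0⟩ := by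
  have hh := L.h_pos
  have hp := L.p_pos
  have hm := L.m_pos
  simp only [tri, Triangle.mk.injEq]
  refine ⟨?_, ?_, ?_⟩ <;> apply (F.longFrame L κ).ext_uv <;>
    simp only [longFrame_u, longFrame_v, u_pt, v_pt, along, w] <;> field_simp <;>
    first
    | ring1
    | linear_combination (p * κ) * L.sq
    | linear_combination -(p * κ) * L.sq

theorem idealLong_tri (L : Legs p m h r) :
    (F.tri p m).idealLong = (F.longFrame L (p / h)).tri (p / h * p) (p / h * m) := by
  have hh := L.h_pos
  rw [F.longFrame_tri L, Triangle.idealLong, F.foot_tri L, tri]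
  simp only [Triangle.mk.injEq]
  refine ⟨?_, trivial, ?_⟩ <;> (congr 1 <;> (field_simp; try ring))

theorem capacity_idealLong (L : Legs p m h r) :
    (F.tri p m).idealLong.capacity = Real.pi * (p / h * r) ^ 2 := by
  rw [F.idealLong_tri L, capacity_tri _ (L.scale (div_pos L.p_pos L.h_pos))]

theorem longChild_tri (L : Legs p m h r) {a : ℝ} (ha : 0 < a) :
    (F.tri p m).longChild a = (F.longFrame L (discRadius a / r)).tri
      (discRadius a / r * p) (discRadius a / r * m) := by
  have hh := L.h_pos
  have hp := L.p_pos
  have hr := L.r_pos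
  have hρ := discRadius_pos ha
  rw [F.longFrame_tri L, Triangle.longChild, F.capacity_idealLong L,
    sqrt_div_pi_mul_sq _ (by positivity), Triangle.scale, F.idealLong_tri L,
    F.longFrame_tri L]
  simp only [Triangle.mk.injEq]
  refine ⟨?_, ?_, ?_⟩ <;> apply F.ext_uv <;> simp only [u_comb, v_comb, tri, u_pt, v_pt] <;>
    field_simp <;> ring

/-- Although the foot is measured from the long corner, it is symmetric in the acute corners. This
reduces the short child to the long child of the swapped triangle. -/
theorem foot_swap (L : Legs p m h r) : (F.tri p m).swap.foot = (F.tri p m).foot := by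
  rw [← swap_tri, F.swap.foot_tri L.swap, F.foot_tri L, swap_pt]
  have hh := L.h_pos.ne'
  congr 1 <;> field_simp
  · linear_combination -p * L.sq
  · linear_combination m * L.sq

end Frame

theorem Triangle.idealShort_eq_swap {T : Triangle} (h : T.swap.foot = T.foot) :
    T.idealShort = T.swap.idealLong.swap := by
  simp only [Triangle.idealShort, Triangle.idealLong, Triangle.swap] at h ⊢
  rw [h]

theorem Triangle.capacity_swap (T : Triangle) : T.swap.capacity = T.capacity := by
  simp only [Triangle.capacity, Triangle.inradius, Triangle.swap, dist_comm T.short T.long,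
    add_comm (dist T.right T.short)]

theorem Triangle.shortChild_eq_swap {T : Triangle} (h : T.swap.foot = T.foot) (a : ℝ) :
    T.shortChild a = (T.swap.longChild a).swap := by
  rw [Triangle.shortChild, Triangle.longChild, Triangle.idealShort_eq_swap h,
    Triangle.capacity_swap]
  rfl

namespace Frame

variable (F : Frame) {p m h r : ℝ}

/-- The frame of the short child whose legs are `κ` times those of the triangle. -/
noncomputable def shortFrame (L : Legs p m h r) (κ : ℝ) : Frame := (F.swap.longFrame L.swap κ).swap

theorem shortFrame_v (L : Legs p m h r) (κ : ℝ) (x : Plane) :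
    (F.shortFrame L κ).v x = F.along p m h x - (h - κ * m) := by
  have := F.swap.longFrame_u L.swap κ x
  rw [F.swap_along L] at this
  rw [shortFrame, swap_v, this]; ring

theorem shortFrame_u (L : Legs p m h r) (κ : ℝ) (x : Plane) :
    (F.shortFrame L κ).u x = F.w p m h x := by
  have := F.swap.longFrame_v L.swap κ x
  rwa [F.swap_w] at this

theorem shortFrame_w (L : Legs p m h r) {κ : ℝ} (hκ : 0 < κ) (x : Plane) :
    (F.shortFrame L κ).w (κ * p) (κ * m) (κ * h) x = F.u x := by
  have := F.swap.longFrame_w L.swap hκ x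
  rwa [← swap_w] at this

theorem shortChild_tri (L : Legs p m h r) {a : ℝ} (ha : 0 < a) :
    (F.tri p m).shortChild a = (F.shortFrame L (discRadius a / r)).tri
      (discRadius a / r * p) (discRadius a / r * m) := by
  rw [Triangle.shortChild_eq_swap (F.foot_swap L), ← swap_tri, F.swap.longChild_tri L.swap ha,
    ← swap_tri]
  rfl

theorem capacity_idealShort (L : Legs p m h r) :
    (F.tri p m).idealShort.capacity = Real.pi * (m / h * r) ^ 2 := by
  rw [Triangle.idealShort_eq_swap (F.foot_swap L), Triangle.capacity_swap, ← swap_tri,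
    F.swap.capacity_idealLong L.swap]

theorem capacity_longChild (L : Legs p m h r) {a : ℝ} (ha : 0 < a) :
    ((F.tri p m).longChild a).capacity = a := by
  have h1 := discRadius_pos ha
  have h2 := L.r_pos
  rw [F.longChild_tri L ha, capacity_tri _ (L.scale (by positivity)), div_mul_cancel₀ _ h2.ne',
    pi_mul_discRadius_sq ha.le]

theorem capacity_shortChild (L : Legs p m h r) {a : ℝ} (ha : 0 < a) :
    ((F.tri p m).shortChild a).capacity = a := by
  have h1 := discRadius_pos ha
  have h2 := L.r_pos
  rw [F.shortChild_tri L ha, capacity_tri _ (L.scale (by positivity)), div_mul_cancel₀ _ h2.ne',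
    pi_mul_discRadius_sq ha.le]

end Frame

/-- A nondegenerate right-angled triangle in a suitable frame. -/
theorem Triangle.exists_frame {T : Triangle} (hT : T.IsRightAngled)
    (hpos : 0 < dist T.right T.short) :
    ∃ (F : Frame) (p m h r : ℝ), Legs p m h r ∧ m ≤ p ∧ T = F.tri p m := by
  obtain ⟨horth, s, hs, hd⟩ := hT
  set m := dist T.right T.short with hm
  set p := dist T.right T.long with hp
  have hp0 : 0 < p := by rw [hd]; positivity
  have hp' : ‖T.long - T.right‖ = p := by rw [hp, dist_comm, dist_eq_norm]
  have hm' : ‖T.short - T.right‖ = m := by rw [hm, dist_comm, dist_eq_norm]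
  refine ⟨⟨T.right, p⁻¹ • (T.long - T.right), m⁻¹ • (T.short - T.right), ?_, ?_, ?_⟩, p, m,
    √(p ^ 2 + m ^ 2), (p + m - √(p ^ 2 + m ^ 2)) / 2, ⟨hp0, hpos, by positivity, ?_, by ring⟩,
    ?_, ?_⟩
  · rw [norm_smul, hp', Real.norm_of_nonneg (by positivity), inv_mul_cancel₀ hp0.ne']
  · rw [norm_smul, hm', Real.norm_of_nonneg (by positivity), inv_mul_cancel₀ hpos.ne']
  · rw [inner_smul_left, inner_smul_right, horth]; simp
  · rw [Real.sq_sqrt (by positivity)]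
  · rw [hd]; nlinarith
  · obtain ⟨R, A, B⟩ := T
    simp only [Frame.tri, Frame.pt, Triangle.mk.injEq, smul_smul, mul_inv_cancel₀ hp0.ne',
      mul_inv_cancel₀ hpos.ne', one_smul]
    refine ⟨by module, by module, by module⟩

theorem Frame.tri_isRightAngled (F : Frame) {p m h r : ℝ} (L : Legs p m h r) (hmp : m ≤ p) :
    (F.tri p m).IsRightAngled := by
  refine ⟨?_, p / m, (one_le_div L.m_pos).2 hmp, ?_⟩
  · have h1 : (F.tri p m).long - (F.tri p m).right = p • F.e₁ := by
      simp only [Frame.tri, Frame.pt]; module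
    have h2 : (F.tri p m).short - (F.tri p m).right = m • F.e₂ := by
      simp only [Frame.tri, Frame.pt]; module
    rw [h1, h2, inner_smul_left, inner_smul_right, F.orth]; simp
  · rw [F.dist_right_long L.p_pos.le, F.dist_right_short L.m_pos.le, div_mul_cancel₀ _ L.m_pos.ne']

/-! ### The curve condition, separation of the children, and rounded corners. -/

namespace Legs

variable {p m h r : ℝ}

/-- In a balanced partition, every circle is large enough for the long child. -/
theorem curve_le_of_balanced (L : Legs p m h r) {ρ ρ₁ ρ₂ : ℝ} (hρ : 0 ≤ ρ)
    (hsum : ρ₁ ^ 2 + ρ₂ ^ 2 ≤ r ^ 2) (hbal : (ρ₁ ^ 2 - ρ ^ 2) * m ^ 2 ≤ ρ₂ ^ 2 * p ^ 2) :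
    h * ρ₁ - p * r ≤ (h - p) * ρ := by
  have hp := L.p_pos
  have hm := L.m_pos
  have hh := L.h_pos
  have hr := L.r_pos
  have hph := L.p_lt_h
  rcases le_or_gt (h * ρ₁ - p * r) 0 with h0 | h0
  · have : 0 ≤ (h - p) * ρ := mul_nonneg (by linarith) hρ
    linarith
  have hρ₁ : ρ₁ ≤ r := abs_le_of_sq_le_sq' (by nlinarith) hr.le |>.2
  -- Balance and `ρ₂ ^ 2 ≤ r ^ 2 - ρ₁ ^ 2` bound the difference of squares. As `ρ₁ ≤ r`, the first
  -- factor is at most `(h - p) / (h + p)` times the second, so its square is bounded by `((h - p) *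
  -- ρ) ^ 2`.
  have e1 : (h * ρ₁ - p * r) * (h * ρ₁ + p * r) ≤ ρ ^ 2 * m ^ 2 := by
    have := mul_le_mul_of_nonneg_right hsum (sq_nonneg p)
    have e := L.sq
    nlinarith
  have e2 : (h * ρ₁ - p * r) * (h + p) ≤ (h * ρ₁ + p * r) * (h - p) := by
    have : 0 ≤ (2 * p * h) * (r - ρ₁) := mul_nonneg (by positivity) (by linarith)
    linear_combination this
  have e3 : (h * ρ₁ - p * r) ^ 2 * (h + p) ≤ ((h - p) * ρ) ^ 2 * (h + p) := by
    have e4 := mul_le_mul_of_nonneg_left e2 h0.le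
    have e5 := mul_le_mul_of_nonneg_right e1 (by linarith : 0 ≤ h - p)
    have e6 : ρ ^ 2 * m ^ 2 * (h - p) = ((h - p) * ρ) ^ 2 * (h + p) := by
      linear_combination -ρ ^ 2 * (h - p) * L.sq
    nlinarith
  have e7 := le_of_mul_le_mul_right e3 (by linarith)
  exact abs_le_of_sq_le_sq' e7 (mul_nonneg (by linarith) hρ) |>.2

/-- The children of a split do not overlap. -/
theorem scaled_le (L : Legs p m h r) {κ₁ κ₂ : ℝ} (hsum : κ₁ ^ 2 + κ₂ ^ 2 ≤ 1) :
    κ₁ * p + κ₂ * m ≤ h := by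
  apply le_of_abs_le
  apply abs_le_of_sq_le_sq _ L.h_pos.le
  rw [L.sq]
  nlinarith [sq_nonneg (κ₁ * m - κ₂ * p), mul_le_mul_of_nonneg_right hsum (sq_nonneg p),
    mul_le_mul_of_nonneg_right hsum (sq_nonneg m)]

end Legs

namespace Frame

variable (F : Frame) {p m h r : ℝ}

/-- A disc between the long leg and the altitude of the long child does not reach beyond the
short leg, if it is large enough. -/
theorem le_u_of_long (L : Legs p m h r) {κ ρ : ℝ} {x : Plane}
    (h₁ : ρ ≤ κ * p - F.along p m h x) (h₂ : ρ ≤ F.v x)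
    (hρ : h * (κ * r) - p * r ≤ (h - p) * ρ) : ρ ≤ F.u x := by
  have hp := L.p_pos
  have e1 := F.h_mul_along L x
  -- The curve condition freed of `r`. Equality belongs to the disc that touches the altitude and
  -- both legs of the parent.
  have e2 : p * (κ * h - p) ≤ (h + m - p) * ρ := by
    have := mul_le_mul_of_nonneg_left hρ hp.le
    apply le_of_mul_le_mul_left _ L.r_pos
    linear_combination this - ρ * L.r_mul_long
  apply le_of_mul_le_mul_left _ hp
  have e3 := mul_le_mul_of_nonneg_left h₁ L.h_pos.le
  have e4 := mul_le_mul_of_nonneg_left h₂ L.m_pos.le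
  linear_combination e2 + e3 + e4 - e1

theorem within_of_longFrame (L : Legs p m h r) {κ ρ : ℝ} (hκ : 0 < κ) {x : Plane}
    (hx : (F.longFrame L κ).Within (κ * p) (κ * m) (κ * h) ρ x)
    (hρ : h * (κ * r) - p * r ≤ (h - p) * ρ) : F.Within p m h ρ x := by
  obtain ⟨h1, h2, h3⟩ := hx
  rw [longFrame_u] at h1
  rw [longFrame_v] at h2
  rw [longFrame_w _ _ hκ] at h3
  exact ⟨F.le_u_of_long L h1 h3 hρ, h3, h2⟩

theorem within_of_shortFrame (L : Legs p m h r) {κ ρ : ℝ} (hκ : 0 < κ) {x : Plane}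
    (hx : (F.shortFrame L κ).Within (κ * p) (κ * m) (κ * h) ρ x)
    (hρ : h * (κ * r) - m * r ≤ (h - m) * ρ) : F.Within p m h ρ x := by
  rw [shortFrame, swap_within] at hx
  exact F.swap_within.1 (F.swap.within_of_longFrame L.swap hκ hx hρ)

/-- Beyond the altitude of the long child, the rounding of the long corner has no effect. -/
theorem mem_roundedAngle_of_beyond (L : Legs p m h r) {κ b : ℝ} {x : Plane} (hv : 0 ≤ F.v x)
    (hw : 0 ≤ F.w p m h x) (hx : κ * p ≤ F.along p m h x) (hb : discRadius b ≤ κ * r) :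
    x ∈ roundedAngle (F.tri p m).long (F.tri p m).right (F.tri p m).short b := by
  rw [F.mem_roundedAngle_long L]
  have hp := L.p_pos
  have hm := L.m_pos
  have hh := L.h_pos
  have hr := L.r_pos
  set ρ := discRadius b
  have hρ : 0 ≤ ρ := discRadius_nonneg b
  have ev := F.h_mul_v L x
  have hrm := L.r_mul
  have hx' : ρ * p ≤ r * F.along p m h x := by
    have := mul_le_mul_of_nonneg_left hx hr.le
    have := mul_le_mul_of_nonneg_right hb hp.le
    linarith
  -- the tangent points of the arc are closer to the corner
  have ht : (h + p) * ρ ≤ m * F.along p m h x := by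
    apply le_of_mul_le_mul_left _ hr
    have := mul_le_mul_of_nonneg_left hx' hm.le
    have : 0 ≤ r * m * ρ := by positivity
    linear_combination this + ‹m * (ρ * p) ≤ _› + ρ * hrm
  -- A disc centred at `x` serves unless `x` is too close to a side. In that case the centre is
  -- moved perpendicularly to that side until it has distance `ρ` from it; the other side does not
  -- interfere, since `x` lies beyond the tangent points.
  rcases le_or_gt ρ (F.w p m h x) with h1 | h1
  · rcases le_or_gt ρ (F.v x) with h2 | h2
    · exact ⟨x, by simpa using hρ, h2, h1⟩
    · refine ⟨F.pt (F.u x) ρ, ?_, by simp, ?_⟩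
      · apply F.dist_le hρ
        simp only [u_pt, v_pt]
        nlinarith
      · have e1 : F.w p m h (F.pt (F.u x) ρ) = (m * (p - F.u x) - p * ρ) / h := by
          simp only [w, u_pt, v_pt]; ring
        rw [e1, le_div_iff₀ hh]
        -- pass from the coordinate along the hypotenuse to the one along the leg
        have e2 : h * F.along p m h x - m * ρ ≤ p * (p - F.u x) := by
          have := mul_le_mul_of_nonneg_left h2.le hm.le
          linarith [F.h_mul_along L x]
        apply le_of_mul_le_mul_left _ (mul_pos hp hr)
        have e3 := mul_le_mul_of_nonneg_left e2 (mul_pos hm hr).le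
        have e4 := mul_le_mul_of_nonneg_left hx' (mul_pos hm hh).le
        have e5 : 0 ≤ ρ * (m * r * h) := by positivity
        have e6 := L.sq
        linear_combination e3 + e4 + ρ * h * hrm + e5 - ρ * r * e6
  · refine ⟨F.pt (F.u x - (ρ - F.w p m h x) * (m / h)) (F.v x - (ρ - F.w p m h x) * (p / h)),
      ?_, ?_, ?_⟩
    · apply F.dist_le hρ
      simp only [u_pt, v_pt]
      have : (m / h) ^ 2 + (p / h) ^ 2 = 1 := by
        have := w_unit L; simpa [neg_div] using this
      have e : (ρ - F.w p m h x) ^ 2 ≤ ρ ^ 2 := by nlinarith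
      linear_combination e + (ρ - F.w p m h x) ^ 2 * this
    · rw [v_pt]
      apply le_of_mul_le_mul_left _ hh
      have : h * (F.v x - (ρ - F.w p m h x) * (p / h)) = m * F.along p m h x - p * ρ := by
        field_simp; linear_combination ev
      rw [this]; linarith
    · rw [w, le_div_iff₀ hh, u_pt, v_pt]
      have e1 := F.h_mul_w L x
      apply le_of_eq
      field_simp
      linear_combination h * e1 + (ρ - F.w p m h x) * L.sq

end Frame

/-! ### The greedy partition -/

theorem totalSize_nil (size : ℕ → ℝ) : totalSize size [] = 0 := rfl

theorem totalSize_cons (size : ℕ → ℝ) (i : ℕ) (C : List ℕ) :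
    totalSize size (i :: C) = size i + totalSize size C := by simp [totalSize]

theorem totalSize_append (size : ℕ → ℝ) (C D : List ℕ) :
    totalSize size (C ++ D) = totalSize size C + totalSize size D := by simp [totalSize]

theorem totalSize_perm {size : ℕ → ℝ} {C D : List ℕ} (h : C.Perm D) :
    totalSize size C = totalSize size D := (h.map size).sum_eq

theorem totalSize_nonneg {size : ℕ → ℝ} {C : List ℕ} (h : ∀ i ∈ C, 0 < size i) :
    0 ≤ totalSize size C := by
  apply List.sum_nonneg
  simp only [List.mem_map]
  rintro _ ⟨i, hi, rfl⟩
  exact (h i hi).le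

theorem le_totalSize {size : ℕ → ℝ} {C : List ℕ} (h : ∀ i ∈ C, 0 < size i) {i : ℕ} (hi : i ∈ C) :
    size i ≤ totalSize size C := by
  rw [totalSize_perm (List.perm_cons_erase hi), totalSize_cons]
  linarith [totalSize_nonneg (size := size) (C := C.erase i)
    fun j hj => h j (List.mem_of_mem_erase hj)]

theorem totalSize_pos {size : ℕ → ℝ} {C : List ℕ} (h : ∀ i ∈ C, 0 < size i) (hC : C ≠ []) :
    0 < totalSize size C := by
  obtain ⟨i, hi⟩ := List.exists_mem_of_ne_nil C hC
  exact (h i hi).trans_le (le_totalSize h hi)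

theorem eq_nil_of_totalSize_le {size : ℕ → ℝ} {C : List ℕ} (h : ∀ i ∈ C, 0 < size i)
    (hC : totalSize size C ≤ 0) : C = [] := by
  by_contra hne
  exact absurd (totalSize_pos h hne) (not_lt.2 hC)

section SplitCircles

variable (size : ℕ → ℝ) (f₁ f₂ : ℝ)

theorem splitCircles_perm (t₁ t₂ : ℝ) (C : List ℕ) :
    ((splitCircles size f₁ f₂ t₁ t₂ C).1 ++ (splitCircles size f₁ f₂ t₁ t₂ C).2).Perm C := by
  induction C generalizing t₁ t₂ with
  | nil => simp [splitCircles]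
  | cons i C ih =>
    rw [splitCircles]
    split
    · simpa using (ih _ _)
    · exact List.perm_middle.trans ((ih _ _).cons i)

theorem splitCircles_sublist (t₁ t₂ : ℝ) (C : List ℕ) :
    (splitCircles size f₁ f₂ t₁ t₂ C).1.Sublist C ∧
      (splitCircles size f₁ f₂ t₁ t₂ C).2.Sublist C := by
  induction C generalizing t₁ t₂ with
  | nil => simp [splitCircles]
  | cons i C ih =>
    rw [splitCircles]
    split
    · exact ⟨(ih _ _).1.cons_cons i, (ih _ _).2.cons i⟩
    · exact ⟨(ih _ _).1.cons i, (ih _ _).2.cons_cons i⟩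

variable {size f₁ f₂}

/-- When the last circle of a part was added, that part was relatively no fuller than the other,
which has only grown since. The last circle is the smallest of its part, so removing any other
member leaves even less. -/
theorem splitCircles_balanced (hf₁ : 0 < f₁) (hf₂ : 0 < f₂) {C : List ℕ}
    (hpos : ∀ i ∈ C, 0 < size i) (hs : C.Pairwise fun j k => size k ≤ size j) (t₁ t₂ : ℝ) :
    (∀ i ∈ (splitCircles size f₁ f₂ t₁ t₂ C).1,
      (t₁ + totalSize size (splitCircles size f₁ f₂ t₁ t₂ C).1 - size i) / f₁ ≤
        (t₂ + totalSize size (splitCircles size f₁ f₂ t₁ t₂ C).2) / f₂) ∧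
    (∀ i ∈ (splitCircles size f₁ f₂ t₁ t₂ C).2,
      (t₂ + totalSize size (splitCircles size f₁ f₂ t₁ t₂ C).2 - size i) / f₂ ≤
        (t₁ + totalSize size (splitCircles size f₁ f₂ t₁ t₂ C).1) / f₁) := by
  induction C generalizing t₁ t₂ with
  | nil => simp [splitCircles]
  | cons i C ih =>
    have hposC : ∀ j ∈ C, 0 < size j := fun j hj => hpos j (List.mem_cons_of_mem _ hj)
    obtain ⟨hi, hs⟩ := List.pairwise_cons.1 hs
    rw [splitCircles]
    split
    · rename_i hcond
      obtain ⟨ih₁, ih₂⟩ := ih hposC hs (t₁ + size i) t₂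
      have hsub := splitCircles_sublist size f₁ f₂ (t₁ + size i) t₂ C
      set s := splitCircles size f₁ f₂ (t₁ + size i) t₂ C
      simp only [totalSize_cons, ← add_assoc]
      refine ⟨fun j hj => ?_, ih₂⟩
      rcases List.mem_cons.1 hj with rfl | hj
      · by_cases hne : s.1 = []
        · rw [hne, totalSize_nil, add_zero, add_sub_cancel_right]
          refine hcond.trans (div_le_div_of_nonneg_right ?_ hf₂.le)
          linarith [totalSize_nonneg fun k hk => hposC k (hsub.2.subset hk)]
        · obtain ⟨k, hk⟩ := List.exists_mem_of_ne_nil _ hne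
          refine le_trans (div_le_div_of_nonneg_right ?_ hf₁.le) (ih₁ k hk)
          linarith [hi k (hsub.1.subset hk)]
      · exact ih₁ j hj
    · rename_i hcond
      obtain ⟨ih₁, ih₂⟩ := ih hposC hs t₁ (t₂ + size i)
      have hsub := splitCircles_sublist size f₁ f₂ t₁ (t₂ + size i) C
      set s := splitCircles size f₁ f₂ t₁ (t₂ + size i) C
      simp only [totalSize_cons, ← add_assoc]
      refine ⟨ih₁, fun j hj => ?_⟩
      rcases List.mem_cons.1 hj with rfl | hj
      · by_cases hne : s.2 = []
        · rw [hne, totalSize_nil, add_zero, add_sub_cancel_right]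
          refine (not_le.1 hcond).le.trans (div_le_div_of_nonneg_right ?_ hf₁.le)
          linarith [totalSize_nonneg fun k hk => hposC k (hsub.1.subset hk)]
        · obtain ⟨k, hk⟩ := List.exists_mem_of_ne_nil _ hne
          refine le_trans (div_le_div_of_nonneg_right ?_ hf₂.le) (ih₂ k hk)
          linarith [hi k (hsub.2.subset hk)]
      · exact ih₂ j hj

/-- Both parts are nonempty, so the recursion of Split Packing strictly decreases the number of
circles; and the largest circle goes to the long child. -/
theorem splitCircles_two (hf₁ : 0 < f₁) {i j : ℕ} (C : List ℕ) (hi : 0 < size i) :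
    i ∈ (splitCircles size f₁ f₂ 0 0 (i :: j :: C)).1 ∧
      j ∈ (splitCircles size f₁ f₂ 0 0 (i :: j :: C)).2 := by
  have : ¬ size i / f₁ ≤ 0 := not_le.2 (by positivity)
  simp [splitCircles, this]

end SplitCircles

/-! ### Correctness of offline Split Packing. -/

namespace Frame

variable (F : Frame) {p m h r : ℝ}

/-- Parent and long child have the same angle at the long corner. -/
theorem roundedAngle_longFrame (L : Legs p m h r) {κ : ℝ} (hκ : 0 < κ) (b : ℝ) :
    roundedAngle ((F.longFrame L κ).tri (κ * p) (κ * m)).long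
        ((F.longFrame L κ).tri (κ * p) (κ * m)).right
        ((F.longFrame L κ).tri (κ * p) (κ * m)).short b =
      roundedAngle (F.tri p m).long (F.tri p m).right (F.tri p m).short b := by
  ext x
  rw [mem_roundedAngle_long _ (L.scale hκ), mem_roundedAngle_long _ L]
  simp only [longFrame_v, F.longFrame_w L hκ]
  exact exists_congr fun z => and_congr_right fun _ => and_comm

theorem closedBall_subset_roundedAngle_long (L : Legs p m h r) {b c : ℝ} {z : Plane} (hbc : b ≤ c)
    (hz : F.Within p m h (discRadius c) z) :
    closedBall z (discRadius c) ⊆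
      roundedAngle (F.tri p m).long (F.tri p m).right (F.tri p m).short b := by
  intro x hx
  apply F.roundedAngle_long_anti L hbc
  rw [F.mem_roundedAngle_long L]
  exact ⟨z, hx, hz.2⟩

theorem closedBall_subset_roundedAngle_short (L : Legs p m h r) {b c : ℝ} {z : Plane}
    (hbc : b ≤ c) (hz : F.Within p m h (discRadius c) z) :
    closedBall z (discRadius c) ⊆
      roundedAngle (F.tri p m).short (F.tri p m).right (F.tri p m).long b := by
  have := F.swap.closedBall_subset_roundedAngle_long L.swap hbc (F.swap_within.2 hz)
  rwa [swap_tri] at this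

theorem along_ge_sub_dist (L : Legs p m h r) (x z : Plane) :
    F.along p m h z - dist x z ≤ F.along p m h x := by
  have e : ∀ x, F.along p m h x = -p / h * F.u x + m / h * F.v x + p * p / h := by
    intro x; simp only [along]; ring
  have := F.sub_le_of_unit (x := x) (z := z) (along_unit L)
  rw [e, e]; linarith

/-- The circles of `C` are packed into the triangle with the largest circle nearest to the long
corner. -/
structure Packed (size : ℕ → ℝ) (p m h : ℝ) (C : List ℕ) (P : List (ℕ × Plane)) : Prop where
  perm : (P.map Prod.fst).Perm C
  within : ∀ q ∈ P, F.Within p m h (discRadius (size q.1)) q.2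
  sep : P.Pairwise fun a b => discRadius (size a.1) + discRadius (size b.1) ≤ dist a.2 b.2
  rounded : ∀ i ∈ C, ∀ q ∈ P, closedBall q.2 (discRadius (size q.1)) ⊆
    roundedAngle (F.tri p m).long (F.tri p m).right (F.tri p m).short (size i)

theorem packed_nil (size : ℕ → ℝ) : F.Packed size p m h [] [] :=
  ⟨by simp, by simp, by simp, by simp⟩

theorem packed_singleton (L : Legs p m h r) {size : ℕ → ℝ} {i : ℕ} (hi : size i ≤ Real.pi * r ^ 2) :
    F.Packed size p m h [i] [(i, (F.tri p m).incenter)] := by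
  have hρ := discRadius_mono hi
  rw [discRadius_pi_mul_sq L.r_pos.le] at hρ
  have hw := F.within_incenter L hρ
  refine ⟨by simp, by simpa using hw, by simp, ?_⟩
  simp only [List.mem_singleton]
  rintro _ rfl _ rfl
  exact F.closedBall_subset_roundedAngle_long L le_rfl hw

/-- Discs in the long and in the short child do not overlap. -/
theorem dist_ge_of_children (L : Legs p m h r) {κ₁ κ₂ ρ₁ ρ₂ : ℝ} {x y : Plane}
    (hκ : κ₁ * p + κ₂ * m ≤ h)
    (hx : ρ₁ ≤ (F.longFrame L κ₁).u x) (hy : ρ₂ ≤ (F.shortFrame L κ₂).v y) :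
    ρ₁ + ρ₂ ≤ dist x y := by
  rw [longFrame_u] at hx
  rw [shortFrame_v] at hy
  refine F.disjoint_of_halfPlanes (γ := p * p / h - κ₁ * p) (along_unit L) ?_ ?_
  · have e : F.along p m h x = -p / h * F.u x + m / h * F.v x + p * p / h := by
      simp only [along]; ring
    linarith
  · have e : F.along p m h y = -p / h * F.u y + m / h * F.v y + p * p / h := by
      simp only [along]; ring
    linarith

/-- Two packed children give a packed triangle. -/
theorem Packed.append (L : Legs p m h r) {size : ℕ → ℝ} {C₁ C₂ : List ℕ}
    {P₁ P₂ : List (ℕ × Plane)} {κ₁ κ₂ : ℝ} (hκ₁ : 0 < κ₁) (hκ₂ : 0 < κ₂)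
    (hκ : κ₁ * p + κ₂ * m ≤ h)
    (h₁ : (F.longFrame L κ₁).Packed size (κ₁ * p) (κ₁ * m) (κ₁ * h) C₁ P₁)
    (h₂ : (F.shortFrame L κ₂).Packed size (κ₂ * p) (κ₂ * m) (κ₂ * h) C₂ P₂)
    (hc₁ : ∀ i ∈ C₁, h * (κ₁ * r) - p * r ≤ (h - p) * discRadius (size i))
    (hc₂ : ∀ i ∈ C₂, h * (κ₂ * r) - m * r ≤ (h - m) * discRadius (size i))
    {i₀ : ℕ} (hi₀ : i₀ ∈ C₁) (hmax : ∀ i ∈ C₁ ++ C₂, size i ≤ size i₀)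
    (hκr : discRadius (size i₀) ≤ κ₁ * r) :
    F.Packed size p m h (C₁ ++ C₂) (P₁ ++ P₂) := by
  have hw₁ : ∀ q ∈ P₁, F.Within p m h (discRadius (size q.1)) q.2 := fun q hq =>
    F.within_of_longFrame L hκ₁ (h₁.within q hq)
      (hc₁ _ (h₁.perm.subset (List.mem_map_of_mem hq)))
  have hw₂ : ∀ q ∈ P₂, F.Within p m h (discRadius (size q.1)) q.2 := fun q hq =>
    F.within_of_shortFrame L hκ₂ (h₂.within q hq)
      (hc₂ _ (h₂.perm.subset (List.mem_map_of_mem hq)))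
  refine ⟨?_, ?_, ?_, ?_⟩
  · rw [List.map_append]; exact h₁.perm.append h₂.perm
  · intro q hq
    exact (List.mem_append.1 hq).elim (hw₁ q) (hw₂ q)
  · refine List.pairwise_append.2 ⟨h₁.sep, h₂.sep, fun a ha b hb => ?_⟩
    exact F.dist_ge_of_children L hκ (h₁.within a ha).1 (h₂.within b hb).2.1
  · intro i hi q hq
    refine Set.Subset.trans ?_ (F.roundedAngle_long_anti L (hmax i hi))
    rcases List.mem_append.1 hq with hq | hq
    · rw [← F.roundedAngle_longFrame L hκ₁]
      exact h₁.rounded i₀ hi₀ q hq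
    -- Discs of the short child lie beyond the altitude of the long child, whose inradius is at
    -- least the radius of the largest circle `i₀`. So the rounding does not reach them.
    · intro x hx
      have hρ := discRadius_nonneg (size q.1)
      refine F.mem_roundedAngle_of_beyond L ((F.closedBall_v hρ).2 (hw₂ q hq).2.1 x hx)
        ((F.closedBall_w L hρ).2 (hw₂ q hq).2.2 x hx) ?_ hκr
      have h3 := (h₂.within q hq).2.1
      rw [shortFrame_v] at h3
      have h4 := F.along_ge_sub_dist L x q.2
      rw [mem_closedBall] at hx
      linarith

/-- Correctness of the Split Packing Algorithm. -/
theorem packed_splitPackAux {size : ℕ → ℝ} (d : ℕ) (F : Frame) {p m h r : ℝ} (L : Legs p m h r)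
    {C : List ℕ} (hd : C.length ≤ d) (hpos : ∀ i ∈ C, 0 < size i)
    (hs : C.Pairwise fun j k => size k ≤ size j) (htot : totalSize size C ≤ Real.pi * r ^ 2) :
    F.Packed size p m h C (splitPackAux size d (F.tri p m) C) := by
  induction d generalizing F p m h r C with
  | zero =>
    obtain rfl := List.length_eq_zero_iff.1 (Nat.le_zero.1 hd)
    rw [splitPackAux]; exact F.packed_nil size
  | succ d ih =>
    match C with
    | [] => rw [splitPackAux]; exact F.packed_nil size
    | [i] =>
      rw [splitPackAux]
      exact F.packed_singleton L (by simpa [totalSize] using htot)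
    | i :: j :: C =>
      rw [splitPackAux]
      have hp := L.p_pos
      have hm := L.m_pos
      have hh := L.h_pos
      have hr := L.r_pos
      have hf₁ : 0 < (F.tri p m).idealLong.capacity := by
        rw [F.capacity_idealLong L]; positivity
      have hf₂ : 0 < (F.tri p m).idealShort.capacity := by
        rw [F.capacity_idealShort L]; positivity
      have hperm := splitCircles_perm size (F.tri p m).idealLong.capacity
        (F.tri p m).idealShort.capacity 0 0 (i :: j :: C)
      have hsub := splitCircles_sublist size (F.tri p m).idealLong.capacity
        (F.tri p m).idealShort.capacity 0 0 (i :: j :: C)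
      have hbal := splitCircles_balanced hf₁ hf₂ hpos hs 0 0
      obtain ⟨hi, hj⟩ := splitCircles_two (f₂ := (F.tri p m).idealShort.capacity) hf₁ (j := j) C
        (hpos i (by simp))
      set s := splitCircles size (F.tri p m).idealLong.capacity
        (F.tri p m).idealShort.capacity 0 0 (i :: j :: C)
      simp only [zero_add] at hbal
      have hlen := hperm.length_eq
      have hl₁ := List.length_pos_of_mem hi
      have hl₂ := List.length_pos_of_mem hj
      rw [List.length_append] at hlen
      have hpos₁ : ∀ k ∈ s.1, 0 < size k := fun k hk => hpos k (hsub.1.subset hk)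
      have hpos₂ : ∀ k ∈ s.2, 0 < size k := fun k hk => hpos k (hsub.2.subset hk)
      have ha₁ := totalSize_pos hpos₁ (List.ne_nil_of_mem hi)
      have ha₂ := totalSize_pos hpos₂ (List.ne_nil_of_mem hj)
      rw [← totalSize_perm hperm, totalSize_append] at htot
      set a₁ := totalSize size s.1
      set a₂ := totalSize size s.2
      have hρ₁ := discRadius_pos ha₁
      have hρ₂ := discRadius_pos ha₂
      have e₁ := pi_mul_discRadius_sq ha₁.le
      have e₂ := pi_mul_discRadius_sq ha₂.le
      have hsum : discRadius a₁ ^ 2 + discRadius a₂ ^ 2 ≤ r ^ 2 := by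
        apply le_of_mul_le_mul_left _ Real.pi_pos
        linarith
      have ed₁ : discRadius a₁ / r * r = discRadius a₁ := div_mul_cancel₀ _ hr.ne'
      have ed₂ : discRadius a₂ / r * r = discRadius a₂ := div_mul_cancel₀ _ hr.ne'
      have p₁ := ih (F.longFrame L (discRadius a₁ / r)) (L.scale (div_pos hρ₁ hr)) (C := s.1)
        (by omega) hpos₁ (hs.sublist hsub.1) (by rw [ed₁, e₁])
      have p₂ := ih (F.shortFrame L (discRadius a₂ / r)) (L.scale (div_pos hρ₂ hr)) (C := s.2)
        (by omega) hpos₂ (hs.sublist hsub.2) (by rw [ed₂, e₂])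
      rw [← F.longChild_tri L ha₁] at p₁
      rw [← F.shortChild_tri L ha₂] at p₂
      -- Translates the balance of areas relative to the ideal capacities, which are proportional to
      -- the squares of the legs, into the hypothesis of `curve_le_of_balanced`. It is stated
      -- symmetrically to serve both children.
      have bal : ∀ {x y c a b : ℝ}, 0 < a → 0 < b → 0 ≤ c → 0 ≤ y → 0 ≤ x →
          (Real.pi * x ^ 2 - c) / (Real.pi * (a / h * r) ^ 2) ≤
            Real.pi * y ^ 2 / (Real.pi * (b / h * r) ^ 2) →
          (x ^ 2 - discRadius c ^ 2) * b ^ 2 ≤ y ^ 2 * a ^ 2 := by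
        intro x y c a b ha hb hc hy hx H
        rw [← pi_mul_discRadius_sq hc, ← mul_sub, mul_div_mul_left _ _ Real.pi_ne_zero,
          mul_div_mul_left _ _ Real.pi_ne_zero, div_le_div_iff₀ (by positivity)
          (by positivity)] at H
        have : 0 < r ^ 2 / h ^ 2 := by positivity
        apply le_of_mul_le_mul_left _ this
        calc r ^ 2 / h ^ 2 * ((x ^ 2 - discRadius c ^ 2) * b ^ 2)
            = (x ^ 2 - discRadius c ^ 2) * (b / h * r) ^ 2 := by field_simp
          _ ≤ _ := H
          _ = r ^ 2 / h ^ 2 * (y ^ 2 * a ^ 2) := by field_simp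
      have key := Packed.append F L (div_pos hρ₁ hr) (div_pos hρ₂ hr)
        (L.scaled_le (by
          rw [div_pow, div_pow, ← add_div, div_le_one (by positivity)]; exact hsum)) p₁ p₂
        (fun k hk => by
          rw [ed₁]
          refine L.curve_le_of_balanced (discRadius_nonneg _) hsum ?_
          have := hbal.1 k hk
          rw [← e₁, ← e₂, F.capacity_idealLong L, F.capacity_idealShort L] at this
          exact bal hp hm (hpos₁ k hk).le hρ₂.le hρ₁.le this)
        (fun k hk => by
          rw [ed₂]
          refine L.swap.curve_le_of_balanced (ρ₂ := discRadius a₁) (discRadius_nonneg _)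
            (by linarith) ?_
          have := hbal.2 k hk
          rw [← e₁, ← e₂, F.capacity_idealLong L, F.capacity_idealShort L] at this
          exact bal hm hp (hpos₂ k hk).le hρ₁.le hρ₂.le this)
        hi (fun k hk => by
          rcases List.mem_cons.1 (hperm.subset hk) with rfl | hk
          · exact le_rfl
          · exact (List.pairwise_cons.1 hs).1 k hk)
        (by rw [ed₁]; exact discRadius_mono (le_totalSize hpos₁ hi))
      exact ⟨key.perm.trans hperm, key.within, key.sep,
        fun k hk => key.rounded k (hperm.symm.subset hk)⟩

theorem packed_splitPack {size : ℕ → ℝ} (L : Legs p m h r)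
    {C : List ℕ} (hpos : ∀ i ∈ C, 0 < size i)
    (hs : C.Pairwise fun j k => size k ≤ size j) (htot : totalSize size C ≤ Real.pi * r ^ 2) :
    F.Packed size p m h C (splitPack size (F.tri p m) C) :=
  packed_splitPackAux _ F L le_rfl hpos hs htot

end Frame

/-! ### The size of the roundings. -/

theorem Triangle.region_swap (T : Triangle) : T.swap.region = T.region := by
  simp only [Triangle.region, Triangle.swap, Set.pair_comm T.short T.long]

theorem Hat.region_swap (T : Triangle) (b b' : ℝ) :
    (⟨T.swap, b', b⟩ : Hat).region = (⟨T, b, b'⟩ : Hat).region := by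
  simp only [Hat.region, Triangle.region_swap]
  rw [Set.inter_right_comm]; rfl

theorem Triangle.shortCurve_nonneg (T : Triangle) (a : ℝ) : 0 ≤ T.shortCurve a :=
  Real.sInf_nonneg fun _ hb => hb.1

theorem Triangle.shortCurve_eq_swap {T : Triangle} (h : T.swap.foot = T.foot) (a : ℝ) :
    T.shortCurve a = T.swap.longCurve a := by
  rw [Triangle.shortCurve, Triangle.longCurve, Triangle.shortChild_eq_swap h]
  congr 1
  ext b
  simp only [Set.mem_ofPred_eq, Hat.region_swap, Triangle.region_swap]

namespace Frame

variable (F : Frame) {p m h r : ℝ}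

theorem mem_roundedAngle_long_zero (L : Legs p m h r) {x : Plane} :
    x ∈ roundedAngle (F.tri p m).long (F.tri p m).right (F.tri p m).short 0 ↔
      0 ≤ F.v x ∧ 0 ≤ F.w p m h x := by
  rw [F.mem_roundedAngle_long L, discRadius_zero]
  constructor
  · rintro ⟨z, h1, h2, h3⟩
    obtain rfl := dist_le_zero.1 h1
    exact ⟨h2, h3⟩
  · rintro ⟨h2, h3⟩
    exact ⟨x, by simp, h2, h3⟩

theorem mem_roundedAngle_short_zero (L : Legs p m h r) {x : Plane} :
    x ∈ roundedAngle (F.tri p m).short (F.tri p m).right (F.tri p m).long 0 ↔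
      0 ≤ F.u x ∧ 0 ≤ F.w p m h x := by
  have := F.swap.mem_roundedAngle_long_zero L.swap (x := x)
  rwa [swap_tri, swap_v, swap_w] at this

/-- A point of the rounded long child lies on the inner side of the short leg. -/
theorem u_nonneg_of_mem_long (L : Legs p m h r) {κ b b' : ℝ} (hκ : 0 < κ) {x : Plane}
    (hb : h * (κ * r) - p * r ≤ (h - p) * discRadius b)
    (hx : x ∈ (⟨(F.longFrame L κ).tri (κ * p) (κ * m), b', b⟩ : Hat).region) : 0 ≤ F.u x := by
  obtain ⟨z, h1, h2, h3⟩ := ((F.longFrame L κ).mem_roundedAngle_short (L.scale hκ)).1 hx.2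
  rw [longFrame_u] at h2
  rw [longFrame_w _ _ hκ] at h3
  have := F.le_u_of_long L h2 h3 hb
  linarith [F.u_ge_sub_dist x z]

theorem v_nonneg_of_mem_short (L : Legs p m h r) {κ b b' : ℝ} (hκ : 0 < κ) {x : Plane}
    (hb : h * (κ * r) - m * r ≤ (h - m) * discRadius b)
    (hx : x ∈ (⟨(F.shortFrame L κ).tri (κ * p) (κ * m), b, b'⟩ : Hat).region) : 0 ≤ F.v x := by
  rw [shortFrame, swap_tri, Hat.region_swap] at hx
  exact F.swap.u_nonneg_of_mem_long L.swap hκ hb hx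

theorem mem_longCurve_set (L : Legs p m h r) {a c : ℝ} (ha : 0 < a) (hc : 0 ≤ c)
    (hac : h * discRadius a - p * r ≤ (h - p) * discRadius c) :
    c ∈ {b | 0 ≤ b ∧ (⟨(F.tri p m).longChild a, 0, b⟩ : Hat).region ⊆ (F.tri p m).region} := by
  refine ⟨hc, fun x hx => ?_⟩
  have hr := L.r_pos
  have hκ := div_pos (discRadius_pos ha) hr
  rw [F.longChild_tri L ha] at hx
  have h1 := ((F.longFrame L _).mem_region_tri (L.scale hκ)).1 hx.1.1
  rw [longFrame_v, F.longFrame_w L hκ] at h1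
  refine (F.mem_region_tri L).2 ⟨F.u_nonneg_of_mem_long L hκ ?_ hx, h1.2.2, h1.2.1⟩
  rwa [div_mul_cancel₀ _ hr.ne']

/-- A circle that satisfies the curve condition is at least as large as the rounding, so it is
unaffected by it and can witness the Packing Invariant. -/
theorem longCurve_le (L : Legs p m h r) {a c : ℝ} (ha : 0 < a) (hc : 0 ≤ c)
    (hac : h * discRadius a - p * r ≤ (h - p) * discRadius c) : (F.tri p m).longCurve a ≤ c :=
  csInf_le ⟨0, fun _ hb => hb.1⟩ (F.mem_longCurve_set L ha hc hac)

/-- If the rounding is too small, the disc of that size fitting snugly into the short corner of the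
child survives the trimming and crosses the short leg. -/
theorem le_of_mem_longCurve_set (L : Legs p m h r) {a b : ℝ} (ha : 0 < a)
    (har : a ≤ Real.pi * r ^ 2)
    (hb : (⟨(F.tri p m).longChild a, 0, b⟩ : Hat).region ⊆ (F.tri p m).region) :
    h * discRadius a - p * r ≤ (h - p) * discRadius b := by
  by_contra! hlt
  have hp := L.p_pos
  have hm := L.m_pos
  have hh := L.h_pos
  have hr := L.r_pos
  have hph := L.p_lt_h
  have hρ := discRadius_nonneg b
  have hρ₁ := discRadius_mono har
  rw [discRadius_pi_mul_sq hr.le] at hρ₁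
  -- The snug disc must be no larger than the child's incircle in order to lie in the child; this
  -- uses `a ≤ π r²`.
  have hρa : discRadius b ≤ discRadius a := by
    apply le_of_mul_le_mul_left _ (sub_pos.2 hph)
    have := mul_le_mul_of_nonneg_left hρ₁ hp.le
    linarith
  have hκ := div_pos (discRadius_pos ha) hr
  rw [F.longChild_tri L ha] at hb
  have hκr : discRadius a / r * r = discRadius a := div_mul_cancel₀ _ hr.ne'
  set κ := discRadius a / r
  rw [← hκr] at hlt hρa
  set ρ := discRadius b with hρdef
  -- the disc of radius `ρ` that fits snugly into the short corner of the long child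
  set z := F.pt (p - (h * (κ * p - ρ) - m * ρ) / p) ρ with hz
  have hvz : F.v z = ρ := F.v_pt _ _
  have huz : p * F.u z = p ^ 2 - (h * (κ * p - ρ) - m * ρ) := by
    rw [hz, u_pt]; field_simp
  have haz : F.along p m h z = κ * p - ρ := by
    apply mul_left_cancel₀ hh.ne'
    rw [F.h_mul_along L, hvz]; linear_combination -huz
  have hwz : ρ ≤ F.w p m h z := by
    have e := F.h_mul_v L z
    rw [hvz, haz] at e
    apply le_of_mul_le_mul_left _ (mul_pos hp hr)
    have e1 := mul_le_mul_of_nonneg_left hρa (mul_pos hp hm).le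
    linear_combination -r * e + e1 + ρ * L.r_mul
  have hlt' : F.u z < ρ := by
    apply lt_of_mul_lt_mul_left _ (mul_pos hp hr).le
    have e1 := mul_lt_mul_of_pos_left hlt hp
    linear_combination e1 + r * huz + ρ * L.r_mul_long
  have hW : (F.longFrame L κ).Within (κ * p) (κ * m) (κ * h) ρ z := by
    refine ⟨?_, ?_, ?_⟩
    · rw [longFrame_u, haz]; linarith
    · rwa [longFrame_v]
    · rw [longFrame_w _ _ hκ, hvz]
  -- The point of the snug disc farthest out in the direction of the short leg; its first coordinate
  -- is negative.
  have hx : F.pt (F.u z - ρ) ρ ∈ closedBall z ρ := by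
    rw [mem_closedBall]
    apply F.dist_le hρ
    simp [hvz]
  have hreg := ((F.longFrame L κ).closedBall_subset_region (L.scale hκ) hρ).2 hW hx
  have hmem := ((F.longFrame L κ).mem_region_tri (L.scale hκ)).1 hreg
  have := hb ⟨⟨hreg, ((F.longFrame L κ).mem_roundedAngle_long_zero (L.scale hκ)).2 hmem.2⟩,
    ((F.longFrame L κ).mem_roundedAngle_short (L.scale hκ)).2 ⟨z, hx, hW.1, hW.2.2⟩⟩
  have := ((F.mem_region_tri L).1 this).1
  rw [u_pt] at this
  linarith

/-- The rounding of the long child is large enough. -/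
theorem le_longCurve (L : Legs p m h r) {a : ℝ} (ha : 0 < a) (har : a ≤ Real.pi * r ^ 2) :
    h * discRadius a - p * r ≤ (h - p) * discRadius ((F.tri p m).longCurve a) := by
  have hph := sub_pos.2 L.p_lt_h
  rcases le_or_gt (h * discRadius a - p * r) 0 with h0 | h0
  · exact h0.trans (mul_nonneg hph.le (discRadius_nonneg _))
  set ρ := (h * discRadius a - p * r) / (h - p) with hρ
  have hρ0 : 0 < ρ := div_pos h0 hph
  have e : h * discRadius a - p * r = (h - p) * ρ := by rw [hρ]; field_simp
  have hle : Real.pi * ρ ^ 2 ≤ (F.tri p m).longCurve a := by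
    apply le_csInf
    · refine ⟨_, F.mem_longCurve_set L ha (c := Real.pi * ρ ^ 2) (by positivity) ?_⟩
      rw [discRadius_pi_mul_sq hρ0.le, e]
    · intro b hb
      have h1 := F.le_of_mem_longCurve_set L ha har hb.2
      rw [e] at h1
      have h2 := le_of_mul_le_mul_left h1 hph
      rw [← pi_mul_discRadius_sq hb.1]
      gcongr
  have := discRadius_mono hle
  rw [discRadius_pi_mul_sq hρ0.le] at this
  rw [e]
  gcongr

theorem shortCurve_le (L : Legs p m h r) {a c : ℝ} (ha : 0 < a) (hc : 0 ≤ c)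
    (hac : h * discRadius a - m * r ≤ (h - m) * discRadius c) : (F.tri p m).shortCurve a ≤ c := by
  rw [Triangle.shortCurve_eq_swap (F.foot_swap L), ← swap_tri]
  exact F.swap.longCurve_le L.swap ha hc hac

theorem le_shortCurve (L : Legs p m h r) {a : ℝ} (ha : 0 < a) (har : a ≤ Real.pi * r ^ 2) :
    h * discRadius a - m * r ≤ (h - m) * discRadius ((F.tri p m).shortCurve a) := by
  rw [Triangle.shortCurve_eq_swap (F.foot_swap L), ← swap_tri]
  exact F.swap.le_longCurve L.swap ha har

end Frame

/-! ### Valid splits of semihats. -/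

/-- The circles `CL` are packed into the left child `X.1` by Split Packing, within the bounds `R` of
the node, and apart from everything in the right child `X.2`, of capacity `aR`. -/
structure ValidSplit (size : ℕ → ℝ) (R : Set Plane) (X : Hat × Hat) (aR : ℝ)
    (CL : List ℕ) : Prop where
  perm : ((splitPack size X.1.tri CL).map Prod.fst).Perm CL
  subset : ∀ q ∈ splitPack size X.1.tri CL,
    closedBall q.2 (discRadius (size q.1)) ⊆ X.1.region ∩ R
  sep : (splitPack size X.1.tri CL).Pairwise fun a b =>
    discRadius (size a.1) + discRadius (size b.1) ≤ dist a.2 b.2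
  right_subset : 0 < aR → X.2.region ⊆ R
  right_sep : 0 < aR → ∀ q ∈ splitPack size X.1.tri CL, ∀ (z : Plane) (ρ : ℝ), 0 ≤ ρ →
    closedBall z ρ ⊆ X.2.region → discRadius (size q.1) + ρ ≤ dist q.2 z

namespace Frame

variable (F : Frame) {p m h r : ℝ}

/-- The curve conditions `hc` and `hbR` keep the left discs and the right child inside the triangle.
At the long corner a rounding up to some circle of `CL` is harmless by `Packed.rounded`; at the
short corner of the left child every disc has to be at least as large as the rounding, whence the
different quantifiers in `hbL` and `hbS`. -/
theorem validSplit_hat (L : Legs p m h r) {size : ℕ → ℝ} {b : ℝ} (hb0 : 0 ≤ b)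
    {aL aR : ℝ} (haL : 0 < aL) (haR : 0 ≤ aR) (ha : aL + aR = Real.pi * r ^ 2) {CL : List ℕ}
    (hpos : ∀ i ∈ CL, 0 < size i) (hs : CL.Pairwise fun j k => size k ≤ size j)
    (htot : totalSize size CL ≤ aL) (hb : 0 < b → ∃ i ∈ CL, b ≤ size i)
    (hc : ∀ i ∈ CL, h * discRadius aL - p * r ≤ (h - p) * discRadius (size i))
    {bL bS bR : ℝ} (hbS : ∀ i ∈ CL, bS ≤ size i) (hbL : CL ≠ [] → ∃ i ∈ CL, bL ≤ size i)
    (hbR : 0 < aR → h * discRadius aR - m * r ≤ (h - m) * discRadius bR) :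
    ValidSplit size (⟨F.tri p m, b, 0⟩ : Hat).region
      (⟨(F.tri p m).longChild aL, bL, bS⟩, ⟨(F.tri p m).shortChild aR, bR, 0⟩) aR CL := by
  have hr := L.r_pos
  have hκ := div_pos (discRadius_pos haL) hr
  have hκr : discRadius aL / r * r = discRadius aL := div_mul_cancel₀ _ hr.ne'
  have P := (F.longFrame L (discRadius aL / r)).packed_splitPack (L.scale hκ) hpos hs
    (by rwa [hκr, pi_mul_discRadius_sq haL.le])
  have eL := F.longChild_tri L haL
  have hbr : discRadius b ≤ discRadius aL := by
    rcases hb0.eq_or_lt with rfl | hb'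
    · rw [discRadius_zero]; exact discRadius_nonneg _
    · obtain ⟨i, hi, hbi⟩ := hb hb'
      exact discRadius_mono (hbi.trans ((le_totalSize hpos hi).trans htot))
  have hsum : (discRadius aL / r) ^ 2 + (discRadius aR / r) ^ 2 ≤ 1 := by
    rw [div_pow, div_pow, ← add_div, div_le_one (by positivity)]
    apply le_of_mul_le_mul_left _ Real.pi_pos
    rw [mul_add, pi_mul_discRadius_sq haL.le, pi_mul_discRadius_sq haR, ha]
  have hκκ := L.scaled_le hsum
  have hregR : 0 < aR → ∀ x ∈ (⟨(F.tri p m).shortChild aR, bR, 0⟩ : Hat).region,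
      0 ≤ F.u x ∧ 0 ≤ F.v x ∧ 0 ≤ F.w p m h x ∧
        discRadius aL / r * p ≤ F.along p m h x := by
    intro haR x hx
    have hκ₂ := div_pos (discRadius_pos haR) hr
    rw [F.shortChild_tri L haR] at hx
    have hv := F.v_nonneg_of_mem_short L hκ₂ (by
      rw [div_mul_cancel₀ _ hr.ne']; exact hbR haR) hx
    have h1 := ((F.shortFrame L _).mem_region_tri (L.scale hκ₂)).1 hx.1.1
    rw [shortFrame_u, shortFrame_v, F.shortFrame_w L hκ₂] at h1
    exact ⟨h1.2.2, hv, h1.1, by linarith⟩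
  refine ⟨?_, ?_, ?_, ?_, ?_⟩
  · simp only [eL]; exact P.perm
  · intro q hq
    simp only [eL] at hq ⊢
    have hqC : q.1 ∈ CL := P.perm.subset (List.mem_map_of_mem hq)
    have hρ := discRadius_nonneg (size q.1)
    have hW := P.within q hq
    have hW' := F.within_of_longFrame L hκ hW (by rw [hκr]; exact hc _ hqC)
    obtain ⟨i, hi, hbi⟩ := hbL (List.ne_nil_of_mem hqC)
    have hbq : ∃ i ∈ CL, b ≤ size i := by
      rcases hb0.eq_or_lt with rfl | hb'
      · exact ⟨q.1, hqC, (hpos _ hqC).le⟩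
      · exact hb hb'
    obtain ⟨j, hj, hbj⟩ := hbq
    refine Set.subset_inter (Set.subset_inter (Set.subset_inter ?_ ?_) ?_)
      (Set.subset_inter (Set.subset_inter ?_ ?_) ?_)
    · exact (closedBall_subset_region _ (L.scale hκ) hρ).2 hW
    · exact (P.rounded i hi q hq).trans (roundedAngle_long_anti _ (L.scale hκ) hbi)
    · exact closedBall_subset_roundedAngle_short _ (L.scale hκ) (hbS _ hqC) hW
    · exact (F.closedBall_subset_region L hρ).2 hW'
    · have := P.rounded j hj q hq
      rw [F.roundedAngle_longFrame L hκ] at this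
      exact this.trans (F.roundedAngle_long_anti L hbj)
    · exact F.closedBall_subset_roundedAngle_short L (hpos _ hqC).le hW'
  · simp only [eL]; exact P.sep
  · intro haR x hx
    obtain ⟨h1, h2, h3, h4⟩ := hregR haR x hx
    exact ⟨⟨(F.mem_region_tri L).2 ⟨h1, h2, h3⟩,
      F.mem_roundedAngle_of_beyond L h2 h3 h4 (by rwa [hκr])⟩,
      (F.mem_roundedAngle_short_zero L).2 ⟨h1, h3⟩⟩
  · intro haR q hq z ρ hρ hz
    have hκ₂ := div_pos (discRadius_pos haR) hr
    simp only [eL] at hq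
    have h1 := hz.trans (Set.inter_subset_left.trans Set.inter_subset_left)
    simp only [F.shortChild_tri L haR] at h1
    rw [closedBall_subset_region _ (L.scale hκ₂) hρ] at h1
    exact F.dist_ge_of_children L hκκ (P.within q hq).1 h1.2.1

end Frame

/-! ### Greedy filling. -/

section GreedyFill

variable {size : ℕ → ℝ} {cap : ℝ}

theorem greedyFill_perm (t : ℝ) (C : List ℕ) :
    ((greedyFill size cap t C).1 ++ (greedyFill size cap t C).2).Perm C := by
  induction C generalizing t with
  | nil => simp [greedyFill]
  | cons i C ih =>
    rw [greedyFill]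
    split
    · simpa using ih _
    · exact List.perm_middle.trans ((ih _).cons i)

theorem greedyFill_sublist (t : ℝ) (C : List ℕ) :
    (greedyFill size cap t C).1.Sublist C ∧ (greedyFill size cap t C).2.Sublist C := by
  induction C generalizing t with
  | nil => simp [greedyFill]
  | cons i C ih =>
    rw [greedyFill]
    split
    · exact ⟨(ih _).1.cons_cons i, (ih _).2.cons i⟩
    · exact ⟨(ih _).1.cons i, (ih _).2.cons_cons i⟩

theorem greedyFill_le {t : ℝ} (ht : t ≤ cap) (C : List ℕ) :
    t + totalSize size (greedyFill size cap t C).1 ≤ cap := by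
  induction C generalizing t with
  | nil => simpa [greedyFill, totalSize]
  | cons i C ih =>
    rw [greedyFill]
    split
    · rename_i h
      have := ih h
      simp only [totalSize_cons]; linarith
    · exact ih ht

/-- Later additions only increase the left total, so a circle rejected once does not fit at the end
either. Every rejected circle therefore exceeds the waste. -/
theorem lt_of_mem_greedyFill (t : ℝ) {C : List ℕ} (hpos : ∀ i ∈ C, 0 < size i) {i : ℕ}
    (hi : i ∈ (greedyFill size cap t C).2) :
    cap < t + totalSize size (greedyFill size cap t C).1 + size i := by
  induction C generalizing t with
  | nil => simp [greedyFill] at hi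
  | cons j C ih =>
    have hpos' : ∀ i ∈ C, 0 < size i := fun k hk => hpos k (List.mem_cons_of_mem _ hk)
    have hsub := greedyFill_sublist (size := size) (cap := cap) t C
    rw [greedyFill] at hi ⊢
    split at hi
    · rename_i h
      have := ih (t + size j) hpos' hi
      simp only [h, if_true, totalSize_cons]; linarith
    · rename_i h
      simp only [h, if_false]
      rcases List.mem_cons.1 hi with rfl | hi
      · have := totalSize_nonneg (size := size) fun k hk => hpos' k (hsub.1.subset hk)
        linarith
      · exact ih t hpos' hi

theorem mem_greedyFill_head {i : ℕ} {C : List ℕ} {t : ℝ} (h : t + size i ≤ cap) :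
    i ∈ (greedyFill size cap t (i :: C)).1 := by
  simp [greedyFill, h]

end GreedyFill

/-! ### Inequalities for the threshold of `Repack` on a triangle. -/

namespace Legs

variable {p m h r : ℝ}

theorem deltaShort_eq (L : Legs p m h r) :
    deltaShort (p / m) = (2 * (h - m) / (2 * h - m)) ^ 2 := by
  have hm := L.m_pos
  have hh := L.h_pos
  have : 2 * h - m ≠ 0 := by linarith [L.m_lt_h]
  have e : Real.sqrt (1 + (p / m) ^ 2) = h / m := by
    rw [Real.sqrt_eq_iff_mul_self_eq (by positivity) (by positivity)]
    field_simp; linear_combination -L.sq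
  have e2 : 2 * (h / m) - 1 ≠ 0 := by
    have : 2 * (h / m) - 1 = (2 * h - m) / m := by field_simp
    rw [this]; positivity
  rw [deltaShort, e]
  congr 1
  field_simp
  ring

/-- A circle that does not fit into the long part is large enough for the rounding of the short
child, if the waste is below the threshold. -/
theorem curve_le_of_delta (L : Legs p m h r) {δ ρ : ℝ} (hδ : 0 ≤ δ) (hlt : δ < deltaShort (p / m))
    (hρ : ρ ^ 2 = r ^ 2 * (m ^ 2 / h ^ 2 + δ)) :
    h * ρ - m * r ≤ (h - m) * (r * Real.sqrt δ) := by
  have hm := L.m_pos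
  have hh := L.h_pos
  have hr := L.r_pos
  have hmh := L.m_lt_h
  rw [L.deltaShort_eq] at hlt
  have hy : 0 ≤ 2 * (h - m) / (2 * h - m) := div_nonneg (by linarith) (by linarith)
  set x := Real.sqrt δ with hx
  have hx0 : 0 ≤ x := Real.sqrt_nonneg _
  have hx2 : x ^ 2 = δ := Real.sq_sqrt hδ
  have hxy : x ≤ 2 * (h - m) / (2 * h - m) := by
    rw [← hx2] at hlt
    exact (abs_lt_of_sq_lt_sq' hlt hy).2.le
  rw [le_div_iff₀ (by linarith)] at hxy
  have hn : 0 ≤ m * r + (h - m) * (r * x) := by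
    have := mul_nonneg (sub_nonneg.2 hmh.le) (mul_nonneg hr.le hx0)
    positivity
  -- After expansion and division by `r ^ 2 * x * m` this is `x * (2 * h - m) ≤ 2 * (h - m)`, which
  -- is where the threshold comes from.
  have : (h * ρ) ^ 2 ≤ (m * r + (h - m) * (r * x)) ^ 2 := by
    have e : (h * ρ) ^ 2 = r ^ 2 * (m ^ 2 + h ^ 2 * x ^ 2) := by
      rw [mul_pow, hρ, hx2]; field_simp
    rw [e]
    have := mul_le_mul_of_nonneg_left hxy (by positivity : 0 ≤ r ^ 2 * x * m)
    linear_combination this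
  linarith [(abs_le_of_sq_le_sq' this hn).2]

theorem sq_h_ge (L : Legs p m h r) (hmp : m ≤ p) : 2 * m ^ 2 ≤ h ^ 2 := by
  nlinarith [L.sq, L.m_pos]

/-- If the waste reaches the threshold, then at most one circle has been put into the long part. -/
theorem le_three_delta (L : Legs p m h r) (hmp : m ≤ p) :
    p ^ 2 / h ^ 2 ≤ 3 * deltaShort (p / m) := by
  have hm := L.m_pos
  have hh := L.h_pos
  have hmh := L.m_lt_h
  rw [L.deltaShort_eq, div_pow, ← mul_div_assoc, div_le_div_iff₀ (by positivity)
    (pow_pos (by linarith) 2)]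
  have h141 : 1.41 * m ≤ h := by
    apply (abs_le_of_sq_le_sq' (a := 1.41 * m) _ hh.le).2
    nlinarith [L.sq_h_ge hmp]
  have e : p ^ 2 = (h - m) * (h + m) := by linear_combination -L.sq
  -- With `h - m` cancelled, the claim is that `8h³ - 12h²m + 3hm² - m³` is nonnegative. The right
  -- side is this cubic divided with remainder by `h - 1.41m`, where `1.41` is a lower bound for
  -- `√2`.
  have key : 0 ≤ (h - 1.41 * m) * (8 * h ^ 2 - 0.72 * h * m + 1.9848 * m ^ 2)
      + 1.798568 * m ^ 3 := by
    have : 0 ≤ 8 * h ^ 2 - 0.72 * h * m + 1.9848 * m ^ 2 := by nlinarith [sq_nonneg (h - m)]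
    have := mul_nonneg (sub_nonneg.2 h141) this
    positivity
  rw [e]
  have := mul_nonneg (sub_nonneg.2 hmh.le) key
  linear_combination this

/-- The form needed for `curve_le_of_two`. If `c₂ ≤ c₁` and `c₁ ≤ (p²/h² - δ) A`, the balance `c₁ m²
≤ (A - c₁ - c₂) p²` follows from `(p²/h² - δ)(m² + 2p²) ≤ p²`, and by Pythagoras this says `p⁴/h² ≤
δ (m² + 2p²)`. -/
theorem fourth_le_delta (L : Legs p m h r) :
    p ^ 4 / h ^ 2 ≤ deltaShort (p / m) * (m ^ 2 + 2 * p ^ 2) := by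
  have hm := L.m_pos
  have hh := L.h_pos
  have hmh := L.m_lt_h
  rw [L.deltaShort_eq, div_pow, div_mul_eq_mul_div, div_le_div_iff₀ (by positivity)
    (pow_pos (by linarith) 2)]
  have e : p ^ 2 = (h - m) * (h + m) := by linear_combination -L.sq
  have e4 : p ^ 4 = ((h - m) * (h + m)) ^ 2 := by rw [← e]; ring
  have key : 0 ≤ (h - m) * (4 * h ^ 3 - h * m ^ 2 + m ^ 3) := by
    apply mul_nonneg (by linarith)
    have h1 : m ^ 2 ≤ h ^ 2 := by gcongr
    have : h * m ^ 2 ≤ h * h ^ 2 := by gcongr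
    have : 0 ≤ m ^ 3 := by positivity
    nlinarith [pow_pos hh 3]
  rw [e, e4]
  have := mul_nonneg (sq_nonneg (h - m)) key
  linear_combination this

/-- If the waste reaches the threshold, then the two largest circles `c₁ ≥ c₂` are large enough for
the rounding of the long child. -/
theorem curve_le_of_two (L : Legs p m h r) {δ c₁ c₂ A : ℝ} (hA : A = Real.pi * r ^ 2)
    (hδ : deltaShort (p / m) ≤ δ) (hc₂ : 0 ≤ c₂) (h₁₂ : c₂ ≤ c₁)
    (h₁ : c₁ ≤ (p ^ 2 / h ^ 2 - δ) * A) (hsum : c₁ + c₂ ≤ A) :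
    h * discRadius (c₁ + c₂) - p * r ≤ (h - p) * discRadius c₂ := by
  have hp := L.p_pos
  have hm := L.m_pos
  have hh := L.h_pos
  have hr := L.r_pos
  have hA0 : 0 < A := by rw [hA]; positivity
  have e₁ : discRadius (c₁ + c₂) ^ 2 ≤ r ^ 2 := by
    apply le_of_mul_le_mul_left _ Real.pi_pos
    rw [pi_mul_discRadius_sq (by linarith)]; linarith
  refine L.curve_le_of_balanced (ρ₂ := Real.sqrt (r ^ 2 - discRadius (c₁ + c₂) ^ 2))
    (discRadius_nonneg _) ?_ ?_
  · rw [Real.sq_sqrt (by linarith)]; linarith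
  rw [Real.sq_sqrt (by linarith)]
  apply le_of_mul_le_mul_left _ Real.pi_pos
  have a₁ := pi_mul_discRadius_sq (a := c₁ + c₂) (by linarith)
  have a₂ := pi_mul_discRadius_sq hc₂
  -- the claim in terms of areas
  have key : c₁ * m ^ 2 ≤ (A - (c₁ + c₂)) * p ^ 2 := by
    have h4 : (p ^ 2 / h ^ 2 - 2 * δ) * p ^ 2 ≤ δ * m ^ 2 := by
      have h5 := L.fourth_le_delta
      have h6 : p ^ 4 / h ^ 2 = p ^ 2 / h ^ 2 * p ^ 2 := by ring
      have h7 := mul_le_mul_of_nonneg_right hδ (by positivity : 0 ≤ m ^ 2 + 2 * p ^ 2)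
      linarith
    have h8 : p ^ 2 / h ^ 2 * (p ^ 2 + m ^ 2) = p ^ 2 := by rw [← L.sq]; field_simp
    have h9 := mul_le_mul_of_nonneg_right h4 hA0.le
    have h10 := mul_le_mul_of_nonneg_right h₁ (by positivity : 0 ≤ m ^ 2 + 2 * p ^ 2)
    have h11 := mul_le_mul_of_nonneg_right h₁₂ (sq_nonneg p)
    nlinarith
  linear_combination key + (m ^ 2 + p ^ 2) * a₁ - m ^ 2 * a₂ + p ^ 2 * hA

end Legs

/-! ### Divisions made by `Repack`, and degenerate triangles. -/

/-- What `Repack` on the shape `S` and the circles `D` achieves at the first level. -/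
structure GoodDivision (size : ℕ → ℝ) (S : Shape) (D : List ℕ) (d : Division) : Prop where
  perm : (d.leftCircles ++ d.rightCircles).Perm D
  cap_add : d.leftCapacity + d.rightCapacity = S.capacity
  cap_left : (S.split d.leftCapacity d.rightCapacity).1.tri.capacity = d.leftCapacity
  cap_right : (S.split d.leftCapacity d.rightCapacity).2.tri.capacity = d.rightCapacity
  inv : PackingInvariant size (.hat (S.split d.leftCapacity d.rightCapacity).2) d.rightCircles
  valid : ValidSplit size S.region (S.split d.leftCapacity d.rightCapacity) d.rightCapacity
    d.leftCircles
  ne_nil : D ≠ [] → d.leftCircles ≠ []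
  half : D = [] → d.rightCapacity ≤ S.capacity / 2
  sublist : d.rightCircles.Sublist D

namespace Triangle

/-- The triangle that has shrunk to the point `x`. -/
def point (x : Plane) : Triangle := ⟨x, x, x⟩

theorem scale_zero (T : Triangle) (z : Plane) : T.scale z 0 = point z := by
  simp [scale, point]

theorem capacity_point (x : Plane) : (point x).capacity = 0 := by
  simp [capacity, inradius, point]

theorem point_isRightAngled (x : Plane) : (point x).IsRightAngled :=
  ⟨by simp [point], 1, le_rfl, by simp [point]⟩

theorem longChild_zero (T : Triangle) : T.longChild 0 = point T.long := by
  rw [longChild, zero_div, Real.sqrt_zero, scale_zero]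

theorem shortChild_zero (T : Triangle) : T.shortChild 0 = point T.short := by
  rw [shortChild, zero_div, Real.sqrt_zero, scale_zero]

theorem idealLong_point (x : Plane) : (point x).idealLong = point x := by
  simp [idealLong, foot, point]

theorem idealShort_point (x : Plane) : (point x).idealShort = point x := by
  simp [idealShort, foot, point]

theorem eq_point {T : Triangle} (hT : T.IsRightAngled) (h : dist T.right T.short = 0) :
    T = point T.right := by
  obtain ⟨-, s, -, hs⟩ := hT
  rw [h, mul_zero] at hs
  obtain ⟨a, b, c⟩ := T
  simp only [dist_eq_zero] at h hs
  subst h hs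
  rfl

end Triangle

theorem packingInvariant_nil {size : ℕ → ℝ} {H : Hat} (hH : H.tri.IsRightAngled)
    (hL : H.bLong = 0) (hS : H.bShort = 0) (hcap : 0 ≤ H.tri.capacity) :
    PackingInvariant size (.hat H) [] :=
  ⟨⟨⟨hH, hL.ge, hS⟩, fun h => absurd h (by simp [hL])⟩, hcap⟩

theorem goodDivision_point {size : ℕ → ℝ} {x : Plane} {b : ℝ} :
    GoodDivision size (.hat ⟨Triangle.point x, b, 0⟩) []
      ((Triangle.point x).divide size []) := by
  have e : (Triangle.point x).divide size [] = ⟨[], [], 0, 0⟩ := by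
    simp [Triangle.divide, Triangle.idealLong_point, Triangle.idealShort_point,
      Triangle.capacity_point, totalSize]
  have hs : (Shape.hat ⟨Triangle.point x, b, 0⟩).split 0 0 =
      (⟨Triangle.point x, max b ((Triangle.point x).longCurve 0), (Triangle.point x).longCurve 0⟩,
        ⟨Triangle.point x, 0, 0⟩) := by
    simp only [Shape.split, Hat.split, Triangle.idealLong_point, Triangle.capacity_point, le_refl,
      if_true, Triangle.longChild_zero, Triangle.shortChild_zero]
    rfl
  rw [e]
  have c0 := Triangle.capacity_point x
  refine ⟨by simp, ?_, ?_, ?_, ?_, ?_, fun h => absurd rfl h, ?_, by simp⟩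
  · simp [Shape.capacity, c0]
  · rw [hs]; exact c0
  · rw [hs]; exact c0
  · rw [hs]; exact packingInvariant_nil (Triangle.point_isRightAngled x) rfl rfl c0.ge
  · refine ⟨by simp [splitPack, splitPackAux], by simp [splitPack, splitPackAux],
      by simp [splitPack, splitPackAux], fun h => absurd h (lt_irrefl _),
      fun h => absurd h (lt_irrefl _)⟩
  · simp [Shape.capacity, c0]

namespace Frame

variable (F : Frame) {p m h r : ℝ}

theorem packingInvariant_shortChild (L : Legs p m h r) (hmp : m ≤ p) {size : ℕ → ℝ} {a b : ℝ}
    {C : List ℕ} (ha : 0 ≤ a) (hb : 0 ≤ b) (hC : 0 < b → ∃ i ∈ C, b ≤ size i)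
    (htot : totalSize size C ≤ a) :
    ((F.tri p m).shortChild a).capacity = a ∧
      PackingInvariant size (.hat ⟨(F.tri p m).shortChild a, b, 0⟩) C := by
  rcases ha.eq_or_lt with rfl | ha
  · have e : ((F.tri p m).shortChild 0).capacity = 0 := by
      rw [Triangle.shortChild_zero, Triangle.capacity_point]
    refine ⟨e, ⟨⟨?_, hb, rfl⟩, hC⟩, htot.trans e.ge⟩
    rw [Triangle.shortChild_zero]; exact Triangle.point_isRightAngled _
  · have e := F.capacity_shortChild L ha
    refine ⟨e, ⟨⟨?_, hb, rfl⟩, hC⟩, htot.trans e.ge⟩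
    have hκ := div_pos (discRadius_pos ha) L.r_pos
    rw [F.shortChild_tri L ha]
    exact tri_isRightAngled _ (L.scale hκ) (by gcongr)

theorem capacity_ideal_add (L : Legs p m h r) :
    (F.tri p m).idealLong.capacity + (F.tri p m).idealShort.capacity = Real.pi * r ^ 2 := by
  rw [F.capacity_idealLong L, F.capacity_idealShort L]
  have := L.h_pos
  field_simp
  linear_combination -r ^ 2 * L.sq

theorem h_mul_discRadius_le (L : Legs p m h r) {a : ℝ} (ha : a ≤ (F.tri p m).idealShort.capacity) :
    h * discRadius a ≤ m * r := by
  have hm := L.m_pos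
  have hh := L.h_pos
  have hr := L.r_pos
  have := discRadius_mono ha
  rw [F.capacity_idealShort L, discRadius_pi_mul_sq (by positivity), div_mul_eq_mul_div,
    le_div_iff₀ hh] at this
  linarith

/-- The properties of a division that make the split of a semihat valid. -/
theorem goodDivision_hat (L : Legs p m h r) (hmp : m ≤ p) {size : ℕ → ℝ} {b : ℝ} (hb0 : 0 ≤ b)
    {D : List ℕ} {d : Division} (hpos : ∀ i ∈ D, 0 < size i)
    (hb : 0 < b → ∃ i ∈ D, b ≤ size i)
    (perm : (d.leftCircles ++ d.rightCircles).Perm D)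
    (cap_add : d.leftCapacity + d.rightCapacity = Real.pi * r ^ 2)
    (haL : 0 < d.leftCapacity) (haR : 0 ≤ d.rightCapacity)
    (hL : totalSize size d.leftCircles ≤ d.leftCapacity)
    (hR : totalSize size d.rightCircles ≤ d.rightCapacity)
    (sorted : d.leftCircles.Pairwise fun j k => size k ≤ size j)
    (sublist : d.rightCircles.Sublist D)
    (hmax : D ≠ [] → ∃ i ∈ d.leftCircles, ∀ j ∈ D, size j ≤ size i)
    (hc : ∀ i ∈ d.leftCircles,
      h * discRadius d.leftCapacity - p * r ≤ (h - p) * discRadius (size i))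
    (hcR : d.leftCapacity < (F.tri p m).idealLong.capacity → ∃ i ∈ d.rightCircles,
      h * discRadius d.rightCapacity - m * r ≤ (h - m) * discRadius (size i))
    (half : D = [] → d.rightCapacity ≤ Real.pi * r ^ 2 / 2) :
    GoodDivision size (.hat ⟨F.tri p m, b, 0⟩) D d := by
  have hposL : ∀ i ∈ d.leftCircles, 0 < size i := fun i hi =>
    hpos i (perm.subset (List.mem_append_left _ hi))
  have hposR : ∀ i ∈ d.rightCircles, 0 < size i := fun i hi => hpos i (sublist.subset hi)
  have hbL : 0 < b → ∃ i ∈ d.leftCircles, b ≤ size i := by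
    intro hb'
    obtain ⟨j, hj, hbj⟩ := hb hb'
    obtain ⟨i, hi, him⟩ := hmax (List.ne_nil_of_mem hj)
    exact ⟨i, hi, hbj.trans (him j hj)⟩
  have hcapS : (Shape.hat ⟨F.tri p m, b, 0⟩).capacity = Real.pi * r ^ 2 := F.capacity_tri L
  have ne_nil : D ≠ [] → d.leftCircles ≠ [] := fun hD => by
    obtain ⟨i, hi, -⟩ := hmax hD
    exact List.ne_nil_of_mem hi
  have capL := F.capacity_longChild L haL
  have haR' : d.rightCapacity ≤ Real.pi * r ^ 2 := by linarith
  by_cases hcase : (F.tri p m).idealLong.capacity ≤ d.leftCapacity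
  · have hs : (Shape.hat ⟨F.tri p m, b, 0⟩).split d.leftCapacity d.rightCapacity =
        (⟨(F.tri p m).longChild d.leftCapacity, max b ((F.tri p m).longCurve d.leftCapacity),
          (F.tri p m).longCurve d.leftCapacity⟩,
        ⟨(F.tri p m).shortChild d.rightCapacity, 0, 0⟩) := by
      simp only [Shape.split, Hat.split, hcase, if_true]
    have hcurve : ∀ i ∈ d.leftCircles, (F.tri p m).longCurve d.leftCapacity ≤ size i :=
      fun i hi => F.longCurve_le L haL (hposL i hi).le (hc i hi)
    obtain ⟨capR, invR⟩ := F.packingInvariant_shortChild L hmp (size := size) haR le_rfl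
      (fun h => absurd h (lt_irrefl _)) hR
    refine ⟨perm, cap_add.trans hcapS.symm, ?_, ?_, ?_, ?_, ne_nil, fun hD => ?_, sublist⟩
    · rw [hs]; exact capL
    · rw [hs]; exact capR
    · rw [hs]; exact invR
    · rw [hs]
      refine F.validSplit_hat L hb0 haL haR cap_add hposL sorted hL hbL hc hcurve ?_ ?_
      · intro hne
        rcases hb0.eq_or_lt with rfl | hb'
        · obtain ⟨i, hi⟩ := List.exists_mem_of_ne_nil _ hne
          exact ⟨i, hi, max_le (hposL i hi).le (hcurve i hi)⟩
        · obtain ⟨i, hi, hbi⟩ := hbL hb'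
          exact ⟨i, hi, max_le hbi (hcurve i hi)⟩
      · intro _
        rw [discRadius_zero, mul_zero, sub_nonpos]
        exact F.h_mul_discRadius_le L (by linarith [F.capacity_ideal_add L])
    · rw [hcapS]; exact half hD
  · have hs : (Shape.hat ⟨F.tri p m, b, 0⟩).split d.leftCapacity d.rightCapacity =
        (⟨(F.tri p m).longChild d.leftCapacity, b, 0⟩,
        ⟨(F.tri p m).shortChild d.rightCapacity, (F.tri p m).shortCurve d.rightCapacity, 0⟩) := by
      simp only [Shape.split, Hat.split, hcase, if_false]
    obtain ⟨i, hi, hci⟩ := hcR (not_le.1 hcase)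
    have haR0 : 0 < d.rightCapacity :=
      (hposR i hi).trans_le ((le_totalSize hposR hi).trans hR)
    obtain ⟨capR, invR⟩ := F.packingInvariant_shortChild L hmp (size := size) haR
      ((F.tri p m).shortCurve_nonneg d.rightCapacity)
      (fun _ => ⟨i, hi, F.shortCurve_le L haR0 (hposR i hi).le hci⟩) hR
    refine ⟨perm, cap_add.trans hcapS.symm, ?_, ?_, ?_, ?_, ne_nil, fun hD => ?_, sublist⟩
    · rw [hs]; exact capL
    · rw [hs]; exact capR
    · rw [hs]; exact invR
    · rw [hs]
      refine F.validSplit_hat L hb0 haL haR cap_add hposL sorted hL hbL hc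
        (fun i hi => (hposL i hi).le) (fun hne => ?_) (fun _ => F.le_shortCurve L haR0 haR')
      rcases hb0.eq_or_lt with rfl | hb'
      · obtain ⟨i, hi⟩ := List.exists_mem_of_ne_nil _ hne
        exact ⟨i, hi, (hposL i hi).le⟩
      · exact hbL hb'
    · rw [hcapS]; exact half hD

end Frame

/-! ### The four cases of `Repack` on a triangle. -/

namespace Frame

variable (F : Frame) {p m h r : ℝ}

/-- In each case one curve condition is trivial, because that child does not exceed its ideal
capacity; only the larger child needs an argument. The largest circle always goes left, where it
takes care of the rounding `b`. -/
theorem goodDivision_divide (L : Legs p m h r) (hmp : m ≤ p) {size : ℕ → ℝ} {b : ℝ} (hb0 : 0 ≤ b)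
    {D : List ℕ} (hpos : ∀ i ∈ D, 0 < size i) (hs : D.Pairwise fun j k => size k ≤ size j)
    (hb : 0 < b → ∃ i ∈ D, b ≤ size i) (htot : totalSize size D ≤ Real.pi * r ^ 2) :
    GoodDivision size (.hat ⟨F.tri p m, b, 0⟩) D ((F.tri p m).divide size D) := by
  have hp := L.p_pos
  have hm := L.m_pos
  have hh := L.h_pos
  have hr := L.r_pos
  have hph := L.p_lt_h
  have hmh := L.m_lt_h
  have hadd := F.capacity_ideal_add L
  have hlong := F.capacity_idealLong L
  have hshort := F.capacity_idealShort L
  have hlong0 : 0 < (F.tri p m).idealLong.capacity := by rw [hlong]; positivity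
  have hshort0 : 0 < (F.tri p m).idealShort.capacity := by rw [hshort]; positivity
  have hcap := F.capacity_tri L
  have hsl : (F.tri p m).idealShort.capacity ≤ (F.tri p m).idealLong.capacity := by
    rw [hlong, hshort]; gcongr
  have trivialCurve : ∀ {a c : ℝ}, 0 ≤ a → a ≤ (F.tri p m).idealLong.capacity →
      h * discRadius a - p * r ≤ (h - p) * discRadius c := by
    intro a c ha hle
    have h1 := discRadius_mono hle
    rw [hlong, discRadius_pi_mul_sq (by positivity), div_mul_eq_mul_div, le_div_iff₀ hh] at h1
    have := mul_nonneg (sub_nonneg.2 hph.le) (discRadius_nonneg c)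
    linarith
  have head_max : ∀ {i : ℕ} {C : List ℕ}, D = i :: C → ∀ j ∈ D, size j ≤ size i := by
    rintro i C rfl j hj
    rcases List.mem_cons.1 hj with rfl | hj
    · exact le_rfl
    · exact (List.pairwise_cons.1 hs).1 j hj
  simp only [Triangle.divide, hcap, F.ratio_tri L]
  split_ifs with h1 h2 h3
  · -- the largest circle alone
    obtain ⟨i, hi, hlt⟩ := h1
    match D, hi with
    | c :: C, hi =>
      have hci := head_max rfl i hi
      have hc0 := hpos c (by simp)
      have hcA : size c ≤ Real.pi * r ^ 2 := (le_totalSize hpos (by simp)).trans htot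
      have hρ := discRadius_mono hcA
      rw [discRadius_pi_mul_sq hr.le] at hρ
      rw [totalSize_cons] at htot
      have et : totalSize size [c] = size c := by simp [totalSize]
      refine F.goodDivision_hat L hmp hb0 hpos hb ?_ ?_ ?_ ?_ ?_ ?_ ?_ ?_ ?_ ?_ ?_ ?_ <;>
        simp only [Division.tight, List.take_succ_cons, List.take_zero, List.drop_succ_cons,
          List.drop_zero, et]
      · exact List.Perm.refl _
      · ring
      · exact hc0
      · linarith
      · exact le_rfl
      · linarith
      · simp
      · exact List.sublist_cons_self _ _
      · exact fun _ => ⟨c, by simp, head_max rfl⟩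
      · intro j hj
        obtain rfl := List.mem_singleton.1 hj
        -- For a single circle of radius `ρ` the curve condition reduces to `p ρ ≤ p r`.
        have := mul_le_mul_of_nonneg_left hρ hp.le
        linarith
      · intro hlt'; linarith
      · exact fun hD => absurd hD (by simp)
  · -- everything on the left
    refine F.goodDivision_hat L hmp hb0 hpos hb ?_ ?_ ?_ ?_ ?_ ?_ ?_ ?_ ?_ ?_ ?_ ?_ <;> simp only
    · simp
    · exact hadd
    · exact hlong0
    · exact hshort0.le
    · exact h2
    · exact hshort0.le
    · exact hs
    · simp
    · intro hD
      match D, hD with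
      | c :: C, _ => exact ⟨c, by simp, head_max rfl⟩
    · exact fun i _ => trivialCurve hlong0.le le_rfl
    · exact fun hlt => absurd hlt (lt_irrefl _)
    · intro _; linarith
  · -- greedy filling
    push Not at h1 h2
    have hperm := greedyFill_perm (size := size) (cap := (F.tri p m).idealLong.capacity) 0 D
    have hsub := greedyFill_sublist (size := size) (cap := (F.tri p m).idealLong.capacity) 0 D
    have hle := greedyFill_le (size := size) hlong0.le D
    have hrej := fun i => lt_of_mem_greedyFill (cap := (F.tri p m).idealLong.capacity) 0 hpos
      (i := i)
    have hhead : ∃ c C, D = c :: C ∧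
        c ∈ (greedyFill size (F.tri p m).idealLong.capacity 0 D).1 := by
      match D with
      | [] => rw [totalSize_nil] at h2; linarith
      | c :: C => exact ⟨c, C, rfl, mem_greedyFill_head (by rw [zero_add]; exact h1 c (by simp))⟩
    set g := greedyFill size (F.tri p m).idealLong.capacity 0 D
    simp only [zero_add] at hle hrej
    obtain ⟨c, C, hD, hc⟩ := hhead
    have hposL : ∀ i ∈ g.1, 0 < size i := fun i hi => hpos i (hsub.1.subset hi)
    have hL0 := totalSize_pos hposL (List.ne_nil_of_mem hc)
    have htot' := totalSize_perm (size := size) hperm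
    rw [totalSize_append] at htot'
    refine F.goodDivision_hat L hmp hb0 hpos hb ?_ ?_ ?_ ?_ ?_ ?_ ?_ ?_ ?_ ?_ ?_ ?_ <;>
      simp only [Division.tight]
    · exact hperm
    · ring
    · exact hL0
    · linarith
    · exact le_rfl
    · linarith
    · exact hs.sublist hsub.1
    · exact hsub.2
    · exact fun _ => ⟨c, hc, head_max hD⟩
    · exact fun i _ => trivialCurve hL0.le hle
    · intro _
      have hne : g.2 ≠ [] := by
        intro hnil
        rw [hnil, totalSize_nil] at htot'
        linarith
      obtain ⟨i, hi⟩ := List.exists_mem_of_ne_nil _ hne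
      refine ⟨i, hi, ?_⟩
      have hA : 0 < Real.pi * r ^ 2 := by positivity
      set δ := ((F.tri p m).idealLong.capacity - totalSize size g.1) / (Real.pi * r ^ 2) with hδ
      have hδ0 : 0 ≤ δ := div_nonneg (by linarith) hA.le
      have hδA : (F.tri p m).idealLong.capacity - totalSize size g.1 = Real.pi * r ^ 2 * δ := by
        rw [hδ]; field_simp
      -- The right child has its ideal share plus the waste, a fraction `m²/h² + δ` of the capacity.
      -- The rejected circle `i` exceeds the waste, so its radius is at least `r √δ`.
      refine (L.curve_le_of_delta hδ0 h3 ?_).trans ?_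
      · rw [discRadius_sq (by linarith), div_eq_iff Real.pi_ne_zero]
        have e1 : (F.tri p m).idealShort.capacity = r ^ 2 * (m ^ 2 / h ^ 2) * Real.pi := by
          rw [hshort]; ring
        linear_combination hδA + e1 - hadd
      · have e2 : Real.pi * (r * Real.sqrt δ) ^ 2 ≤ size i := by
          rw [mul_pow, Real.sq_sqrt hδ0]
          linarith [hrej i hi]
        have e3 := discRadius_mono e2
        rw [discRadius_pi_mul_sq (by positivity)] at e3
        exact mul_le_mul_of_nonneg_left e3 (by linarith)
    · exact fun h => absurd h (by simp [hD])
  · -- the two largest circles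
    push Not at h1 h2 h3
    match D with
    | [] => rw [totalSize_nil] at h2; linarith
    | [c] =>
      have := h1 c (by simp)
      simp only [totalSize_cons, totalSize_nil, add_zero] at h2
      linarith
    | c₁ :: c₂ :: C =>
      have hA : 0 < Real.pi * r ^ 2 := by positivity
      have h12 : size c₂ ≤ size c₁ := head_max rfl c₂ (by simp)
      have hc₁ := hpos c₁ (by simp)
      have hc₂ := hpos c₂ (by simp)
      have hperm := greedyFill_perm (size := size) (cap := (F.tri p m).idealLong.capacity) 0
        (c₁ :: c₂ :: C)
      have hsub := greedyFill_sublist (size := size) (cap := (F.tri p m).idealLong.capacity) 0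
        (c₁ :: c₂ :: C)
      have hle := greedyFill_le (size := size) hlong0.le (c₁ :: c₂ :: C)
      have hrej := fun i => lt_of_mem_greedyFill (cap := (F.tri p m).idealLong.capacity) 0 hpos
        (i := i)
      have hmem₁ : c₁ ∈ (greedyFill size (F.tri p m).idealLong.capacity 0 (c₁ :: c₂ :: C)).1 :=
        mem_greedyFill_head (by rw [zero_add]; exact h1 c₁ (by simp))
      have hposL : ∀ i ∈ (greedyFill size (F.tri p m).idealLong.capacity 0 (c₁ :: c₂ :: C)).1,
        0 < size i := fun i hi => hpos i (hsub.1.subset hi)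
      have hc₁L := le_totalSize hposL hmem₁
      have htwo : size c₁ + size c₂ ≤ (F.tri p m).idealLong.capacity →
          size c₁ + size c₂ ≤
            totalSize size (greedyFill size (F.tri p m).idealLong.capacity 0 (c₁ :: c₂ :: C)).1 ∧
          ∀ i ∈ (greedyFill size (F.tri p m).idealLong.capacity 0 (c₁ :: c₂ :: C)).2,
            size i ≤ size c₂ := by
        intro H
        have H' : size c₁ ≤ (F.tri p m).idealLong.capacity := by linarith
        have hg : greedyFill size (F.tri p m).idealLong.capacity 0 (c₁ :: c₂ :: C) =
            (c₁ :: c₂ :: (greedyFill size (F.tri p m).idealLong.capacity (size c₁ + size c₂) C).1,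
              (greedyFill size (F.tri p m).idealLong.capacity (size c₁ + size c₂) C).2) := by
          simp [greedyFill, H, H']
        have hsub' := greedyFill_sublist (size := size) (cap := (F.tri p m).idealLong.capacity)
          (size c₁ + size c₂) C
        rw [hg]
        constructor
        · simp only [totalSize_cons]
          linarith [totalSize_nonneg (size := size) fun i hi => hpos i
            (List.mem_cons_of_mem _ (List.mem_cons_of_mem _ (hsub'.1.subset hi)))]
        · intro i hi
          exact (List.pairwise_cons.1 (List.pairwise_cons.1 hs).2).1 i (hsub'.2.subset hi)
      have htot' := totalSize_perm (size := size) hperm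
      rw [totalSize_append] at htot'
      set g := greedyFill size (F.tri p m).idealLong.capacity 0 (c₁ :: c₂ :: C)
      simp only [zero_add] at hle hrej
      have e1 : (F.tri p m).idealLong.capacity = p ^ 2 / h ^ 2 * (Real.pi * r ^ 2) := by
        rw [hlong]; ring
      set δ := ((F.tri p m).idealLong.capacity - totalSize size g.1) / (Real.pi * r ^ 2) with hδ
      have hδA : (F.tri p m).idealLong.capacity - totalSize size g.1 = δ * (Real.pi * r ^ 2) := by
        rw [hδ]; field_simp
      have hδ0 : 0 ≤ δ := div_nonneg (by linarith) hA.le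
      -- Otherwise both circles are on the left and at least as large as a rejected circle, which
      -- exceeds the waste `δ A`. The left part then exceeds `2 δ A` and the ideal capacity `3 δ A`,
      -- contrary to `le_three_delta`. So the left child is at least the ideal one and the right
      -- child needs no rounding.
      have hlarge : (F.tri p m).idealLong.capacity ≤ size c₁ + size c₂ := by
        by_contra! hlt
        obtain ⟨ht1, ht2⟩ := htwo hlt.le
        have hne : g.2 ≠ [] := by
          intro hnil
          rw [hnil, totalSize_nil] at htot'
          linarith
        obtain ⟨i, hi⟩ := List.exists_mem_of_ne_nil _ hne
        have h4 := hrej i hi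
        have h5 := ht2 i hi
        have h6 := L.le_three_delta hmp
        have h7 : p ^ 2 / h ^ 2 * (Real.pi * r ^ 2) ≤ 3 * δ * (Real.pi * r ^ 2) :=
          mul_le_mul_of_nonneg_right (by linarith) hA.le
        linarith
      simp only [totalSize_cons] at htot
      have hC := totalSize_nonneg (size := size) (C := C) fun i hi => hpos i
        (List.mem_cons_of_mem _ (List.mem_cons_of_mem _ hi))
      have et : totalSize size [c₁, c₂] = size c₁ + size c₂ := by simp [totalSize]
      -- The bound on `c₁` holds because the greedy filling contains `c₁` and has total size `(p²/h²
      -- - δ) A`.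
      have hcurve := L.curve_le_of_two rfl h3 hc₂.le h12 (by linarith) (by linarith)
      refine F.goodDivision_hat L hmp hb0 hpos hb ?_ ?_ ?_ ?_ ?_ ?_ ?_ ?_ ?_ ?_ ?_ ?_ <;>
        simp only [Division.tight, List.take_succ_cons, List.take_zero, List.drop_succ_cons,
          List.drop_zero, et]
      · exact List.Perm.refl _
      · ring
      · linarith
      · linarith
      · exact le_rfl
      · linarith
      · simpa using h12
      · exact (List.sublist_cons_self _ _).trans (List.sublist_cons_self _ _)
      · exact fun _ => ⟨c₁, by simp, head_max rfl⟩
      · intro j hj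
        have hj' : size c₂ ≤ size j := by
          rcases List.mem_cons.1 hj with rfl | hj
          · exact h12
          · rw [List.mem_singleton.1 hj]
        exact hcurve.trans (mul_le_mul_of_nonneg_left (discRadius_mono hj') (by linarith))
      · intro hlt; linarith
      · exact fun h => absurd h (by simp)

end Frame

/-- `Repack` works on semihats that satisfy the Packing Invariant. -/
theorem goodDivision_semihat {size : ℕ → ℝ} {H : Hat} {D : List ℕ} (hpos : ∀ i ∈ D, 0 < size i)
    (hs : D.Pairwise fun j k => size k ≤ size j) (hinv : PackingInvariant size (.hat H) D) :
    GoodDivision size (.hat H) D (H.tri.divide size D) := by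
  obtain ⟨⟨⟨hT, hb0, hS⟩, hb⟩, htot⟩ := hinv
  obtain ⟨T, b, b'⟩ := H
  simp only at hT hb0 hS hb
  subst hS
  change totalSize size D ≤ T.capacity at htot
  rcases (dist_nonneg (x := T.right) (y := T.short)).eq_or_lt with h0 | h0
  · have e := Triangle.eq_point hT h0.symm
    rw [e, Triangle.capacity_point] at htot
    obtain rfl := eq_nil_of_totalSize_le hpos htot
    rw [e]
    exact goodDivision_point
  · obtain ⟨F, p, m, h, r, L, hmp, rfl⟩ := Triangle.exists_frame hT h0
    rw [F.capacity_tri L] at htot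
    exact F.goodDivision_divide L hmp hb0 hpos hs hb htot

/-! ### `Repack` on a square. -/

section GreedyRemove

variable {size : ℕ → ℝ} {a : ℝ}

theorem greedyRemove_perm (t : ℝ) (C : List ℕ) :
    ((greedyRemove size a t C).1 ++ (greedyRemove size a t C).2).Perm C := by
  induction C generalizing t with
  | nil => simp [greedyRemove]
  | cons i C ih =>
    rw [greedyRemove]
    split
    · exact List.perm_middle.trans ((ih _).cons i)
    · simpa using ih _

theorem greedyRemove_sublist (t : ℝ) (C : List ℕ) :
    (greedyRemove size a t C).1.Sublist C ∧ (greedyRemove size a t C).2.Sublist C := by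
  induction C generalizing t with
  | nil => simp [greedyRemove]
  | cons i C ih =>
    rw [greedyRemove]
    split
    · exact ⟨(ih _).1.cons i, (ih _).2.cons_cons i⟩
    · exact ⟨(ih _).1.cons_cons i, (ih _).2.cons i⟩

theorem le_greedyRemove {t : ℝ} (ht : a ≤ t) (C : List ℕ) :
    a ≤ t - totalSize size (greedyRemove size a t C).2 := by
  induction C generalizing t with
  | nil => simpa [greedyRemove, totalSize]
  | cons i C ih =>
    rw [greedyRemove]
    split
    · rename_i h
      have := ih h
      simp only [totalSize_cons]; linarith
    · exact ih ht

/-- Later removals only lower the left total, so a circle that had to stay cannot be removed at the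
end. Every circle on the left thus exceeds the excess over half the capacity. -/
theorem lt_of_mem_greedyRemove (t : ℝ) {C : List ℕ} (hpos : ∀ i ∈ C, 0 < size i) {i : ℕ}
    (hi : i ∈ (greedyRemove size a t C).1) :
    t - totalSize size (greedyRemove size a t C).2 - size i < a := by
  induction C generalizing t with
  | nil => simp [greedyRemove] at hi
  | cons j C ih =>
    have hpos' : ∀ i ∈ C, 0 < size i := fun k hk => hpos k (List.mem_cons_of_mem _ hk)
    have hsub := greedyRemove_sublist (size := size) (a := a) t C
    rw [greedyRemove] at hi ⊢
    split at hi
    · rename_i h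
      have := ih (t - size j) hpos' hi
      simp only [h, if_true, totalSize_cons]; linarith
    · rename_i h
      simp only [h, if_false]
      rcases List.mem_cons.1 hi with rfl | hi
      · have := totalSize_nonneg (size := size) fun k hk => hpos' k (hsub.2.subset hk)
        linarith
      · exact ih t hpos' hi

end GreedyRemove

namespace Frame

variable (F : Frame) {l h r : ℝ}

/-- The square with a corner at the origin and sides `l` along the axes. -/
noncomputable def square (l : ℝ) : Square := ⟨F.pt 0 0, F.pt l 0, F.pt 0 l⟩

/-- The frame at the opposite corner of a square. -/
noncomputable def opposite (l : ℝ) : Frame :=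
  ⟨F.pt l l, -F.e₁, -F.e₂, by rw [norm_neg, F.norm₁], by rw [norm_neg, F.norm₂],
    by rw [inner_neg_neg, F.orth]⟩

theorem opposite_u (l : ℝ) (x : Plane) : (F.opposite l).u x = l - F.u x := by
  rw [u]
  simp only [opposite, inner_neg_left, inner_e₁_sub, u_pt]
  ring

theorem opposite_v (l : ℝ) (x : Plane) : (F.opposite l).v x = l - F.v x := by
  rw [v]
  simp only [opposite, inner_neg_left, inner_e₂_sub, v_pt]
  ring

theorem square_half₁ (l : ℝ) : (F.square l).half₁ = F.tri l l := rfl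

theorem square_half₂ (l : ℝ) : (F.square l).half₂ = (F.opposite l).tri l l := by
  simp only [Square.half₂, Square.opposite, square, tri, opposite, pt, Triangle.mk.injEq]
  refine ⟨by module, by module, by module⟩

theorem square_opposite (l : ℝ) : (F.square l).opposite = (F.opposite l).pt 0 0 := by
  have := congrArg Triangle.right (F.square_half₂ l)
  exact this

theorem mem_region_square (hl : 0 < l) {x : Plane} :
    x ∈ (F.square l).region ↔ (0 ≤ F.u x ∧ F.u x ≤ l) ∧ 0 ≤ F.v x ∧ F.v x ≤ l := by
  constructor
  · rintro ⟨s, t, ⟨hs0, hs1⟩, ⟨ht0, ht1⟩, rfl⟩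
    simp only [u_comb, v_comb, square, u_pt, v_pt]
    refine ⟨⟨?_, ?_⟩, ?_, ?_⟩ <;> nlinarith
  · rintro ⟨⟨hs0, hs1⟩, ht0, ht1⟩
    refine ⟨F.u x / l, F.v x / l, ⟨by positivity, (div_le_one hl).2 hs1⟩,
      ⟨by positivity, (div_le_one hl).2 ht1⟩, ?_⟩
    apply F.ext_uv
    · simp only [u_comb, square, u_pt]; field_simp; ring
    · simp only [v_comb, square, v_pt]; field_simp; ring

theorem capacity_square (L : Legs l l h r) : (F.square l).capacity = 2 * (Real.pi * r ^ 2) := by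
  rw [Square.capacity, square_half₁, square_half₂, capacity_tri _ L, capacity_tri _ L]; ring

theorem scale_tri (κ : ℝ) (p m : ℝ) : (F.tri p m).scale (F.pt 0 0) κ = F.tri (κ * p) (κ * m) := by
  simp only [Triangle.scale, tri, Triangle.mk.injEq]
  refine ⟨?_, ?_, ?_⟩ <;> apply F.ext_uv <;> simp [u_comb, v_comb]

theorem leftChild_square (L : Legs l l h r) (a : ℝ) :
    (F.square l).leftChild a = F.tri (discRadius a / r * l) (discRadius a / r * l) := by
  rw [Square.leftChild, square_half₁, F.capacity_tri L, sqrt_div_pi_mul_sq _ L.r_pos.le]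
  exact F.scale_tri _ _ _

theorem rightChild_square (L : Legs l l h r) (a : ℝ) :
    (F.square l).rightChild a =
      (F.opposite l).tri (discRadius a / r * l) (discRadius a / r * l) := by
  rw [Square.rightChild, square_half₂, capacity_tri _ L, sqrt_div_pi_mul_sq _ L.r_pos.le,
    square_opposite]
  exact scale_tri _ _ _ _

/-- A disc in the left child does not reach beyond the square, if it is large enough. -/
theorem u_le_of_left (L : Legs l l h r) {κ ρ : ℝ} (hκ : 0 < κ) {x : Plane} (hv : ρ ≤ F.v x)
    (hw : ρ ≤ F.w (κ * l) (κ * l) (κ * h) x) (hρ : l * (κ * r - r) ≤ (h - l) * ρ) :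
    F.u x ≤ l - ρ := by
  have hl := L.p_pos
  have e := F.h_mul_w (L.scale hκ) x
  have e1 : h * F.w (κ * l) (κ * l) (κ * h) x = l * (κ * l - F.u x - F.v x) := by
    apply mul_left_cancel₀ hκ.ne'
    linear_combination e
  have e2 := mul_le_mul_of_nonneg_left hw L.h_pos.le
  have e3 : l * l * (κ - 1) ≤ h * ρ := by
    apply le_of_mul_le_mul_left _ L.r_pos
    have e4 : h * r = l * (h - l) := by linear_combination h / 2 * L.two_r - L.sq / 2
    have e5 := mul_le_mul_of_nonneg_left hρ hl.le
    linear_combination e5 - ρ * e4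
  apply le_of_mul_le_mul_left _ hl
  have e6 := mul_le_mul_of_nonneg_left hv hl.le
  linear_combination e6 + e3 + e2 + e1

theorem curve_square_le (L : Legs l l h r) {a c : ℝ} (ha : 0 < a) (hc : 0 ≤ c)
    (hac : l * (discRadius a - r) ≤ (h - l) * discRadius c) : (F.square l).curve a ≤ c := by
  refine csInf_le ⟨0, fun _ hb => hb.1⟩ ⟨hc, fun x hx => ?_⟩
  have hr := L.r_pos
  have hκ := div_pos (discRadius_pos ha) hr
  rw [F.leftChild_square L] at hx
  rw [← div_mul_cancel₀ (discRadius a) hr.ne'] at hac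
  have h1 := (F.mem_region_tri (L.scale hκ)).1 hx.1.1
  obtain ⟨z, hz1, hz2, hz3⟩ := (F.mem_roundedAngle_long (L.scale hκ)).1 hx.1.2
  obtain ⟨y, hy1, hy2, hy3⟩ := (F.mem_roundedAngle_short (L.scale hκ)).1 hx.2
  have hz := F.u_le_of_left L hκ hz2 hz3 hac
  have hy := F.swap.u_le_of_left L hκ hy2 (by rwa [swap_w]) hac
  rw [swap_u] at hy
  refine (F.mem_region_square L.p_pos).2 ⟨⟨h1.1, ?_⟩, h1.2.1, ?_⟩
  · have := F.u_ge_sub_dist z x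
    rw [dist_comm] at this; linarith
  · have := F.v_ge_sub_dist y x
    rw [dist_comm] at this; linarith

/-- The left and the right child of a square are on different sides of a diagonal. -/
theorem dist_ge_of_square_children (L : Legs l l h r) {κ₁ κ₂ ρ₁ ρ₂ : ℝ} (hκ₁ : 0 < κ₁)
    (hκ₂ : 0 < κ₂) (hκ : κ₁ + κ₂ ≤ 2) {x y : Plane}
    (hx : ρ₁ ≤ F.w (κ₁ * l) (κ₁ * l) (κ₁ * h) x)
    (hy : ρ₂ ≤ (F.opposite l).w (κ₂ * l) (κ₂ * l) (κ₂ * h) y) : ρ₁ + ρ₂ ≤ dist x y := by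
  have hl := L.p_pos
  have hh := L.h_pos
  refine F.disjoint_of_halfPlanes (α := l / h) (β := l / h) (γ := -(κ₁ * l * l / h)) ?_ ?_ ?_
  · field_simp; linear_combination -L.sq
  · have e : F.w (κ₁ * l) (κ₁ * l) (κ₁ * h) x =
        -(l / h * F.u x + l / h * F.v x + -(κ₁ * l * l / h)) := by
      rw [w]; field_simp; ring
    linarith
  · have e : (F.opposite l).w (κ₂ * l) (κ₂ * l) (κ₂ * h) y =
        (l / h * F.u y + l / h * F.v y) - (2 - κ₂) * l * l / h := by
      rw [w, opposite_u, opposite_v]; field_simp; ring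
    have : κ₁ * l * l / h ≤ (2 - κ₂) * l * l / h := by
      gcongr; linarith
    linarith

/-- The scale factors satisfy `κ₁² + κ₂² ≤ 2`, hence `κ₁ + κ₂ ≤ 2`, and a parallel to the diagonal
separates the children. The right child lies in the square because its factor is at most `1`. -/
theorem validSplit_square (L : Legs l l h r) {size : ℕ → ℝ} {aL aR : ℝ} (haL : 0 < aL)
    (haR : 0 ≤ aR) (ha : aL + aR = 2 * (Real.pi * r ^ 2)) (hle : aR ≤ Real.pi * r ^ 2)
    {CL : List ℕ} (hpos : ∀ i ∈ CL, 0 < size i) (hs : CL.Pairwise fun j k => size k ≤ size j)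
    (htot : totalSize size CL ≤ aL)
    (hc : ∀ i ∈ CL, l * (discRadius aL - r) ≤ (h - l) * discRadius (size i)) :
    ValidSplit size (F.square l).region ((F.square l).split aL aR) aR CL := by
  have hl := L.p_pos
  have hr := L.r_pos
  have hκ := div_pos (discRadius_pos haL) hr
  have hκr : discRadius aL / r * r = discRadius aL := div_mul_cancel₀ _ hr.ne'
  have P := F.packed_splitPack (L.scale hκ) hpos hs
    (by rwa [hκr, pi_mul_discRadius_sq haL.le])
  have eL := F.leftChild_square L aL
  have eR := F.rightChild_square L aR
  have hsum : (discRadius aL / r) ^ 2 + (discRadius aR / r) ^ 2 ≤ 2 := by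
    rw [div_pow, div_pow, ← add_div, div_le_iff₀ (by positivity)]
    apply le_of_mul_le_mul_left _ Real.pi_pos
    rw [mul_add, pi_mul_discRadius_sq haL.le, pi_mul_discRadius_sq haR, ha]
    linarith
  have hκκ : discRadius aL / r + discRadius aR / r ≤ 2 := by
    nlinarith [sq_nonneg (discRadius aL / r - 1), sq_nonneg (discRadius aR / r - 1)]
  have hκ₂ : discRadius aR / r ≤ 1 := by
    rw [div_le_one hr, ← discRadius_pi_mul_sq hr.le]
    exact discRadius_mono hle
  simp only [Square.split, Triangle.full, eL, eR]
  refine ⟨P.perm, ?_, P.sep, ?_, ?_⟩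
  · intro q hq
    have hqC : q.1 ∈ CL := P.perm.subset (List.mem_map_of_mem hq)
    have hρ := discRadius_nonneg (size q.1)
    have hW := P.within q hq
    have hcq := F.curve_square_le L haL (hpos _ hqC).le (hc _ hqC)
    have hc' := hc _ hqC
    rw [← hκr] at hc'
    have hu := F.u_le_of_left L hκ hW.2.1 hW.2.2 hc'
    have hv := F.swap.u_le_of_left L hκ hW.1 (by rw [swap_w]; exact hW.2.2) hc'
    rw [swap_u] at hv
    refine Set.subset_inter (Set.subset_inter (Set.subset_inter ?_ ?_) ?_) ?_
    · exact (closedBall_subset_region _ (L.scale hκ) hρ).2 hW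
    · exact closedBall_subset_roundedAngle_long _ (L.scale hκ) hcq hW
    · exact closedBall_subset_roundedAngle_short _ (L.scale hκ) hcq hW
    · intro x hx
      have h1 := (F.closedBall_u hρ).2 hW.1 x hx
      have h2 := (F.closedBall_v hρ).2 hW.2.1 x hx
      rw [mem_closedBall, dist_comm] at hx
      have h3 := F.u_ge_sub_dist q.2 x
      have h4 := F.v_ge_sub_dist q.2 x
      exact (F.mem_region_square hl).2 ⟨⟨h1, by linarith⟩, h2, by linarith⟩
  · intro haR x hx
    have hκ0 := div_pos (discRadius_pos haR) hr
    have h1 := (mem_region_tri _ (L.scale hκ0)).1 hx.1.1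
    have h2 := (F.opposite l).h_mul_w (L.scale hκ0) x
    rw [opposite_u, opposite_v] at h1 h2
    have h3 : F.u x ≤ l := by linarith
    have h4 : F.v x ≤ l := by linarith
    have h5 : 0 ≤ discRadius aR / r * l * (discRadius aR / r * l - (l - F.u x) - (l - F.v x)) := by
      have := mul_nonneg (mul_pos hκ0 L.h_pos).le h1.2.2
      rw [h2] at this
      linarith
    have h6 := nonneg_of_mul_nonneg_right h5 (mul_pos hκ0 hl)
    have h7 : discRadius aR / r * l ≤ 1 * l := by gcongr
    exact (F.mem_region_square hl).2 ⟨⟨by linarith, h3⟩, by linarith, h4⟩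
  · intro haR q hq z ρ hρ hz
    have hκ0 := div_pos (discRadius_pos haR) hr
    have h1 := hz.trans (Set.inter_subset_left.trans Set.inter_subset_left)
    rw [closedBall_subset_region _ (L.scale hκ0) hρ] at h1
    exact F.dist_ge_of_square_children L hκ hκ0 hκκ (P.within q hq).2.2 h1.2.2

end Frame

theorem Legs.curve_le_of_square {l h r : ℝ} (L : Legs l l h r) {ρ ρ₁ : ℝ} (hρ : 0 ≤ ρ)
    (h₁ : r ≤ ρ₁) (h₂ : ρ₁ ^ 2 ≤ 2 * r ^ 2) (hlt : ρ₁ ^ 2 - ρ ^ 2 ≤ r ^ 2) :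
    l * (ρ₁ - r) ≤ (h - l) * ρ := by
  have hl := L.p_pos
  have hh := L.h_pos
  have hr := L.r_pos
  have hlh := L.p_lt_h
  have e1 : ρ₁ * l ≤ h * r := by
    apply (abs_le_of_sq_le_sq' _ (by positivity)).2
    nlinarith [L.sq]
  -- By `h² = 2l²` this is equivalent to `ρ₁ l ≤ h r`. Multiplied by `ρ₁ - r` it bounds the square
  -- of the claim's left side by `(h - l)² (ρ₁² - r²)`.
  have e2 : l ^ 2 * (ρ₁ - r) ≤ (h - l) ^ 2 * (ρ₁ + r) := by
    have := mul_le_mul_of_nonneg_left e1 (sub_nonneg.2 hlh.le)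
    nlinarith [L.sq]
  have e3 := mul_le_mul_of_nonneg_left e2 (sub_nonneg.2 h₁)
  have e4 := mul_le_mul_of_nonneg_left hlt (sq_nonneg (h - l))
  apply (abs_le_of_sq_le_sq' _ (mul_nonneg (by linarith) hρ)).2
  linear_combination e3 + e4

namespace Frame

variable (F : Frame) {l h r : ℝ}

theorem rightChild_square_spec (L : Legs l l h r) {a : ℝ} (ha : 0 ≤ a) :
    ((F.square l).rightChild a).capacity = a ∧ ((F.square l).rightChild a).IsRightAngled := by
  rcases ha.eq_or_lt with rfl | ha
  · rw [Square.rightChild, zero_div, Real.sqrt_zero, Triangle.scale_zero]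
    exact ⟨Triangle.capacity_point _, Triangle.point_isRightAngled _⟩
  · have hκ := div_pos (discRadius_pos ha) L.r_pos
    rw [F.rightChild_square L, capacity_tri _ (L.scale hκ), div_mul_cancel₀ _ L.r_pos.ne',
      pi_mul_discRadius_sq ha.le]
    exact ⟨rfl, tri_isRightAngled _ (L.scale hκ) le_rfl⟩

theorem capacity_leftChild_square (L : Legs l l h r) {a : ℝ} (ha : 0 < a) :
    ((F.square l).leftChild a).capacity = a := by
  have hκ := div_pos (discRadius_pos ha) L.r_pos
  rw [F.leftChild_square L, capacity_tri _ (L.scale hκ), div_mul_cancel₀ _ L.r_pos.ne',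
    pi_mul_discRadius_sq ha.le]

theorem goodDivision_square (L : Legs l l h r) {size : ℕ → ℝ} {D : List ℕ}
    (hpos : ∀ i ∈ D, 0 < size i) (hs : D.Pairwise fun j k => size k ≤ size j)
    (htot : totalSize size D ≤ 2 * (Real.pi * r ^ 2)) :
    GoodDivision size (.square (F.square l)) D ((F.square l).divide size D) := by
  have hr := L.r_pos
  have hA : 0 < Real.pi * r ^ 2 := by positivity
  have hcap := F.capacity_square L
  have hcapS : (Shape.square (F.square l)).capacity = 2 * (Real.pi * r ^ 2) := hcap
  have ehalf : 2 * (Real.pi * r ^ 2) / 2 = Real.pi * r ^ 2 := by ring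
  simp only [Square.divide, hcap, ehalf]
  split_ifs with h1
  · have hperm := greedyRemove_perm (size := size) (a := Real.pi * r ^ 2) (totalSize size D) D
    have hsub := greedyRemove_sublist (size := size) (a := Real.pi * r ^ 2) (totalSize size D) D
    have hle := le_greedyRemove (size := size) h1.le D
    have hlt := fun i => lt_of_mem_greedyRemove (a := Real.pi * r ^ 2) (totalSize size D) hpos
      (i := i)
    set g := greedyRemove size (Real.pi * r ^ 2) (totalSize size D) D
    have htot' := totalSize_perm (size := size) hperm
    rw [totalSize_append] at htot'
    have hposR : ∀ i ∈ g.2, 0 < size i := fun i hi => hpos i (hsub.2.subset hi)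
    have hposL : ∀ i ∈ g.1, 0 < size i := fun i hi => hpos i (hsub.1.subset hi)
    have hR0 := totalSize_nonneg hposR
    have haL : 0 < totalSize size g.1 := by linarith
    have haR : 0 ≤ 2 * (Real.pi * r ^ 2) - totalSize size g.1 := by linarith
    obtain ⟨capR, rightR⟩ := F.rightChild_square_spec L haR
    refine ⟨hperm, ?_, ?_, ?_, ?_, ?_, ?_, ?_, hsub.2⟩ <;> simp only [Division.tight, hcapS]
    · ring
    · exact F.capacity_leftChild_square L haL
    · exact capR
    · refine ⟨⟨⟨rightR, le_rfl, rfl⟩, fun h => absurd h (lt_irrefl _)⟩, ?_⟩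
      change _ ≤ ((F.square l).rightChild _).capacity
      rw [capR]; linarith
    · refine F.validSplit_square L haL haR (by ring) (by linarith) hposL (hs.sublist hsub.1)
        le_rfl fun i hi => ?_
      have e := pi_mul_discRadius_sq haL.le
      have ei := pi_mul_discRadius_sq (hposL i hi).le
      refine L.curve_le_of_square (discRadius_nonneg _) ?_ ?_ ?_
      · rw [← discRadius_pi_mul_sq hr.le]
        exact discRadius_mono (by linarith)
      · apply le_of_mul_le_mul_left _ Real.pi_pos
        linarith
      · apply le_of_mul_le_mul_left _ Real.pi_pos
        linarith [hlt i hi]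
    · intro _ hnil
      rw [hnil, totalSize_nil] at haL
      exact lt_irrefl _ haL
    · rintro rfl
      rw [totalSize_nil] at h1
      linarith
  · push Not at h1
    obtain ⟨capR, rightR⟩ := F.rightChild_square_spec L hA.le
    refine ⟨by simp, ?_, ?_, ?_, ?_, ?_, ?_, ?_, by simp⟩ <;> simp only [hcapS]
    · ring
    · exact F.capacity_leftChild_square L hA
    · exact capR
    · exact packingInvariant_nil rightR rfl rfl (capR.symm ▸ hA.le)
    · refine F.validSplit_square L hA hA.le (by ring) le_rfl hpos hs h1 fun i hi => ?_
      rw [discRadius_pi_mul_sq hr.le, sub_self, mul_zero]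
      exact mul_nonneg (by linarith [L.p_lt_h]) (discRadius_nonneg _)
    · exact id
    · intro _; linarith

end Frame

theorem Square.exists_frame {Q : Square} (hQ : Q.IsSquare) :
    ∃ (F : Frame) (l h r : ℝ), Legs l l h r ∧ Q = F.square l := by
  obtain ⟨h1, h2, h3⟩ := hQ
  have hT : Q.half₁.IsRightAngled := ⟨h1, 1, le_rfl, by rw [one_mul]; exact h2⟩
  obtain ⟨F, p, m, h, r, L, -, e⟩ := Triangle.exists_frame hT (by rw [h2] at h3; exact h3)
  have ep : dist Q.corner Q.adj₁ = p := by
    have := F.dist_right_long (m := m) L.p_pos.le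
    rwa [← e] at this
  have em : dist Q.corner Q.adj₂ = m := by
    have := F.dist_right_short (p := p) L.m_pos.le
    rwa [← e] at this
  obtain rfl : p = m := by rw [← ep, ← em, h2]
  refine ⟨F, p, h, r, L, ?_⟩
  obtain ⟨a, b, c⟩ := Q
  simp only [Square.half₁, Frame.tri, Triangle.mk.injEq] at e
  simp only [Frame.square, Square.mk.injEq]
  exact e

/-- `Repack` works on nodes that satisfy the Packing Invariant. -/
theorem goodDivision {size : ℕ → ℝ} {S : Shape} {D : List ℕ} (hpos : ∀ i ∈ D, 0 < size i)
    (hs : D.Pairwise fun j k => size k ≤ size j) (hinv : PackingInvariant size S D) :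
    GoodDivision size S D (S.divide size D) := by
  match S with
  | .hat H => exact goodDivision_semihat hpos hs hinv
  | .square Q =>
    obtain ⟨hQ, htot⟩ := hinv
    obtain ⟨F, l, h, r, L, rfl⟩ := Square.exists_frame hQ
    change _ ≤ (F.square l).capacity at htot
    rw [F.capacity_square L] at htot
    exact F.goodDivision_square L hpos hs htot

/-! ### The invariant of the tree -/

/-- The level `l` has been created by `Repack` from some of its circles, and `l'` is the next
level. -/
def Level.Linked (size : ℕ → ℝ) (l l' : Level) : Prop :=
  ∃ D : List ℕ, D ⊆ l.circles ∧ (D.Pairwise fun j k => size k ≤ size j) ∧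
    PackingInvariant size l.node D ∧
    l.left = (repackLevel size l.node D).left ∧
    l.leftCircles = (repackLevel size l.node D).leftCircles ∧
    l.placed = (repackLevel size l.node D).placed ∧
    l'.node = (repackRight size l.node D).1 ∧
    l.circles.Perm (l.leftCircles ++ l'.circles)

/-- The invariant of the Online Split Packing Algorithm. -/
structure PackTree.Valid (size : ℕ → ℝ) (T : PackTree) : Prop where
  nodup : ∀ n, (T n).circles.Nodup
  pos : ∀ n, ∀ i ∈ (T n).circles, 0 < size i
  inv : T.PackingInvariantHolds size
  linked : ∀ n, (T n).Linked size (T (n + 1))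
  finite : ∃ N, ∀ n, N ≤ n → (T n).circles = []

theorem PackingInvariant.mono {size : ℕ → ℝ} {S : Shape} {C C' : List ℕ}
    (h : PackingInvariant size S C) (hC : C ⊆ C') (htot : totalSize size C' ≤ S.capacity) :
    PackingInvariant size S C' := by
  obtain ⟨h1, -⟩ := h
  refine ⟨?_, htot⟩
  match S, h1 with
  | .square Q, h1 => exact h1
  | .hat H, h1 =>
    refine ⟨h1.1, fun hb => ?_⟩
    obtain ⟨i, hi, hbi⟩ := h1.2 hb
    exact ⟨i, hC hi, hbi⟩

/-! ### Trees built by `Repack`. -/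

/-- The circles and the node to which `Repack` can be applied. -/
structure Repackable (size : ℕ → ℝ) (S : Shape) (C : List ℕ) : Prop where
  nodup : C.Nodup
  pos : ∀ i ∈ C, 0 < size i
  sorted : C.Pairwise fun j k => size k ≤ size j
  inv : PackingInvariant size S C

namespace Repackable

variable {size : ℕ → ℝ} {S : Shape} {C : List ℕ}

theorem good (h : Repackable size S C) : GoodDivision size S C (S.divide size C) :=
  goodDivision h.pos h.sorted h.inv

theorem right (h : Repackable size S C) :
    Repackable size (repackRight size S C).1 (repackRight size S C).2 :=
  ⟨h.nodup.sublist h.good.sublist, fun i hi => h.pos i (h.good.sublist.subset hi),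
    h.sorted.sublist h.good.sublist, h.good.inv⟩

theorem level (h : Repackable size S C) (n : ℕ) : Repackable size (repack size S C n).node
    (repack size S C n).circles := by
  induction n generalizing S C with
  | zero => exact h
  | succ n ih => exact ih h.right

/-- As long as circles remain, each level puts at least one of them on the left. -/
theorem circles_eq_nil (h : Repackable size S C) {n : ℕ} (hn : C.length ≤ n) :
    (repack size S C n).circles = [] := by
  induction n generalizing S C with
  | zero => exact List.length_eq_zero_iff.1 (Nat.le_zero.1 hn)
  | succ n ih =>
    refine ih h.right ?_
    have hperm := h.good.perm.length_eq
    rw [List.length_append] at hperm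
    change (S.divide size C).rightCircles.length ≤ n
    by_cases hC : C = []
    · subst hC
      rw [List.length_nil] at hperm
      omega
    · have := List.length_pos_iff.2 (h.good.ne_nil hC)
      omega

theorem linked (h : Repackable size S C) (n : ℕ) :
    (repack size S C n).Linked size (repack size S C (n + 1)) := by
  induction n generalizing S C with
  | zero => exact ⟨C, List.Subset.refl _, h.sorted, h.inv, rfl, rfl, rfl, rfl, h.good.perm.symm⟩
  | succ n ih => exact ih h.right

theorem valid (h : Repackable size S C) : (repack size S C).Valid size :=
  ⟨fun n => (h.level n).nodup, fun n => (h.level n).pos, fun n => (h.level n).inv, h.linked,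
    C.length, fun _ hn => h.circles_eq_nil hn⟩

end Repackable

/-! ### Placements along the right spine. -/

/-- What the invariant says about two consecutive levels. -/
structure Level.Good (size : ℕ → ℝ) (l l' : Level) : Prop where
  circles_perm : l.circles.Perm (l.leftCircles ++ l'.circles)
  cap_add : l.left.tri.capacity + l'.node.capacity = l.node.capacity
  half : l.circles = [] → l'.node.capacity ≤ l.node.capacity / 2
  perm : (l.placed.map Prod.fst).Perm l.leftCircles
  subset : ∀ q ∈ l.placed, closedBall q.2 (discRadius (size q.1)) ⊆ l.left.region ∩ l.node.region
  sep : l.placed.Pairwise fun a b =>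
    discRadius (size a.1) + discRadius (size b.1) ≤ dist a.2 b.2
  right_subset : 0 < l'.node.capacity → l'.node.region ⊆ l.node.region
  right_sep : 0 < l'.node.capacity → ∀ q ∈ l.placed, ∀ (z : Plane) (ρ : ℝ), 0 ≤ ρ →
    closedBall z ρ ⊆ l'.node.region → discRadius (size q.1) + ρ ≤ dist q.2 z

/-- The left child and the next node date from the last `Repack`, so `goodDivision` is applied to
the remembered list `D`, although `l.circles` may have grown since. -/
theorem Level.Linked.good {size : ℕ → ℝ} {l l' : Level} (h : l.Linked size l')
    (hpos : ∀ i ∈ l.circles, 0 < size i) : l.Good size l' := by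
  obtain ⟨D, hD, hs, hinv, h1, h2, h3, h4, h5⟩ := h
  have G := goodDivision (fun i hi => hpos i (hD hi)) hs hinv
  have hcap : l'.node.capacity = (l.node.divide size D).rightCapacity := by
    rw [h4]; exact G.cap_right
  refine ⟨h5, ?_, ?_, ?_, ?_, ?_, ?_, ?_⟩
  · rw [hcap, h1, ← G.cap_add]
    exact congrArg (· + _) G.cap_left
  · intro hnil
    rw [hcap]
    rw [hnil] at hD
    exact G.half (List.subset_nil.1 hD)
  · rw [h3, h2]; exact G.valid.perm
  · rw [h3, h1]; exact G.valid.subset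
  · rw [h3]; exact G.valid.sep
  · rw [hcap, h4]; exact G.valid.right_subset
  · rw [hcap, h4, h3]; exact G.valid.right_sep

namespace PackTree

variable {size : ℕ → ℝ} {T : PackTree}

theorem Valid.good (h : T.Valid size) (n : ℕ) : (T n).Good size (T (n + 1)) :=
  (h.linked n).good (h.pos n)

theorem Valid.tail (h : T.Valid size) : T.tail.Valid size := by
  obtain ⟨N, hN⟩ := h.finite
  exact ⟨fun n => h.nodup _, fun n => h.pos _, fun n => h.inv _, fun n => h.linked _,
    N, fun n hn => hN _ (by omega)⟩

theorem Valid.cons {l : Level} {R : PackTree} (hR : R.Valid size) (nodup : l.circles.Nodup)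
    (pos : ∀ i ∈ l.circles, 0 < size i) (inv : PackingInvariant size l.node l.circles)
    (linked : l.Linked size (R 0)) : (PackTree.cons l R).Valid size := by
  obtain ⟨N, hN⟩ := hR.finite
  refine ⟨?_, ?_, ?_, ?_, N + 1, ?_⟩
  · rintro (_ | n)
    exacts [nodup, hR.nodup n]
  · rintro (_ | n)
    exacts [pos, hR.pos n]
  · rintro (_ | n)
    exacts [inv, hR.inv n]
  · rintro (_ | n)
    exacts [linked, hR.linked n]
  · rintro (_ | n) hn
    · omega
    · exact hN n (by omega)

theorem Valid.subset (h : T.Valid size) {n m : ℕ} (hnm : n ≤ m) :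
    (T m).circles ⊆ (T n).circles := by
  induction m, hnm using Nat.le_induction with
  | base => exact List.Subset.refl _
  | succ m _ ih =>
    exact fun i hi => ih ((h.good m).circles_perm.symm.subset (List.mem_append_right _ hi))

theorem Valid.leftCircles_subset (h : T.Valid size) (n : ℕ) :
    (T n).leftCircles ⊆ (T n).circles :=
  fun _ hi => (h.good n).circles_perm.symm.subset (List.mem_append_left _ hi)

/-- Provides the hypothesis of `right_subset` and `right_sep`, which say nothing about degenerate
nodes. -/
theorem Valid.capacity_pos (h : T.Valid size) {n i : ℕ} (hi : i ∈ (T n).circles) :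
    0 < (T n).node.capacity :=
  ((h.pos n i hi).trans_le (le_totalSize (h.pos n) hi)).trans_le (h.inv n).2

theorem Valid.region_subset (h : T.Valid size) {n m i : ℕ} (hnm : n ≤ m)
    (hi : i ∈ (T m).circles) : (T m).node.region ⊆ (T n).node.region := by
  induction m, hnm using Nat.le_induction with
  | base => exact subset_rfl
  | succ m _ ih =>
    exact ((h.good m).right_subset (h.capacity_pos hi)).trans (ih (h.subset m.le_succ hi))

theorem Valid.mem_leftCircles (h : T.Valid size) {n i : ℕ} {p : Plane}
    (hi : (i, p) ∈ (T n).placed) : i ∈ (T n).leftCircles := (h.good n).perm.subset (List.mem_map_of_mem hi)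

theorem Valid.mem_circles_of_placedIn (h : T.Valid size) {n i : ℕ} {p : Plane}
    (hi : T.PlacedIn n i p) : i ∈ (T n).circles := by
  obtain ⟨m, hnm, hm⟩ := hi
  exact h.subset hnm (h.leftCircles_subset m (h.mem_leftCircles hm))

theorem Valid.exists_placed (h : T.Valid size) {n i : ℕ} (hi : i ∈ (T n).leftCircles) :
    ∃ p, (i, p) ∈ (T n).placed := by
  have := (h.good n).perm.symm.subset hi
  obtain ⟨⟨j, p⟩, hq, rfl⟩ := List.mem_map.1 this
  exact ⟨p, hq⟩

theorem Valid.exists_placedIn (h : T.Valid size) {n i : ℕ} (hi : i ∈ (T n).circles) :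
    ∃ p, T.PlacedIn n i p := by
  obtain ⟨N, hN⟩ := h.finite
  have main : ∀ k n, N ≤ n + k → i ∈ (T n).circles → ∃ p, T.PlacedIn n i p := by
    intro k
    induction k with
    | zero =>
      intro n hn hi
      rw [hN n hn] at hi
      simp at hi
    | succ k ih =>
      intro n hn hi
      rcases List.mem_append.1 ((h.good n).circles_perm.subset hi) with hi | hi
      · obtain ⟨p, hp⟩ := h.exists_placed hi
        exact ⟨p, n, le_rfl, hp⟩
      · obtain ⟨p, m, hm, hp⟩ := ih (n + 1) (by omega) hi
        exact ⟨p, m, by omega, hp⟩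
  exact main N n (by omega) hi

theorem Valid.placed_unique (h : T.Valid size) {n i : ℕ} {p p' : Plane}
    (hp : (i, p) ∈ (T n).placed) (hp' : (i, p') ∈ (T n).placed) : p = p' := by
  have hnd := (List.nodup_append.1 ((h.good n).circles_perm.nodup_iff.1 (h.nodup n))).1
  rw [← (h.good n).perm.nodup_iff] at hnd
  have := List.inj_on_of_nodup_map hnd hp hp' rfl
  exact (Prod.mk.inj this).2

theorem Valid.not_mem_of_lt (h : T.Valid size) {n m i : ℕ} (hnm : n < m)
    (hi : i ∈ (T n).leftCircles) : i ∉ (T m).circles := by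
  intro hm
  have := List.disjoint_of_nodup_append ((h.good n).circles_perm.nodup_iff.1 (h.nodup n))
  exact this hi (h.subset hnm hm)

theorem Valid.placedIn_unique (h : T.Valid size) {n i : ℕ} {p p' : Plane}
    (hp : T.PlacedIn n i p) (hp' : T.PlacedIn n i p') : p = p' := by
  obtain ⟨m, -, hm⟩ := hp
  obtain ⟨m', -, hm'⟩ := hp'
  have h1 := h.mem_leftCircles hm
  have h2 := h.mem_leftCircles hm'
  rcases lt_trichotomy m m' with hlt | rfl | hlt
  · exact absurd (h.leftCircles_subset _ h2) (h.not_mem_of_lt hlt h1)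
  · exact h.placed_unique hm hm'
  · exact absurd (h.leftCircles_subset _ h1) (h.not_mem_of_lt hlt h2)

theorem Valid.placed_sep (h : T.Valid size) {n i j : ℕ} {p q : Plane} (hij : i ≠ j)
    (hp : (i, p) ∈ (T n).placed) (hq : (j, q) ∈ (T n).placed) :
    discRadius (size i) + discRadius (size j) ≤ dist p q := by
  -- The symmetry allows the pairwise statement to be used irrespective of the order in the list.
  have : Std.Symm fun a b : ℕ × Plane =>
      discRadius (size a.1) + discRadius (size b.1) ≤ dist a.2 b.2 :=
    ⟨fun a b hab => by rwa [dist_comm, add_comm]⟩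
  exact (h.good n).sep.forall hp hq fun e => hij (Prod.mk.inj e).1

theorem Valid.placed_sep_of_lt (h : T.Valid size) {n m i j : ℕ} {p q : Plane} (hnm : n < m)
    (hp : (i, p) ∈ (T n).placed) (hq : (j, q) ∈ (T m).placed) :
    discRadius (size i) + discRadius (size j) ≤ dist p q := by
  have hj := h.leftCircles_subset _ (h.mem_leftCircles hq)
  refine (h.good n).right_sep (h.capacity_pos (h.subset hnm hj)) _ hp _ _ (discRadius_nonneg _) ?_
  exact (((h.good m).subset _ hq).trans Set.inter_subset_right).trans (h.region_subset hnm hj)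

theorem Valid.placedIn_sep (h : T.Valid size) {n i j : ℕ} {p q : Plane} (hij : i ≠ j)
    (hp : T.PlacedIn n i p) (hq : T.PlacedIn n j q) :
    discRadius (size i) + discRadius (size j) ≤ dist p q := by
  obtain ⟨m, -, hm⟩ := hp
  obtain ⟨m', -, hm'⟩ := hq
  rcases lt_trichotomy m m' with hlt | rfl | hlt
  · exact h.placed_sep_of_lt hlt hm hm'
  · exact h.placed_sep hij hm hm'
  · rw [dist_comm, add_comm]
    exact h.placed_sep_of_lt hlt hm' hm

end PackTree

theorem ValidlyPacked.of_placement {size : ℕ → ℝ} {R : Set Plane} {C : List ℕ}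
    {P : ℕ → Plane → Prop} (mem : ∀ i p, P i p → i ∈ C) (ex : ∀ i ∈ C, ∃ p, P i p)
    (unique : ∀ i p p', P i p → P i p' → p = p')
    (subset : ∀ i p, P i p → closedBall p (discRadius (size i)) ⊆ R)
    (sep : ∀ i j p q, i ≠ j → P i p → P j q →
      discRadius (size i) + discRadius (size j) ≤ dist p q) :
    ValidlyPacked size R C P := by
  classical
  refine ⟨fun i => if h : i ∈ C then (ex i h).choose else 0, ?_, ?_, ?_⟩
  · intro i p
    constructor
    · intro hp
      have hi := mem i p hp
      simp only [hi, dif_pos, true_and]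
      exact unique i _ _ hp (ex i hi).choose_spec
    · rintro ⟨hi, rfl⟩
      simp only [hi, dif_pos]
      exact (ex i hi).choose_spec
  · intro i hi
    simp only [hi, dif_pos]
    exact subset i _ (ex i hi).choose_spec
  · intro i hi j hj hij
    simp only [hi, hj, dif_pos]
    exact ball_disjoint_ball (sep i j _ _ hij (ex i hi).choose_spec (ex j hj).choose_spec)

namespace PackTree

variable {size : ℕ → ℝ} {T T' : PackTree}

theorem Valid.allValidlyPacked (h : T.Valid size) : T.AllValidlyPacked size := by
  intro n
  constructor
  · refine .of_placement (fun i p => h.mem_circles_of_placedIn) (fun i => h.exists_placedIn)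
      (fun i p p' => h.placedIn_unique) (fun i p hp => ?_) fun i j p q => h.placedIn_sep
    obtain ⟨m, hnm, hm⟩ := hp
    exact (((h.good m).subset _ hm).trans Set.inter_subset_right).trans
      (h.region_subset hnm (h.leftCircles_subset _ (h.mem_leftCircles hm)))
  · exact .of_placement (fun i p => h.mem_leftCircles) (fun i => h.exists_placed)
      (fun i p p' => h.placed_unique)
      (fun i p hp => ((h.good n).subset _ hp).trans Set.inter_subset_left)
      fun i j p q => h.placed_sep

/-! ### Insertion: preservation of the invariant and termination. -/

/-- Insertion preserves the invariant. -/
theorem Valid.insert {i : ℕ} (hi : 0 < size i) (ins : InsertCircle size i T T')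
    (h : T.Valid size) (hmem : i ∉ (T 0).circles)
    (hcap : totalSize size (T 0).circles + size i ≤ (T 0).node.capacity) :
    T'.Valid size ∧ (T' 0).node = (T 0).node ∧ (T' 0).circles.Perm (i :: (T 0).circles) := by
  induction ins with
  | recurse T R hrec _ ih =>
    have G := h.good 0
    have htot : totalSize size (T 0).circles =
        totalSize size (T 0).leftCircles + totalSize size (T 1).circles := by
      rw [totalSize_perm G.circles_perm, totalSize_append]
    -- In a tight shape all the free capacity is that of the right child; otherwise the recursion
    -- condition itself says that the circle fits.
    have hcap1 : totalSize size (T 1).circles + size i ≤ (T 1).node.capacity := by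
      rcases hrec with ht | hlt
      · have := G.cap_add
        rw [Level.IsTight] at ht
        rw [zero_add] at this
        linarith
      · exact hlt.le
    obtain ⟨hR, hnode, hperm⟩ := ih h.tail (fun hi1 => hmem (h.subset (Nat.zero_le 1) hi1)) hcap1
    refine ⟨hR.cons ?_ ?_ ?_ ?_, rfl, List.Perm.refl _⟩
    · exact List.nodup_cons.2 ⟨hmem, h.nodup 0⟩
    · intro j hj
      rcases List.mem_cons.1 hj with rfl | hj
      · exact hi
      · exact h.pos 0 j hj
    · refine (h.inv 0).mono (List.subset_cons_self _ _) ?_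
      rw [totalSize_cons]; linarith
    -- The same `D` still accounts for the left child, because the recursion changes neither it nor
    -- the shape of the right child.
    · obtain ⟨D, hD, hs, hinv, h1, h2, h3, h4, h5⟩ := h.linked 0
      refine ⟨D, fun j hj => List.mem_cons_of_mem _ (hD hj), hs, hinv, h1, h2, h3,
        hnode.trans h4, ?_⟩
      exact ((h5.cons i).trans List.perm_middle.symm).trans
        (hperm.symm.append_left _)
  | repack T C _ hC hsort =>
    refine ⟨Repackable.valid ⟨?_, ?_, hsort, ?_⟩, rfl, hC⟩
    · exact hC.nodup_iff.2 (List.nodup_cons.2 ⟨hmem, h.nodup 0⟩)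
    · intro j hj
      rcases List.mem_cons.1 (hC.subset hj) with rfl | hj
      · exact hi
      · exact h.pos 0 j hj
    · refine (h.inv 0).mono (fun j hj => hC.symm.subset (List.mem_cons_of_mem _ hj)) ?_
      rw [totalSize_perm hC, totalSize_cons]; linarith

theorem exists_repack {i : ℕ} (h : ¬ T.Recurses size i) : ∃ T', InsertCircle size i T T' := by
  refine ⟨_, .repack T ((i :: (T 0).circles).mergeSort fun j k => size k ≤ size j) h
    (List.mergeSort_perm _ _) ?_⟩
  have := List.pairwise_mergeSort (le := fun j k => decide (size k ≤ size j))
    (by simp only [decide_eq_true_eq]; exact fun a b c hab hbc => hbc.trans hab)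
    (by simp only [Bool.or_eq_true, decide_eq_true_eq]; exact fun a b => le_total _ _)
    (i :: (T 0).circles)
  simpa only [decide_eq_true_eq] using this

/-- Insertions terminate. -/
theorem Valid.exists_insert {i : ℕ} (hi : 0 < size i) (h : T.Valid size)
    (hcap : totalSize size (T 0).circles + size i ≤ (T 0).node.capacity) :
    ∃ T', InsertCircle size i T T' := by
  -- If the subtree at depth `n` does not recurse, the insertion stops there or earlier.
  have descend : ∀ (n : ℕ) (T : PackTree), ¬ PackTree.Recurses size i (fun k => T (n + k)) →
      ∃ T', InsertCircle size i T T' := by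
    intro n
    induction n with
    | zero =>
      intro T hT
      simp only [zero_add] at hT
      exact exists_repack hT
    | succ n ih =>
      intro T hT
      by_cases hrec : T.Recurses size i
      · obtain ⟨R, hR⟩ := ih T.tail (by
          have e : (fun k => T (n + 1 + k)) = fun k => T.tail (n + k) := by
            funext k; simp only [PackTree.tail]; congr 1; omega
          rwa [e] at hT)
        exact ⟨_, .recurse T R hrec hR⟩
      · exact exists_repack hrec
  -- If every level recursed, the circle would fit into every node of the spine. But from some level
  -- on the nodes are empty and each has at most half the capacity of its predecessor.
  by_contra hno
  have hall : ∀ n, PackTree.Recurses size i (fun k => T (n + k)) := fun n => by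
    by_contra hn
    exact hno (descend n T hn)
  have hcapn : ∀ n, totalSize size (T n).circles + size i ≤ (T n).node.capacity := by
    intro n
    induction n with
    | zero => exact hcap
    | succ n ih =>
      have G := h.good n
      have htot : totalSize size (T n).circles =
          totalSize size (T n).leftCircles + totalSize size (T (n + 1)).circles := by
        rw [totalSize_perm G.circles_perm, totalSize_append]
      rcases hall n with ht | hlt
      · have := G.cap_add
        change totalSize size (T n).leftCircles = (T n).left.tri.capacity at ht
        linarith
      · exact hlt.le
  obtain ⟨N, hN⟩ := h.finite
  have hhalf : ∀ k, (T (N + k)).node.capacity ≤ (T N).node.capacity / 2 ^ k := by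
    intro k
    induction k with
    | zero => simp
    | succ k ih =>
      have h1 := (h.good (N + k)).half (hN _ (by omega))
      rw [pow_succ, ← div_div]
      change (T (N + k + 1)).node.capacity ≤ _
      linarith
  obtain ⟨k, hk⟩ := pow_unbounded_of_one_lt ((T N).node.capacity / size i) one_lt_two
  have h1 := hcapn (N + k)
  have h2 := hhalf k
  have h3 := totalSize_nonneg (h.pos (N + k))
  rw [div_lt_iff₀ hi, ← div_lt_iff₀' (by positivity)] at hk
  linarith

end PackTree

/-! ### Runs of the algorithm from a root. -/

theorem totalSize_range (size : ℕ → ℝ) (k : ℕ) :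
    totalSize size (List.range k) = ∑ i ∈ Finset.range k, size i := by
  induction k with
  | zero => simp [totalSize]
  | succ k ih =>
    rw [List.range_succ, totalSize_append, ih, Finset.sum_range_succ, totalSize_cons, totalSize_nil,
      add_zero]

theorem Triangle.capacity_nonneg (T : Triangle) : 0 ≤ T.capacity :=
  mul_nonneg Real.pi_pos.le (sq_nonneg _)

theorem Shape.capacity_nonneg (S : Shape) : 0 ≤ S.capacity := by
  match S with
  | .square Q => exact add_nonneg (Triangle.capacity_nonneg _) (Triangle.capacity_nonneg _)
  | .hat H => exact Triangle.capacity_nonneg _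

theorem Shape.IsRoot.repackable {root : Shape} (h : root.IsRoot) (size : ℕ → ℝ) :
    Repackable size root [] := by
  refine ⟨List.nodup_nil, by simp, List.Pairwise.nil, ?_⟩
  have hc := root.capacity_nonneg
  match root, h with
  | .square Q, h => exact ⟨h, hc⟩
  | .hat H, ⟨h1, _, h3⟩ =>
    have hL : H.bLong = 0 := by rw [h3]; rfl
    have hS : H.bShort = 0 := by rw [h3]; rfl
    exact packingInvariant_nil h1 hL hS hc

section Run

variable {size : ℕ → ℝ} {root : Shape} {N : ℕ}

theorem sum_add_le (hpos : ∀ k < N, 0 < size k)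
    (htot : ∑ k ∈ Finset.range N, size k ≤ root.capacity) {k : ℕ} (hk : k < N) :
    totalSize size (List.range k) + size k ≤ root.capacity := by
  rw [totalSize_range, ← Finset.sum_range_succ]
  refine le_trans (Finset.sum_le_sum_of_subset_of_nonneg ?_ ?_) htot
  · intro i hi
    rw [Finset.mem_range] at hi ⊢
    omega
  · intro i hi _
    exact (hpos i (Finset.mem_range.1 hi)).le

theorem Run.valid (hroot : root.IsRoot) (hpos : ∀ k < N, 0 < size k)
    (htot : ∑ k ∈ Finset.range N, size k ≤ root.capacity) {k : ℕ} (hk : k ≤ N) {T : PackTree}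
    (hrun : Run size root k T) :
    T.Valid size ∧ (T 0).node = root ∧ (T 0).circles.Perm (List.range k) := by
  induction hrun with
  | init => exact ⟨(hroot.repackable size).valid, rfl, List.Perm.refl _⟩
  | insert k T T' _ hi ih =>
    obtain ⟨hT, hnode, hperm⟩ := ih (by omega)
    obtain ⟨hT', hnode', hperm'⟩ := hT.insert (hpos k (by omega)) hi
      (fun hmem => by simpa using hperm.subset hmem)
      (by rw [totalSize_perm hperm, hnode]; exact sum_add_le hpos htot (by omega))
    refine ⟨hT', hnode'.trans hnode, hperm'.trans ((hperm.cons k).trans ?_)⟩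
    rw [List.range_succ]
    exact (List.perm_append_singleton _ _).symm

theorem Run.exists_insert (hroot : root.IsRoot) (hpos : ∀ k < N, 0 < size k)
    (htot : ∑ k ∈ Finset.range N, size k ≤ root.capacity) {k : ℕ} (hk : k < N) {T : PackTree}
    (hrun : Run size root k T) : ∃ T', InsertCircle size k T T' := by
  obtain ⟨hT, hnode, hperm⟩ := hrun.valid hroot hpos htot hk.le
  refine hT.exists_insert (hpos k hk) ?_
  rw [totalSize_perm hperm, hnode]
  exact sum_add_le hpos htot hk

theorem Run.exists_run (hroot : root.IsRoot) (hpos : ∀ k < N, 0 < size k)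
    (htot : ∑ k ∈ Finset.range N, size k ≤ root.capacity) {k : ℕ} (hk : k ≤ N) :
    ∃ T, Run size root k T := by
  induction k with
  | zero => exact ⟨_, .init⟩
  | succ k ih =>
    obtain ⟨T, hT⟩ := ih (by omega)
    obtain ⟨T', hT'⟩ := hT.exists_insert hroot hpos htot hk
    exact ⟨T', .insert k T T' hT hT'⟩

end Run

theorem hasPackingDensity {root : Shape} (hroot : root.IsRoot) :
    HasPackingDensity root root.capacity := by
  intro size N hpos htot k hk
  refine ⟨Run.exists_run hroot hpos htot hk, fun T hT => ?_⟩
  obtain ⟨hV, hnode, hperm⟩ := hT.valid hroot hpos htot hk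
  refine ⟨fun hk' => hT.exists_insert hroot hpos htot hk', ?_⟩
  obtain ⟨c, h1, h2, h3⟩ := (hV.allValidlyPacked 0).1
  rw [hnode] at h2
  have hm : ∀ i, i ∈ List.range k ↔ i ∈ (T 0).circles := fun i => hperm.mem_iff.symm
  exact ⟨c, fun i p => by rw [hm]; exact h1 i p, fun i hi => h2 i ((hm i).1 hi),
    fun i hi j hj => h3 i ((hm i).1 hi) j ((hm j).1 hj)⟩

/-- An algorithm of packing density `A` shows that circles of total area `A` can be packed. -/
theorem HasPackingDensity.canPack {root : Shape} {A : ℝ} (h : HasPackingDensity root A) {n : ℕ}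
    {area : Fin n → ℝ} (hpos : ∀ i, 0 < area i) (htot : ∑ i, area i ≤ A) :
    CanPack root.region area := by
  -- The value `0` is harmless: positivity is only required of the first `n` circles.
  set size : ℕ → ℝ := fun k => if hk : k < n then area ⟨k, hk⟩ else 0 with hsize
  have hs : ∀ i : Fin n, size i = area i := fun i => by simp [hsize]
  obtain ⟨⟨T, hT⟩, H⟩ := h size n (fun k hk => by simp [hsize, hk, hpos])
    (by rw [Finset.sum_range]; simpa only [hs] using htot) n le_rfl
  obtain ⟨c, -, h2, h3⟩ := (H T hT).2
  refine ⟨fun i => c i, fun i => ?_, fun i j hij => ?_⟩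
  · rw [← hs]; exact h2 i (by simp)
  · rw [← hs, ← hs]
    exact h3 i (by simp) j (by simp) fun e => hij (Fin.ext e)

/-! ### Upper bounds for the critical density -/

namespace Frame

variable (F : Frame) {p m h r l : ℝ}

/-- The distances from the sides, weighted by the side lengths, add up to twice the area, which is
also `r (p + m + h)`. -/
theorem Within.le_inradius (L : Legs p m h r) {ρ : ℝ} {x : Plane} (hx : F.Within p m h ρ x) :
    ρ ≤ r := by
  obtain ⟨h1, h2, h3⟩ := hx
  have hp := L.p_pos
  have hm := L.m_pos
  have hh := L.h_pos
  have e := F.h_mul_w L x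
  have e1 := mul_le_mul_of_nonneg_left h1 hm.le
  have e2 := mul_le_mul_of_nonneg_left h2 hp.le
  have e3 := mul_le_mul_of_nonneg_left h3 hh.le
  apply le_of_mul_le_mul_right (a := p + m + h) _ (by positivity)
  linear_combination e1 + e2 + e3 + e - L.r_mul

/-- Two equal circles in a square are not larger than the incircles of its halves. -/
theorem le_of_two_in_square (L : Legs l l h r) {ρ : ℝ} (hρ : 0 < ρ) {x y : Plane}
    (hx : closedBall x ρ ⊆ (F.square l).region) (hy : closedBall y ρ ⊆ (F.square l).region)
    (hxy : Disjoint (ball x ρ) (ball y ρ)) : ρ ≤ r := by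
  have hl := L.p_pos
  have hlh := L.p_lt_h
  have hr := L.two_r
  have bounds : ∀ z, closedBall z ρ ⊆ (F.square l).region →
      (ρ ≤ F.u z ∧ F.u z ≤ l - ρ) ∧ ρ ≤ F.v z ∧ F.v z ≤ l - ρ := by
    intro z hz
    have hz' := fun x (hx : x ∈ closedBall z ρ) => (F.mem_region_square hl).1 (hz hx)
    have h1 := (F.closedBall_u hρ.le).1 fun x hx => (hz' x hx).1.1
    have h2 := ((F.opposite l).closedBall_u (z := z) hρ.le).1 fun x hx => by
      rw [opposite_u]; linarith [(hz' x hx).1.2]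
    have h3 := (F.closedBall_v hρ.le).1 fun x hx => (hz' x hx).2.1
    have h4 := ((F.opposite l).closedBall_v (z := z) hρ.le).1 fun x hx => by
      rw [opposite_v]; linarith [(hz' x hx).2.2]
    rw [opposite_u] at h2
    rw [opposite_v] at h4
    exact ⟨⟨h1, by linarith⟩, h3, by linarith⟩
  obtain ⟨⟨a1, a2⟩, a3, a4⟩ := bounds x hx
  obtain ⟨⟨b1, b2⟩, b3, b4⟩ := bounds y hy
  have hd := (disjoint_ball_ball_iff hρ hρ).1 hxy
  have hd2 : (ρ + ρ) ^ 2 ≤ dist x y ^ 2 := pow_le_pow_left₀ (by positivity) hd 2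
  rw [F.dist_sq] at hd2
  have hu : (F.u x - F.u y) ^ 2 ≤ (l - 2 * ρ) ^ 2 :=
    sq_le_sq' (by linarith) (by linarith)
  have hv : (F.v x - F.v y) ^ 2 ≤ (l - 2 * ρ) ^ 2 :=
    sq_le_sq' (by linarith) (by linarith)
  by_contra! hlt
  -- The centres lie in a square of side `l - 2ρ` at distance at least `2ρ`. If `ρ > r`, that side
  -- is less than `l - 2r = h - l`, and `(2r)² = 2 (h - l)²` gives a contradiction.
  have h5 : (l - 2 * ρ) ^ 2 ≤ (h - l) ^ 2 := sq_le_sq' (by linarith) (by linarith)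
  have h6 : r ^ 2 < ρ ^ 2 := pow_lt_pow_left₀ hlt L.r_pos.le two_ne_zero
  have h7 : (2 * r) ^ 2 = 2 * (h - l) ^ 2 := by rw [hr]; linear_combination -L.sq
  nlinarith

end Frame

/-- The extremal families are one circle of size `A` in a triangle and two circles of size `A / 2`
in a square. -/
theorem Shape.IsRoot.le_capacity {root : Shape} (h : root.IsRoot) {A : ℝ}
    (hA : ∀ (n : ℕ) (area : Fin n → ℝ), (∀ i, 0 < area i) → ∑ i, area i ≤ A →
      CanPack root.region area) : A ≤ root.capacity := by
  by_contra! hlt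
  have hA0 : 0 < A := root.capacity_nonneg.trans_lt hlt
  match root, h with
  | .hat H, ⟨h1, h2, h3⟩ =>
    obtain ⟨F, p, m, h, r, L, -, e⟩ := Triangle.exists_frame h1 h2
    obtain ⟨c, hc, -⟩ := hA 1 (fun _ => A) (fun _ => hA0) (by simp)
    have hin : closedBall (c 0) (discRadius A) ⊆ (F.tri p m).region := by
      rw [← e]
      exact (hc 0).trans (Set.inter_subset_left.trans Set.inter_subset_left)
    rw [F.closedBall_subset_region L (discRadius_nonneg A)] at hin
    have hle := hin.le_inradius F L
    change H.tri.capacity < A at hlt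
    rw [e, F.capacity_tri L, ← pi_mul_discRadius_sq hA0.le] at hlt
    have := discRadius_nonneg A
    exact absurd hlt (not_lt.2 (by gcongr))
  | .square Q, h =>
    obtain ⟨F, l, h, r, L, rfl⟩ := Square.exists_frame h
    obtain ⟨c, hc, hd⟩ := hA 2 (fun _ => A / 2) (fun _ => by positivity)
      (by rw [Fin.sum_univ_two, add_halves])
    have hle := F.le_of_two_in_square L (discRadius_pos (half_pos hA0)) (hc 0) (hc 1)
      (hd 0 1 (by decide))
    change (F.square l).capacity < A at hlt
    have e := pi_mul_discRadius_sq (half_pos hA0).le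
    rw [F.capacity_square L] at hlt
    have := discRadius_nonneg (A / 2)
    have : Real.pi * discRadius (A / 2) ^ 2 ≤ Real.pi * r ^ 2 := by gcongr
    linarith

end CirclePacking

theorem mainTheorem1 (root : Shape) (hroot : root.IsRoot) :
    -- the capacity used by the algorithm is the critical density of the root
    IsCriticalDensity root.region root.capacity ∧
    -- for every sequence of insertions within the capacity of the root
    (∀ (size : ℕ → ℝ) (N : ℕ), (∀ k < N, 0 < size k) →
      ∑ k ∈ Finset.range N, size k ≤ root.capacity →
      ∀ k ≤ N,
        (∃ T, Run size root k T) ∧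
        ∀ T, Run size root k T →
          (k < N → ∃ T', InsertCircle size k T T') ∧
          (T 0).node = root ∧
          (T 0).circles.Perm (List.range k) ∧
          T.AllValidlyPacked size ∧
          T.PackingInvariantHolds size) ∧
    -- the algorithm packs to critical density
    HasPackingDensity root root.capacity := by
  have hdens := hasPackingDensity hroot
  refine ⟨⟨fun n area hpos htot => hdens.canPack hpos htot, fun A hA => hroot.le_capacity hA⟩,
    fun size N hpos htot k hk => ⟨Run.exists_run hroot hpos htot hk, fun T hT => ?_⟩, hdens⟩
  obtain ⟨hV, hnode, hperm⟩ := hT.valid hroot hpos htot hk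
  exact ⟨fun hk' => hT.exists_insert hroot hpos htot hk', hnode, hperm, hV.allValidlyPacked, hV.inv⟩
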